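/- Let $\alpha\in(0,1)\cup(1,\infty)$. For an $n$-qubit state $\rho$ let $S_\alpha(\rho)=\frac{1}{1-\alpha}\log\operatorname{tr}(\rho^\alpha)$ be the quantum $\alpha$-Rényi entropy and put $\eta=\frac{\operatorname{tr}(\rho^\alpha)^{-1}}{|1-\alpha|}$. A purified query oracle of $\rho$ is a unitary $U_\rho$ on registers $A$ ($n$ qubits) and $B$ ($n'$ qubits) such that $|\Psi_\rho\rangle=U_\rho|0\rangle_A|0\rangle_B$ satisfies $\operatorname{tr}_B|\Psi_\rho\rangle\langle\Psi_\rho|=\rho$. Let $\widehat U_\rho$ be the qubitized block encoding of $\rho$: with a further $n$-qubit register $S$, $\widehat U_\rho=(2|0\rangle\langle 0|_{AB}-I)\,U_\rho^\dagger\,\mathrm{SWAP}_{AS}\,U_\rho$, where $U_\rho$ acts on $A,B$. A quantum phase processing (QPP) circuit $\mathcal A$ prepares $|0\rangle|0\rangle_{AB}|\Psi_\rho\rangle_{SB'}$, the first qubit being a single ancilla, with one query to $U_\rho$, and then applies $$R_z(\omega)R_y(\theta_0)R_z(\phi_0)\prod_{l=1}^{L}C_l\,R_y(\theta_l)R_z(\phi_l),$$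 where the rotations act on the ancilla and $C_l$ is $\widehat U_\rho^\dagger$ controlled on ancilla value $0$ for odd $l$, and $\widehat U_\rho$ controlled on ancilla value $1$ for even $l$. The number $L$ and the angles may be chosen freely. Each $C_l$ costs one query to $U_\rho$ and one to $U_\rho^\dagger$. An estimation algorithm repeatedly runs circuits on the all-zero state, measures only the ancilla qubit, may choose the next circuit depending on the earlier outcomes, and finally outputs a real number. It may depend on $\alpha,\gamma,\varepsilon,\delta$, but not on $\rho$, $U_\rho$, $n$, $n'$ or $\eta$. In the single-qubit measurement setting the circuits are QPP circuits. In the amplitude estimation setting the circuits are $G^k\mathcal A$, where $\mathcal A$ is a QPP circuit, $k\ge 0$, and $G=\mathcal A(2|0\rangle\langle 0|-I)\mathcal A^\dagger\,((I-2|1\rangle\langle1|)\otimes I)$ is the Grover operator, whose rightmost factor acts on the ancilla. Let $\delta\in(0,1)$, $M>0$, $\gamma>0$ and $\varepsilon>0$ with $|1-\alpha|\varepsilon\le M$. In each setting there is an algorithm which, for every state $\rho$ whose nonzero eigenvalues are all at least $\gamma$ and every purified query oracle $U_\rho$ of $\rho$, with probability at least $1-\delta$ outputs an estimate of $S_\alpha(\rho)$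 with error at most $\varepsilon$ and makes in total a number of queries to $U_\rho$ and $U_\rho^\dagger$ of at most * by single-qubit measurement: $\widetilde O\!\left(\frac{\eta^2}{\gamma^{3-2\alpha}\varepsilon^2}\right)$ if $\alpha\in(0,1)$, and $\widetilde O\!\left(\frac{(\alpha\gamma+1)\,\eta^2}{\gamma\varepsilon^2}\right)$ if $\alpha>1$; * by amplitude estimation: $\widetilde O\!\left(\frac{\eta}{\gamma^{2-\alpha}\varepsilon}\right)$ if $\alpha\in(0,1)$, and $\widetilde O\!\left(\frac{(\alpha\gamma+1)\,\eta}{\gamma\varepsilon}\right)$ if $\alpha>1$. Here $\widetilde O(f)$ stands for $C\,f\,\log^k(2+f)$, where $k$ is an absolute constant and $C$ depends only on $\delta$ and $M$. -/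

import Mathlib

open Matrix
open scoped Kronecker ComplexOrder

noncomputable section

/-! ### Quantum states, purified oracles and Rényi entropy -/

/-- Computational basis of an `n`-qubit register; `0` is the all-zero bit string. -/
abbrev Reg (n : ℕ) : Type := Fin n → Fin 2

/-- Density matrices. -/
def IsDensityMatrix {X : Type*} [Fintype X] [DecidableEq X] (ρ : Matrix X X ℂ) : Prop :=
  ρ.PosSemidef ∧ ρ.trace = 1

/-- `U` is a purified query oracle of the `n`-qubit state `ρ`: the reduced state on the first
register `A` of `|Ψ⟩ = U |0⟩_A |0⟩_B` is `ρ`, that is `tr_B |Ψ⟩⟨Ψ| = ρ`. -/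
def IsPurifiedOracle {n m : ℕ} (U : unitaryGroup (Reg n × Reg m) ℂ)
    (ρ : Matrix (Reg n) (Reg n) ℂ) : Prop :=
  ∀ i j : Reg n,
    ρ i j = ∑ b : Reg m, (U : Matrix (Reg n × Reg m) (Reg n × Reg m) ℂ) (i, b) (0, 0) *
      star ((U : Matrix (Reg n × Reg m) (Reg n × Reg m) ℂ) (j, b) (0, 0))

/-- `tr(ρ ^ α)`, the power being taken by functional calculus. -/
def tracePow {X : Type*} [Fintype X] [DecidableEq X] (α : ℝ) (ρ : Matrix X X ℂ) : ℝ :=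
  (cfc (fun x : ℝ => x ^ α) ρ).trace.re

/-- The quantum `α`-Rényi entropy `S_α(ρ) = (1 - α)⁻¹ log tr(ρ ^ α)`. -/
def renyiEntropy {X : Type*} [Fintype X] [DecidableEq X] (α : ℝ) (ρ : Matrix X X ℂ) : ℝ :=
  1 / (1 - α) * Real.log (tracePow α ρ)

/-- `η = tr(ρ ^ α)⁻¹ / |1 - α|`. -/
def renyiEta {X : Type*} [Fintype X] [DecidableEq X] (α : ℝ) (ρ : Matrix X X ℂ) : ℝ :=
  (tracePow α ρ)⁻¹ / |1 - α|

/-! ### Elementary unitaries -/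

/-- The rotation `R_z(φ) = diag(e^{-iφ/2}, e^{iφ/2})`. -/
def Rz (φ : ℝ) : unitaryGroup (Fin 2) ℂ :=
  ⟨!![Complex.exp (-(((φ / 2 : ℝ) : ℂ) * Complex.I)), 0;
      0, Complex.exp (((φ / 2 : ℝ) : ℂ) * Complex.I)], by
    rw [mem_unitaryGroup_iff]
    generalize φ / 2 = x
    ext i j
    fin_cases i <;> fin_cases j <;>
      simp [Matrix.mul_apply, star_apply, ← Complex.exp_conj, ← Complex.exp_add]⟩

/-- The rotation `R_y(θ)`. -/
def Ry (θ : ℝ) : unitaryGroup (Fin 2) ℂ :=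
  ⟨!![((Real.cos (θ / 2) : ℝ) : ℂ), -((Real.sin (θ / 2) : ℝ) : ℂ);
      ((Real.sin (θ / 2) : ℝ) : ℂ), ((Real.cos (θ / 2) : ℝ) : ℂ)], by
    have h : ((Real.cos (θ / 2) : ℝ) : ℂ) * ((Real.cos (θ / 2) : ℝ) : ℂ) +
        ((Real.sin (θ / 2) : ℝ) : ℂ) * ((Real.sin (θ / 2) : ℝ) : ℂ) = 1 := by
      rw [← Complex.ofReal_mul, ← Complex.ofReal_mul, ← Complex.ofReal_add, ← pow_two, ← pow_two,
        Real.cos_sq_add_sin_sq, Complex.ofReal_one]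
    rw [mem_unitaryGroup_iff]
    generalize Real.cos (θ / 2) = c at h ⊢
    generalize Real.sin (θ / 2) = t at h ⊢
    ext i j
    fin_cases i <;> fin_cases j <;> simp [Matrix.mul_apply, star_apply]
    · exact h
    · ring
    · ring
    · rw [add_comm]; exact h⟩

/-- The reflection `2 |x₀⟩⟨x₀| - 1`. -/
def reflector {X : Type*} [Fintype X] [DecidableEq X] (x₀ : X) : unitaryGroup X ℂ :=
  ⟨diagonal fun x => if x = x₀ then 1 else -1, by
    rw [mem_unitaryGroup_iff, star_eq_conjTranspose, diagonal_conjTranspose, diagonal_mul_diagonal,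
      ← diagonal_one]
    congr 1
    funext x
    by_cases h : x = x₀ <;> simp [h]⟩

/-- The unitary that permutes the computational basis by `σ`. -/
def permGate {X : Type*} [Fintype X] [DecidableEq X] (σ : Equiv.Perm X) : unitaryGroup X ℂ :=
  ⟨Matrix.of fun x y => if x = σ y then 1 else 0, by
    rw [mem_unitaryGroup_iff]
    ext x y
    rw [Matrix.mul_apply, Fintype.sum_eq_single (σ.symm x)]
    · by_cases h : x = y <;> simp [star_apply, Matrix.one_apply, h, eq_comm]
    · intro z hz
      have : x ≠ σ z := fun h => hz (by simp [h])
      simp [this]⟩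

/-- Controlled `V`: applies `V` if the control qubit is `c`, and the identity otherwise. -/
def controlled {X : Type*} [Fintype X] [DecidableEq X] (c : Fin 2) (V : unitaryGroup X ℂ) :
    unitaryGroup (Fin 2 × X) ℂ :=
  ⟨Matrix.of fun x y => if x.1 = y.1 then
      (if x.1 = c then (V : Matrix X X ℂ) x.2 y.2 else (1 : Matrix X X ℂ) x.2 y.2) else 0, by
    rw [mem_unitaryGroup_iff]
    ext ⟨a, x⟩ ⟨b, y⟩
    have hV : ∑ z, (V : Matrix X X ℂ) x z * star ((V : Matrix X X ℂ) y z) =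
        (1 : Matrix X X ℂ) x y := by
      have := congrFun (congrFun (mem_unitaryGroup_iff.1 V.2) x) y
      simpa [Matrix.mul_apply, star_apply] using this
    rw [Matrix.mul_apply, Fintype.sum_prod_type, Fintype.sum_eq_single a]
    · by_cases hab : a = b
      · subst hab
        by_cases hac : a = c
        · simpa [hac, star_apply, Matrix.one_apply] using hV
        · by_cases hxy : x = y
          · simp [hac, star_apply, Matrix.one_apply, hxy]
          · simp [hac, star_apply, Matrix.one_apply, hxy]
      · simp [star_apply, Matrix.one_apply, hab, Ne.symm hab]
    · intro d hd
      simp [hd.symm]⟩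

/-- `V ⊗ 1`. -/
def onLeft {X Y : Type*} [Fintype X] [DecidableEq X] [Fintype Y] [DecidableEq Y]
    (V : unitaryGroup X ℂ) : unitaryGroup (X × Y) ℂ :=
  ⟨(V : Matrix X X ℂ) ⊗ₖ (1 : Matrix Y Y ℂ), kronecker_mem_unitary V.2 (one_mem _)⟩

/-- `1 ⊗ V`. -/
def onRight {X Y : Type*} [Fintype X] [DecidableEq X] [Fintype Y] [DecidableEq Y]
    (V : unitaryGroup Y ℂ) : unitaryGroup (X × Y) ℂ :=
  ⟨(1 : Matrix X X ℂ) ⊗ₖ (V : Matrix Y Y ℂ), kronecker_mem_unitary (one_mem _) V.2⟩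

/-! ### Query circuits

The registers are, in this order: the ancilla qubit of phase processing; registers `A`, `B`
(`n + m` qubits) of the block encoding; the system register `S` (`n` qubits) together with the
register `B'` (`m` qubits) that purifies its initial state. -/

/-- The `n + m` qubits on which the oracle acts. -/
abbrev OracleReg (n m : ℕ) : Type := Reg n × Reg m

/-- All the qubits but the ancilla: `(A, B)` and `(S, B')`. -/
abbrev MainReg (n m : ℕ) : Type := OracleReg n m × OracleReg n m

/-- All the qubits. -/
abbrev FullReg (n m : ℕ) : Type := Fin 2 × MainReg n m

/-- The pair of registers to which an oracle query is applied. -/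
inductive Site
  /-- the registers `A`, `B` -/
  | block
  /-- the registers `S`, `B'` -/
  | input

/-- An operation of a query circuit. -/
inductive Gate (n m : ℕ)
  /-- a unitary that does not depend on the oracle -/
  | free (V : unitaryGroup (FullReg n m) ℂ)
  /-- a query of the oracle or, if `dagger` is true, of its inverse -/
  | query (site : Site) (dagger : Bool)

/-- A circuit, as the list of its operations in order of time. -/
abbrev Circuit (n m : ℕ) : Type := List (Gate n m)

section Circuits

variable {n m : ℕ}

/-- A unitary `V` on the ancilla qubit. -/
def onAncilla (V : unitaryGroup (Fin 2) ℂ) : unitaryGroup (FullReg n m) ℂ := onLeft V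

/-- A unitary `V` on one of the two pairs of registers. -/
def onSite (V : unitaryGroup (OracleReg n m) ℂ) : Site → unitaryGroup (FullReg n m) ℂ
  | .block => onRight (onLeft V)
  | .input => onRight (onRight V)

/-- The swap of the registers `A` and `S`. -/
def swapAS : unitaryGroup (MainReg n m) ℂ :=
  permGate
    { toFun := fun x => ((x.2.1, x.1.2), (x.1.1, x.2.2))
      invFun := fun x => ((x.2.1, x.1.2), (x.1.1, x.2.2))
      left_inv := fun _ => rfl
      right_inv := fun _ => rfl }

/-- The reflection `2 |0⟩⟨0| - 1` of the registers `A`, `B`. -/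
def reflectAB : unitaryGroup (MainReg n m) ℂ := onLeft (reflector (0, 0))

namespace Gate

/-- The unitary of an operation, for the oracle `U`. -/
def eval (U : unitaryGroup (OracleReg n m) ℂ) : Gate n m → unitaryGroup (FullReg n m) ℂ
  | free V => V
  | query s false => onSite U s
  | query s true => onSite U⁻¹ s

/-- The inverse operation. -/
def inv : Gate n m → Gate n m
  | free V => free V⁻¹
  | query s d => query s !d

/-- Whether the operation is a query. -/
def isQuery : Gate n m → Bool
  | free _ => false
  | query _ _ => true

end Gate

namespace Circuit

/-- The unitary of a circuit, for the oracle `U`; the head of the list acts first. -/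
def eval (U : unitaryGroup (OracleReg n m) ℂ) : Circuit n m → unitaryGroup (FullReg n m) ℂ
  | [] => 1
  | g :: c => Circuit.eval U c * g.eval U

/-- The inverse circuit. -/
def inv (c : Circuit n m) : Circuit n m := (c.map Gate.inv).reverse

/-- The total number of queries to the oracle and to its inverse. -/
def queries (c : Circuit n m) : ℕ := c.countP Gate.isQuery

/-- The probability of the outcome `b` when the circuit is run on the all-zero state and the
ancilla qubit, and no other qubit, is measured in the computational basis. -/
def outcomeProb (U : unitaryGroup (OracleReg n m) ℂ) (c : Circuit n m) (b : Fin 2) : ℝ :=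
  ∑ x : MainReg n m, ‖(Circuit.eval U c : Matrix (FullReg n m) (FullReg n m) ℂ)
    (b, x) (0, ((0, 0), (0, 0)))‖ ^ 2

end Circuit

/-- Controlled `Û` with control value `c`, where `Û = (2|0⟩⟨0| - 1)_{AB} U† SWAP_{AS} U` is the
qubitized block encoding of `ρ`; only the swap and the reflection need the control. -/
def ctrlBlockEncoding (c : Fin 2) : Circuit n m :=
  [.query .block false, .free (controlled c swapAS), .query .block true,
    .free (controlled c reflectAB)]

/-- Controlled `Û†` with control value `c`. -/
def ctrlBlockEncodingInv (c : Fin 2) : Circuit n m := (ctrlBlockEncoding c).inv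

end Circuits

/-! ### Quantum phase processing -/

/-- The parameters of a phase processing circuit: the number `L` of layers and the angles
`ω`, `θ₀, …, θ_L`, `φ₀, …, φ_L` (values of `θ`, `φ` beyond index `L` are not used). -/
structure QPPParams where
  /-- number of layers -/
  L : ℕ
  /-- the angle of the final rotation -/
  ω : ℝ
  /-- the angles of the rotations `R_y` -/
  θ : ℕ → ℝ
  /-- the angles of the rotations `R_z` -/
  φ : ℕ → ℝ

section Algorithms

variable {n m : ℕ}

/-- The signal operator of layer `l`: `Û†` controlled on `0` if `l` is odd, and `Û` controlled
on `1` if `l` is even. -/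
def signal (l : ℕ) : Circuit n m :=
  if Odd l then ctrlBlockEncodingInv 0 else ctrlBlockEncoding 1

/-- The circuit of `R_z(ω) R_y(θ₀) R_z(φ₀) ∏_{l = 1}^{k} (signal l) R_y(θ_l) R_z(φ_l)`,
where the factors are ordered from left to right. -/
def qppLayers (ω : ℝ) (θ φ : ℕ → ℝ) : ℕ → Circuit n m
  | 0 => [.free (onAncilla (Rz (φ 0))), .free (onAncilla (Ry (θ 0))), .free (onAncilla (Rz ω))]
  | k + 1 => [.free (onAncilla (Rz (φ (k + 1)))), .free (onAncilla (Ry (θ (k + 1))))] ++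
      signal (k + 1) ++ qppLayers ω θ φ k

/-- Preparation of the purification `|Ψ_ρ⟩` on `S`, `B'`, followed by phase processing of `Û`. -/
def qppCircuit (p : QPPParams) : Circuit n m :=
  .query .input false :: qppLayers p.ω p.θ p.φ p.L

/-- The Grover operator `𝒜 (2|0⟩⟨0| - 1) 𝒜† (1 - 2|1⟩⟨1|)` of a circuit `𝒜`, the last factor
acting on the ancilla qubit. -/
def grover (A : Circuit n m) : Circuit n m :=
  [.free (onAncilla (reflector 0))] ++ A.inv ++ [.free (reflector (0, ((0, 0), (0, 0))))] ++ A

/-- Amplitude amplification: `𝒜` followed by `k` Grover operators. -/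
def amplified (A : Circuit n m) (k : ℕ) : Circuit n m :=
  A ++ (List.replicate k (grover A)).flatten

/-- An adaptive estimation algorithm whose quantum part consists in running circuits with labels
in `χ` and measuring a single qubit: a decision tree, in which a node runs a circuit from
scratch and branches on the measured bit, and a leaf returns an estimate. -/
inductive Algorithm (χ : Type)
  | output (v : ℝ)
  | measure (c : χ) (next : Fin 2 → Algorithm χ)

/-- The probability that `E v q` holds for the returned estimate `v` and the total number `q` of
queries, if label `c` is realized by `circ c`, the oracle is `U`, and `q₀` queries were made
before. -/
def Algorithm.prob {χ : Type} (circ : χ → Circuit n m) (U : unitaryGroup (OracleReg n m) ℂ)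
    (E : ℝ → ℕ → Prop) : Algorithm χ → ℕ → ℝ
  | .output v, q₀ => open Classical in if E v q₀ then 1 else 0
  | .measure c next, q₀ =>
      ∑ b : Fin 2, (circ c).outcomeProb U b *
        Algorithm.prob circ U E (next b) (q₀ + (circ c).queries)

end Algorithms

/-- There is an algorithm running circuits of the family `circ` that, for all numbers of qubits,
all states `ρ` whose nonzero eigenvalues are at least `γ` and all purified oracles of `ρ`, with
probability at least `1 - δ` estimates `S_α(ρ)` up to `ε` with at most `Q η` queries, where
`η = tr(ρ ^ α)⁻¹ / |1 - α|`. The algorithm does not know `ρ`, `η` or the oracle. -/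
def RenyiEstimable {χ : Type} (circ : ∀ n m : ℕ, χ → Circuit n m) (α γ ε δ : ℝ) (Q : ℝ → ℝ) :
    Prop :=
  ∃ 𝒜 : Algorithm χ, ∀ (n m : ℕ) (ρ : Matrix (Reg n) (Reg n) ℂ)
    (U : unitaryGroup (OracleReg n m) ℂ),
    IsDensityMatrix ρ → IsPurifiedOracle U ρ → (∀ p ∈ spectrum ℝ ρ, p ≠ 0 → γ ≤ p) →
      1 - δ ≤ 𝒜.prob (circ n m) U
        (fun v q => |v - renyiEntropy α ρ| ≤ ε ∧ (q : ℝ) ≤ Q (renyiEta α ρ)) 0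

/-- Estimation by measuring the ancilla qubit of phase processing circuits. -/
def EstimableByMeasurement : (α γ ε δ : ℝ) → (ℝ → ℝ) → Prop :=
  RenyiEstimable fun _ _ (p : QPPParams) => qppCircuit p

/-- Estimation by amplitude estimation on phase processing circuits, that is, by measuring the
ancilla qubit after any number of Grover operators of such a circuit. -/
def EstimableByAmplitudeEstimation : (α γ ε δ : ℝ) → (ℝ → ℝ) → Prop :=
  RenyiEstimable fun _ _ (p : QPPParams × ℕ) => amplified (qppCircuit p.1) p.2

/-- `C f log(2 + f)^k`; a bound of this form, with constants `C` and `k`, is a bound `Õ(f)`. -/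
def softO (C : ℝ) (k : ℕ) (f : ℝ) : ℝ := C * f * Real.log (2 + f) ^ k

end

noncomputable section

/-! ### Block structure of circuits with respect to the ancilla -/

/-! Let `E` be the qubitized encoding. Half of `E + E⁻¹` maps `|0⟩_{AB} ⊗ φ` to `|0⟩_{AB} ⊗ ρφ`
(`half_blockEncoding_add_inv_mulVec`). A phase processing circuit applies to its main registers a
Laurent polynomial in `E` (`block_qppLayers`), and every real polynomial `Q` with `|Q| ≤ 1/2` on
`[-1, 1]` can be realized: Fejér–Riesz supplies a complementary polynomial, and stripping off layers
supplies the angles (`fejer_riesz`, `exists_qppRow`, `exists_qppParams`). Run on the purification,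
the circuit shows the outcome 1 with probability `P = tr(ρ Q(ρ)²)`.

If `Q(x)²` is `κ x^(α-1)` on `[γ, 1]` up to a relative error `τ`, then `P` is `κ tr(ρ^α)` up to the
same relative error, since zero eigenvalues carry no weight. Such a `Q` has degree of order `1/γ`
(plus `α` when `α > 1`), up to logarithms: the binomial series of `(1 - (1 - x²))^(-s/2)` is cut at
about `1/γ²` terms, and the Chebyshev expansion of each `(1 - x²)^k` is cut at the square root of
that (`exists_negPow_approx`). Boundedness on all of `[-1, 1]` costs a factor `κ` of order `γ^(1-α)`
for `α < 1`, up to logarithms, and a constant for `α > 1`.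

An estimate of `P` with relative error `τ` gives `log tr(ρ^α)` with additive error of order `τ`, so
`τ` of order `min(|1-α|ε, 1)` suffices. The algorithm must adapt to an unknown `P`. In the
measurement setting, inverse binomial sampling does this: repeat until a fixed number of successes
is seen; about `1/(δτ²P)` runs are needed (`estimableByMeasurement_of_approx`). In the amplitude
setting, the same sampling with constant accuracy gives a first value of `√P`. Majority votes on
amplified circuits then shrink the uncertainty by `3/4` per round; scaling `Q` by a factor at most 1
puts the amplified angle where the vote is most sensitive (`exists_alignment`,
`le_prob_refineEstimate`, `estimableByAmplitudeEstimation_of_approx`).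

Finally `tr(ρ^α) ≤ γ^(α-1)` for `α < 1`, or `tr(ρ^α) ≤ 1` for `α > 1`, turns these costs into the
stated powers of `η`, and all logarithms are absorbed into `log(2 + f)` (`le_softO`). -/

/-- The block of a matrix on `Fin 2 × X` with ancilla indices `a`, `b`. -/
def block {X : Type*} (M : Matrix (Fin 2 × X) (Fin 2 × X) ℂ) (a b : Fin 2) : Matrix X X ℂ :=
  Matrix.of fun x y => M (a, x) (b, y)

section Blocks

set_option linter.unusedSectionVars false

variable {X Y : Type*} [Fintype X] [DecidableEq X] [Fintype Y] [DecidableEq Y]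

theorem block_mul (M N : Matrix (Fin 2 × X) (Fin 2 × X) ℂ) (a b : Fin 2) :
    block (M * N) a b = ∑ c, block M a c * block N c b := by
  ext x y
  simp [block, Matrix.mul_apply, Fintype.sum_prod_type, Matrix.add_apply]

theorem block_onLeft (V : unitaryGroup (Fin 2) ℂ) (a b : Fin 2) :
    block (onLeft V : unitaryGroup (Fin 2 × X) ℂ).1 a b =
      (V : Matrix (Fin 2) (Fin 2) ℂ) a b • (1 : Matrix X X ℂ) := by
  ext x y
  simp [block, onLeft, Matrix.kroneckerMap_apply]

/-- The matrix on `Fin 2 × X` that applies `V a` when the ancilla is in the state `a`. -/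
def IsBlockDiag (M : Matrix (Fin 2 × X) (Fin 2 × X) ℂ) (V : Fin 2 → Matrix X X ℂ) : Prop :=
  ∀ a b, block M a b = if a = b then V a else 0

theorem IsBlockDiag.mul {M N : Matrix (Fin 2 × X) (Fin 2 × X) ℂ} {V W : Fin 2 → Matrix X X ℂ}
    (hM : IsBlockDiag M V) (hN : IsBlockDiag N W) :
    IsBlockDiag (M * N) fun a => V a * W a := by
  intro a b
  rw [block_mul, Fintype.sum_eq_single a]
  · rw [hM, hN]
    by_cases h : a = b <;> simp [h]
  · intro c hc
    rw [hM]
    simp [hc.symm]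

theorem isBlockDiag_onRight (V : unitaryGroup X ℂ) :
    IsBlockDiag (onRight V : unitaryGroup (Fin 2 × X) ℂ).1 fun _ => V.1 := by
  intro a b
  ext x y
  by_cases h : a = b <;> simp [block, onRight, Matrix.kroneckerMap_apply, h]

theorem isBlockDiag_controlled (c : Fin 2) (V : unitaryGroup X ℂ) :
    IsBlockDiag (controlled c V).1 fun a => if a = c then V.1 else 1 := by
  intro a b
  ext x y
  by_cases h : a = b
  · by_cases h' : a = c
    · subst h; simp [block, controlled, h']
    · subst h; simp [block, controlled, h']
  · simp [block, controlled, h]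

theorem IsBlockDiag.star {M : Matrix (Fin 2 × X) (Fin 2 × X) ℂ} {V : Fin 2 → Matrix X X ℂ}
    (hM : IsBlockDiag M V) : IsBlockDiag (star M) fun a => star (V a) := by
  intro a b
  have h := hM b a
  ext x y
  have h2 := congrFun (congrFun h y) x
  simp only [block, of_apply] at h2
  simp only [block, of_apply, star_apply, h2]
  by_cases hab : a = b
  · subst hab; simp [star_apply]
  · simp [hab, Ne.symm hab]

theorem onLeft_mul (V W : unitaryGroup X ℂ) :
    (onLeft (V * W) : unitaryGroup (X × Y) ℂ) = onLeft V * onLeft W := by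
  apply Subtype.ext
  simp [onLeft, ← Matrix.mul_kronecker_mul]

theorem onLeft_one : (onLeft 1 : unitaryGroup (X × Y) ℂ) = 1 := by
  apply Subtype.ext
  simp [onLeft]

/-- The squared Euclidean norm. -/
def normSq (v : X → ℂ) : ℝ := ∑ x, ‖v x‖ ^ 2

theorem normSq_eq_dotProduct (v : X → ℂ) : ((normSq v : ℝ) : ℂ) = star v ⬝ᵥ v := by
  simp only [normSq, dotProduct, Pi.star_apply]
  push_cast
  refine Finset.sum_congr rfl fun x _ => ?_
  have := Complex.conj_mul' (v x)
  simpa using this.symm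

theorem normSq_unitary_mulVec (V : unitaryGroup X ℂ) (v : X → ℂ) :
    normSq (V.1 *ᵥ v) = normSq v := by
  have : ((normSq (V.1 *ᵥ v) : ℝ) : ℂ) = ((normSq v : ℝ) : ℂ) := by
    rw [normSq_eq_dotProduct, normSq_eq_dotProduct, star_mulVec, ← dotProduct_mulVec,
      mulVec_mulVec, ← star_eq_conjTranspose, Unitary.star_mul_self_of_mem V.2, one_mulVec]
  exact_mod_cast this

end Blocks

theorem unitaryGroup_inv_val {X : Type*} [Fintype X] [DecidableEq X] (V : unitaryGroup X ℂ) :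
    (V⁻¹).1 = star V.1 := rfl

/-! ### Phase processing circuits as rows of polynomials in the block encoding -/

section QPP

variable {n m : ℕ} (U : unitaryGroup (OracleReg n m) ℂ)

theorem Circuit.eval_append (c d : Circuit n m) :
    Circuit.eval U (c ++ d) = Circuit.eval U d * Circuit.eval U c := by
  induction c with
  | nil => simp [Circuit.eval]
  | cons g c ih => simp [Circuit.eval, ih, mul_assoc]

theorem onSite_inv (s : Site) : onSite U⁻¹ s = (onSite U s)⁻¹ := by
  apply Subtype.ext
  cases s <;> simp [onSite, onLeft, onRight, star_eq_conjTranspose,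
    conjTranspose_kronecker]

theorem Circuit.eval_inv (c : Circuit n m) : Circuit.eval U c.inv = (Circuit.eval U c)⁻¹ := by
  induction c with
  | nil => simp [Circuit.inv, Circuit.eval]
  | cons g c ih =>
    have hg : Gate.eval U g.inv = (Gate.eval U g)⁻¹ := by
      rcases g with V | ⟨s, d⟩
      · rfl
      · cases d <;> simp [Gate.inv, Gate.eval, onSite_inv]
    have : Circuit.inv (g :: c) = Circuit.inv c ++ [g.inv] := by simp [Circuit.inv]
    rw [this, Circuit.eval_append, ih]
    simp [Circuit.eval, hg]

/-- The qubitized block encoding `(2|0⟩⟨0| - 1)_{AB} U† SWAP_{AS} U`. -/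
def blockEncoding : unitaryGroup (MainReg n m) ℂ :=
  reflectAB * onLeft U⁻¹ * swapAS * onLeft U

theorem isBlockDiag_ctrlBlockEncoding (c : Fin 2) :
    IsBlockDiag (Circuit.eval U (ctrlBlockEncoding c)).1
      fun a => if a = c then (blockEncoding U).1 else 1 := by
  have h1 := isBlockDiag_onRight (onLeft U : unitaryGroup (MainReg n m) ℂ)
  have h2 := isBlockDiag_onRight (onLeft U⁻¹ : unitaryGroup (MainReg n m) ℂ)
  have h3 := isBlockDiag_controlled c (swapAS : unitaryGroup (MainReg n m) ℂ)
  have h4 := isBlockDiag_controlled c (reflectAB : unitaryGroup (MainReg n m) ℂ)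
  have h := ((h4.mul h2).mul h3).mul h1
  have hU : (onLeft U⁻¹ : unitaryGroup (MainReg n m) ℂ).1 *
      (onLeft U : unitaryGroup (MainReg n m) ℂ).1 = 1 := by
    rw [← Submonoid.coe_mul, ← onLeft_mul, inv_mul_cancel, onLeft_one]; rfl
  have e : (Circuit.eval U (ctrlBlockEncoding c)).1 =
      (controlled c (reflectAB : unitaryGroup (MainReg n m) ℂ)).1 *
        (onRight (onLeft U⁻¹ : unitaryGroup (MainReg n m) ℂ)).1 *
        (controlled c (swapAS : unitaryGroup (MainReg n m) ℂ)).1 *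
        (onRight (onLeft U : unitaryGroup (MainReg n m) ℂ)).1 := by
    simp [ctrlBlockEncoding, Circuit.eval, Gate.eval, onSite]
  rw [e]
  intro a b
  rw [h]
  by_cases hac : a = c
  · simp [hac, blockEncoding, mul_assoc]
  · simp [hac, hU]

theorem isBlockDiag_ctrlBlockEncodingInv (c : Fin 2) :
    IsBlockDiag (Circuit.eval U (ctrlBlockEncodingInv c)).1
      fun a => if a = c then (blockEncoding U)⁻¹.1 else 1 := by
  have h := (isBlockDiag_ctrlBlockEncoding U c).star
  rw [ctrlBlockEncodingInv, Circuit.eval_inv]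
  intro a b
  have := h a b
  rw [unitaryGroup_inv_val, this]
  by_cases hac : a = c <;> simp [hac]

open Polynomial in
/-- The second row of the `2 × 2` matrix of polynomials that a phase processing circuit applies,
up to a power of the variable. -/
def qppRow (ω : ℝ) (θ φ : ℕ → ℝ) : ℕ → Fin 2 → ℂ[X]
  | 0 => fun b => C ((Rz ω * (Ry (θ 0) * Rz (φ 0))).1 1 b)
  | k + 1 => fun b =>
      qppRow ω θ φ k 0 * C ((Ry (θ (k + 1)) * Rz (φ (k + 1))).1 0 b) +
        X * qppRow ω θ φ k 1 * C ((Ry (θ (k + 1)) * Rz (φ (k + 1))).1 1 b)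

/-- With `E` the block encoding and `F` its inverse, an even layer is `diag(1, E)` and an odd layer
is `diag(F, 1) = F · diag(1, E)`. So every layer acts as the same polynomial matrix, and each odd
one contributes one extra factor `F`; there are `(k + 1) / 2` odd indices up to `k`. -/
theorem block_qppLayers (ω : ℝ) (θ φ : ℕ → ℝ) (k : ℕ) (b : Fin 2) :
    block (Circuit.eval U (qppLayers ω θ φ k)).1 1 b =
      (blockEncoding U)⁻¹.1 ^ ((k + 1) / 2) *
        Polynomial.aeval (blockEncoding U).1 (qppRow ω θ φ k b) := by
  induction k generalizing b with
  | zero =>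
    have e : Circuit.eval U (qppLayers ω θ φ 0) =
        onLeft (Rz ω * (Ry (θ 0) * Rz (φ 0))) := by
      simp [qppLayers, Circuit.eval, Gate.eval, onAncilla, onLeft_mul, mul_assoc]
    rw [e, block_onLeft]
    simp [qppRow, Algebra.smul_def]
  | succ k ih =>
    have e : Circuit.eval U (qppLayers ω θ φ (k + 1)) =
        Circuit.eval U (qppLayers ω θ φ k) * Circuit.eval U (signal (k + 1)) *
          onLeft (Ry (θ (k + 1)) * Rz (φ (k + 1))) := by
      rw [qppLayers, Circuit.eval_append, Circuit.eval_append]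
      simp [Circuit.eval, Gate.eval, onAncilla, onLeft_mul, mul_assoc]
    have hinv : (blockEncoding U)⁻¹.1 * (blockEncoding U).1 = 1 := by
      rw [← Submonoid.coe_mul, inv_mul_cancel]; rfl
    have hinv' : (blockEncoding U).1 * (blockEncoding U)⁻¹.1 = 1 := by
      rw [← Submonoid.coe_mul, mul_inv_cancel]; rfl
    have hcomm : ∀ p : Polynomial ℂ, Polynomial.aeval (blockEncoding U).1 p * (blockEncoding U)⁻¹.1
        = (blockEncoding U)⁻¹.1 * Polynomial.aeval (blockEncoding U).1 p := by
      intro p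
      have h : Commute (Polynomial.aeval (blockEncoding U).1 p) (blockEncoding U).1 := by
        have := Polynomial.aeval_X (R := ℂ) (blockEncoding U).1
        have h2 : Commute (Polynomial.aeval (blockEncoding U).1 p)
            (Polynomial.aeval (blockEncoding U).1 (Polynomial.X : Polynomial ℂ)) := by
          rw [Commute, SemiconjBy, ← map_mul, ← map_mul, mul_comm]
        rwa [this] at h2
      calc _ = (blockEncoding U)⁻¹.1 * ((blockEncoding U).1 *
            Polynomial.aeval (blockEncoding U).1 p) * (blockEncoding U)⁻¹.1 := by
              rw [← mul_assoc, hinv, one_mul]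
        _ = _ := by rw [← h.eq, mul_assoc, mul_assoc, hinv', mul_one]
    set E := (blockEncoding U).1
    set F := (blockEncoding U)⁻¹.1
    set A := (Ry (θ (k + 1)) * Rz (φ (k + 1)))
    have hrow : Polynomial.aeval E (qppRow ω θ φ (k + 1) b) =
        A.1 0 b • Polynomial.aeval E (qppRow ω θ φ k 0) +
          A.1 1 b • (E * Polynomial.aeval E (qppRow ω θ φ k 1)) := by
      rw [qppRow]
      simp only [map_add, map_mul, Polynomial.aeval_C, Polynomial.aeval_X]
      rw [← Algebra.commutes, ← Algebra.commutes, ← Algebra.smul_def, ← Algebra.smul_def]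
    rw [e, Submonoid.coe_mul, Submonoid.coe_mul, block_mul]
    simp only [block_mul, Fin.sum_univ_two, ih, block_onLeft]
    rw [hrow]
    by_cases hk : Odd (k + 1)
    · obtain ⟨j, hj⟩ := hk
      have hs := isBlockDiag_ctrlBlockEncodingInv U 0
      have e1 : (signal (k + 1) : Circuit n m) = ctrlBlockEncodingInv 0 := by
        simp [signal, show Odd (k + 1) from ⟨j, hj⟩]
      have e2 : (k + 1) / 2 = j := by omega
      have e3 : (k + 1 + 1) / 2 = j + 1 := by omega
      have e4 : F ^ j * F * (A.1 1 b • (E * Polynomial.aeval E (qppRow ω θ φ k 1))) =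
          A.1 1 b • (F ^ j * Polynomial.aeval E (qppRow ω θ φ k 1)) := by
        rw [mul_smul_comm, mul_assoc, ← mul_assoc F, hinv, one_mul]
      rw [e1, e2, e3]
      simp only [hs _ _]
      simp only [pow_succ, mul_add, e4]
      simp only [mul_smul_comm, mul_one]
      have hF : star (blockEncoding U).1 = F := rfl
      simp [mul_assoc, hF, hcomm]
    · have hs := isBlockDiag_ctrlBlockEncoding U 1
      obtain ⟨j, hj⟩ := Nat.not_odd_iff_even.1 hk
      have e1 : (signal (k + 1) : Circuit n m) = ctrlBlockEncoding 1 := by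
        simp [signal, hk]
      have e2 : (k + 1) / 2 = j := by omega
      have e3 : (k + 1 + 1) / 2 = j := by omega
      have hcomm' : Polynomial.aeval E (qppRow ω θ φ k 1) * E =
          E * Polynomial.aeval E (qppRow ω θ φ k 1) := by
        have := Polynomial.aeval_X (R := ℂ) E
        nth_rewrite 2 [← this]
        nth_rewrite 3 [← this]
        rw [← map_mul, ← map_mul, mul_comm]
      rw [e1, e2, e3]
      simp only [hs _ _]
      simp [mul_add, mul_assoc, hcomm', E]

end QPP

/-! ### The outcome probability of phase processing -/

open Polynomial in
/-- The polynomial `z ^ d Q((z + z⁻¹) / 2)`. -/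
def laurentLift (d : ℕ) (Q : ℝ[X]) : ℂ[X] :=
  ∑ i ∈ Finset.range (Q.natDegree + 1),
    C (Q.coeff i : ℂ) * (X ^ (d - i) * (C (1 / 2) * (X ^ 2 + 1)) ^ i)

/-- Rests on `E² + 1 = E (E + F)`. A general algebra is used because the identity is needed both for
the block encoding and for points of the unit circle. -/
theorem aeval_laurentLift {A : Type*} [Ring A] [Algebra ℂ A] (E F : A) (hEF : E * F = 1)
    (hFE : F * E = 1) (d : ℕ) (Q : Polynomial ℝ) (hd : Q.natDegree ≤ d) :
    Polynomial.aeval E (laurentLift d Q) =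
      E ^ d * Polynomial.aeval (algebraMap ℂ A (1 / 2) * (E + F))
        (Q.map (algebraMap ℝ ℂ)) := by
  have hEFc : Commute E F := by rw [Commute, SemiconjBy, hEF, hFE]
  have hdeg : (Q.map (algebraMap ℝ ℂ)).natDegree < Q.natDegree + 1 :=
    Nat.lt_succ_of_le Polynomial.natDegree_map_le
  rw [Polynomial.aeval_eq_sum_range' hdeg, laurentLift, map_sum, Finset.mul_sum]
  refine Finset.sum_congr rfl fun i hi => ?_
  have hi' : i ≤ d := by rw [Finset.mem_range] at hi; omega
  have h1 : E ^ 2 + 1 = E * (E + F) := by rw [mul_add, hEF, sq]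
  have h2 : algebraMap ℂ A (1 / 2) * (E ^ 2 + 1) = E * (algebraMap ℂ A (1 / 2) * (E + F)) := by
    rw [h1, ← mul_assoc, ← mul_assoc, Algebra.commutes]
  have h3 : Commute E (algebraMap ℂ A (1 / 2) * (E + F)) := by
    apply Commute.mul_right
    · exact (Algebra.commutes _ _).symm
    · exact (Commute.refl E).add_right hEFc
  simp only [map_mul, map_pow, Polynomial.aeval_C, Polynomial.aeval_X, map_add, map_one]
  rw [h2, h3.mul_pow, ← mul_assoc (E ^ (d - i)), ← pow_add, Nat.sub_add_cancel hi',
    Polynomial.coeff_map, ← Algebra.smul_def, mul_smul_comm]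
  rfl

section QPP

variable {n m : ℕ} (U : unitaryGroup (OracleReg n m) ℂ)

/-- The state `|0⟩_{AB} ⊗ φ` for a vector `φ` of the registers `S`, `B'`, written as a matrix. -/
def inputState (φ : Matrix (Reg n) (Reg m) ℂ) : MainReg n m → ℂ :=
  fun x => if x.1 = (0, 0) then φ x.2.1 x.2.2 else 0

theorem onLeft_mulVec {X Y : Type*} [Fintype X] [DecidableEq X] [Fintype Y] [DecidableEq Y]
    (V : unitaryGroup X ℂ) (v : X × Y → ℂ) (x : X) (y : Y) :
    ((onLeft V : unitaryGroup (X × Y) ℂ).1 *ᵥ v) (x, y) = ∑ z, V.1 x z * v (z, y) := by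
  simp only [mulVec, dotProduct, onLeft, Fintype.sum_prod_type, Matrix.kroneckerMap_apply]
  refine Finset.sum_congr rfl fun z _ => ?_
  rw [Fintype.sum_eq_single y]
  · simp
  · intro w hw
    simp [hw.symm]

theorem swapAS_mulVec (v : MainReg n m → ℂ) (a s : Reg n) (b c : Reg m) :
    ((swapAS : unitaryGroup (MainReg n m) ℂ).1 *ᵥ v) ((a, b), (s, c)) = v ((s, b), (a, c)) := by
  simp only [mulVec, dotProduct, swapAS, permGate, of_apply]
  rw [Fintype.sum_eq_single ((s, b), (a, c))]
  · simp
  · rintro ⟨⟨x1, x2⟩, ⟨x3, x4⟩⟩ hx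
    rw [if_neg, zero_mul]
    intro h
    apply hx
    simp only [Equiv.coe_fn_mk, Prod.mk.injEq] at h ⊢
    tauto

/-- The operator `U† SWAP U`, without the reflection. -/
def swapEncoding : unitaryGroup (MainReg n m) ℂ := onLeft U⁻¹ * swapAS * onLeft U

/-- After the swap the vector `φ` sits in `A` and the purification in `S`, `B`; pairing with `U |0⟩`
on `A`, `B` traces out `B` and leaves the matrix of `ρ` acting on `φ`. -/
theorem swapEncoding_inputState {ρ : Matrix (Reg n) (Reg n) ℂ} (h : IsPurifiedOracle U ρ)
    (φ : Matrix (Reg n) (Reg m) ℂ) (s : Reg n) (b : Reg m) :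
    ((swapEncoding U).1 *ᵥ inputState φ) ((0, 0), (s, b)) = (ρ * φ) s b := by
  rw [swapEncoding, Submonoid.coe_mul, Submonoid.coe_mul, ← mulVec_mulVec, ← mulVec_mulVec,
    onLeft_mulVec]
  have h1 : ∀ z : OracleReg n m, ((swapAS : unitaryGroup (MainReg n m) ℂ).1 *ᵥ
      (onLeft U : unitaryGroup (MainReg n m) ℂ).1 *ᵥ inputState φ) (z, (s, b)) =
      U.1 (s, z.2) (0, 0) * φ z.1 b := by
    rintro ⟨a, c⟩
    rw [swapAS_mulVec, onLeft_mulVec, Fintype.sum_eq_single (0, 0)]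
    · simp [inputState]
    · intro z hz
      simp [inputState, hz]
  simp only [h1, Fintype.sum_prod_type, Matrix.mul_apply, h s, unitaryGroup_inv_val, star_apply,
    Finset.sum_mul]
  refine Finset.sum_congr rfl fun a _ => Finset.sum_congr rfl fun c _ => by ring

theorem reflectAB_mulVec (v : MainReg n m → ℂ) (x : OracleReg n m) (y : OracleReg n m) :
    ((reflectAB : unitaryGroup (MainReg n m) ℂ).1 *ᵥ v) (x, y) =
      if x = (0, 0) then v (x, y) else -v (x, y) := by
  rw [reflectAB, onLeft_mulVec, Fintype.sum_eq_single x]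
  · by_cases h : x = (0, 0) <;> simp [reflector, h]
  · intro z hz
    simp [reflector, diagonal_apply_ne _ hz.symm]

theorem reflector_inv {X : Type*} [Fintype X] [DecidableEq X] (x : X) :
    (reflector x)⁻¹ = reflector x := by
  apply Subtype.ext
  rw [unitaryGroup_inv_val, reflector, star_eq_conjTranspose, diagonal_conjTranspose]
  congr 1
  funext y
  by_cases h : y = x <;> simp [h]

theorem onLeft_inv {X Y : Type*} [Fintype X] [DecidableEq X] [Fintype Y] [DecidableEq Y]
    (V : unitaryGroup X ℂ) :
    (onLeft V⁻¹ : unitaryGroup (X × Y) ℂ) = (onLeft V)⁻¹ := by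
  rw [eq_inv_iff_mul_eq_one, ← onLeft_mul, inv_mul_cancel, onLeft_one]

theorem swapAS_inv : (swapAS : unitaryGroup (MainReg n m) ℂ)⁻¹ = swapAS := by
  apply Subtype.ext
  rw [unitaryGroup_inv_val]
  ext ⟨⟨a, b⟩, ⟨s, c⟩⟩ ⟨⟨a', b'⟩, ⟨s', c'⟩⟩
  simp only [star_apply, swapAS, permGate, of_apply, Equiv.coe_fn_mk, Prod.mk.injEq]
  have : ((a' = s ∧ b' = b) ∧ s' = a ∧ c' = c) ↔ ((a = s' ∧ b = b') ∧ s = a' ∧ c = c') := by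
    constructor <;> (rintro ⟨⟨h1, h2⟩, h3, h4⟩; simp [h1, h2, h3, h4])
  by_cases h : (a = s' ∧ b = b') ∧ s = a' ∧ c = c'
  · rw [if_pos (this.2 h), if_pos h]; simp
  · rw [if_neg (fun h' => h (this.1 h')), if_neg h]; simp

theorem swapEncoding_inv : (swapEncoding U)⁻¹ = swapEncoding U := by
  simp only [swapEncoding, _root_.mul_inv_rev, swapAS_inv, ← onLeft_inv, inv_inv, mul_assoc]

/-- Write the encoding as `R S` with `R` the reflection and `S` an involution, so that its inverse
is `S R`. As `R` fixes `|0⟩_{AB}`, the half sum acts there as `(R + 1)/2 · S`, that is, as the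
projection onto `|0⟩_{AB}` after `S`. Hence the subspace `|0⟩_{AB}` is invariant, although it is not
invariant under the encoding itself. -/
theorem half_blockEncoding_add_inv_mulVec {ρ : Matrix (Reg n) (Reg n) ℂ}
    (h : IsPurifiedOracle U ρ) (φ : Matrix (Reg n) (Reg m) ℂ) :
    (algebraMap ℂ (Matrix (MainReg n m) (MainReg n m) ℂ) (1 / 2) *
      ((blockEncoding U).1 + (blockEncoding U)⁻¹.1)) *ᵥ inputState φ = inputState (ρ * φ) := by
  have hE : blockEncoding U = reflectAB * swapEncoding U := by
    simp [blockEncoding, swapEncoding, mul_assoc]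
  have hF : (blockEncoding U)⁻¹ = swapEncoding U * reflectAB := by
    rw [hE, _root_.mul_inv_rev, swapEncoding_inv, reflectAB, ← onLeft_inv, reflector_inv]
  have hr : (reflectAB : unitaryGroup (MainReg n m) ℂ).1 *ᵥ inputState φ = inputState φ := by
    funext ⟨x, y⟩
    rw [reflectAB_mulVec]
    by_cases hx : x = (0, 0) <;> simp [inputState, hx]
  rw [← Algebra.smul_def, smul_mulVec, add_mulVec, hF, hE, Submonoid.coe_mul, Submonoid.coe_mul,
    ← mulVec_mulVec, ← mulVec_mulVec, hr]
  funext ⟨x, ⟨s, b⟩⟩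
  rw [Pi.smul_apply, Pi.add_apply, reflectAB_mulVec]
  by_cases hx : x = (0, 0)
  · subst hx
    have hs := swapEncoding_inputState U h φ s b
    rw [if_pos rfl, hs]
    simp only [inputState, if_pos]
    rw [smul_eq_mul]
    ring
  · simp [hx, inputState]

theorem aeval_mulVec_inputState {ρ : Matrix (Reg n) (Reg n) ℂ}
    (H : Matrix (MainReg n m) (MainReg n m) ℂ)
    (hH : ∀ φ : Matrix (Reg n) (Reg m) ℂ, H *ᵥ inputState φ = inputState (ρ * φ))
    (p : Polynomial ℂ) (φ : Matrix (Reg n) (Reg m) ℂ) :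
    Polynomial.aeval H p *ᵥ inputState φ = inputState (Polynomial.aeval ρ p * φ) := by
  induction p using Polynomial.induction_on' with
  | add p q hp hq =>
    rw [map_add, map_add, add_mulVec, hp, hq, Matrix.add_mul]
    funext x
    by_cases hx : x.1 = (0, 0) <;> simp [inputState, hx]
  | monomial k a =>
    rw [Polynomial.aeval_monomial, Polynomial.aeval_monomial, ← Algebra.smul_def,
      ← Algebra.smul_def, smul_mulVec]
    have hk : ∀ (k : ℕ) (φ : Matrix (Reg n) (Reg m) ℂ),
        H ^ k *ᵥ inputState φ = inputState (ρ ^ k * φ) := by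
      intro k
      induction k with
      | zero => simp
      | succ k ih =>
        intro φ
        rw [pow_succ, ← mulVec_mulVec, hH, ih, pow_succ, Matrix.mul_assoc]
    rw [hk]
    funext x
    by_cases hx : x.1 = (0, 0) <;> simp [inputState, hx]

theorem normSq_smul {X : Type*} [Fintype X] (c : ℂ) (hc : ‖c‖ = 1) (v : X → ℂ) :
    normSq (c • v) = normSq v := by
  simp [normSq, hc]

theorem normSq_inputState (φ : Matrix (Reg n) (Reg m) ℂ) :
    normSq (inputState φ) = (φ * φᴴ).trace.re := by
  have : normSq (inputState φ) = ∑ s, ∑ b, ‖φ s b‖ ^ 2 := by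
    rw [normSq, Fintype.sum_prod_type, Fintype.sum_eq_single (0, 0)]
    · simp [inputState, Fintype.sum_prod_type]
    · intro z hz
      simp [inputState, hz]
  rw [this, Matrix.trace, Complex.re_sum]
  refine Finset.sum_congr rfl fun s _ => ?_
  rw [Matrix.diag_apply, Matrix.mul_apply, Complex.re_sum]
  refine Finset.sum_congr rfl fun b _ => ?_
  rw [conjTranspose_apply, ← Complex.normSq_eq_norm_sq]
  simp [Complex.normSq_apply]

/-- The outcome probability of phase processing whose polynomial is `Q`. -/
theorem outcomeProb_qppCircuit {ρ : Matrix (Reg n) (Reg n) ℂ} (h : IsPurifiedOracle U ρ)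
    (p : QPPParams) (d : ℕ) (hL : p.L = 2 * d) (Q : Polynomial ℝ) (hd : Q.natDegree ≤ d) (c : ℂ)
    (hc : ‖c‖ = 1)
    (hrow : qppRow p.ω p.θ p.φ p.L 0 = Polynomial.C c * laurentLift d Q) :
    Circuit.outcomeProb U (qppCircuit p) 1 =
      (Polynomial.aeval ρ (Q.map (algebraMap ℝ ℂ)) * ρ *
        (Polynomial.aeval ρ (Q.map (algebraMap ℝ ℂ)))ᴴ).trace.re := by
  set φ : Matrix (Reg n) (Reg m) ℂ := Matrix.of fun s b => U.1 (s, b) (0, 0) with hφ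
  have hρ : φ * φᴴ = ρ := by
    ext i j
    rw [h i j]
    simp [Matrix.mul_apply, hφ]
  have hinv : (blockEncoding U)⁻¹.1 * (blockEncoding U).1 = 1 := by
    rw [← Submonoid.coe_mul, inv_mul_cancel]; rfl
  have hinv' : (blockEncoding U).1 * (blockEncoding U)⁻¹.1 = 1 := by
    rw [← Submonoid.coe_mul, mul_inv_cancel]; rfl
  set R := Polynomial.aeval ρ (Q.map (algebraMap ℝ ℂ))
  have hblock : block (Circuit.eval U (qppLayers p.ω p.θ p.φ p.L)).1 1 0 =
      c • Polynomial.aeval (algebraMap ℂ (Matrix (MainReg n m) (MainReg n m) ℂ) (1 / 2) *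
        ((blockEncoding U).1 + (blockEncoding U)⁻¹.1)) (Q.map (algebraMap ℝ ℂ)) := by
    rw [block_qppLayers, hrow, map_mul, Polynomial.aeval_C,
      aeval_laurentLift _ _ hinv' hinv d Q hd, ← Algebra.smul_def, mul_smul_comm, ← mul_assoc, hL,
      show (2 * d + 1) / 2 = d by omega]
    congr 1
    have : (blockEncoding U)⁻¹.1 ^ d * (blockEncoding U).1 ^ d = 1 := by
      rw [← (show Commute (blockEncoding U)⁻¹.1 (blockEncoding U).1 by
        rw [Commute, SemiconjBy, hinv, hinv']).mul_pow, hinv, one_pow]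
    rw [this, one_mul]
  have hcol : ∀ y, (block (onSite U .input).1 0 0 *ᵥ Pi.single ((0, 0), (0, 0)) 1) y =
      inputState φ y := by
    rintro ⟨x, y⟩
    have := isBlockDiag_onRight (onRight U : unitaryGroup (MainReg n m) ℂ) 0 0
    rw [onSite, this]
    by_cases hx : x = (0, 0) <;>
      simp [inputState, onRight, hx, hφ, Matrix.kroneckerMap_apply]
  have hblock2 : block (Circuit.eval U (qppCircuit p)).1 1 0 =
      block (Circuit.eval U (qppLayers p.ω p.θ p.φ p.L)).1 1 0 *
        block (onSite U .input).1 0 0 := by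
    have e : (Circuit.eval U (qppCircuit p)).1 =
        (Circuit.eval U (qppLayers p.ω p.θ p.φ p.L)).1 * (onSite U .input).1 := by
      simp [qppCircuit, Circuit.eval, Gate.eval]
    have := isBlockDiag_onRight (onRight U : unitaryGroup (MainReg n m) ℂ) 1 0
    rw [e, block_mul, Fin.sum_univ_two, onSite, this]
    simp
  -- The global phase `c` disappears in the norm; what remains is the squared norm of `Q(ρ)` applied
  -- to the purification `φ`, and `φ φᴴ = ρ`.
  have key : Circuit.outcomeProb U (qppCircuit p) 1 = normSq (inputState (R * φ)) := by
    rw [← normSq_smul c hc, ← aeval_mulVec_inputState _ (half_blockEncoding_add_inv_mulVec U h),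
      ← smul_mulVec, ← hblock, ← funext hcol, mulVec_mulVec, ← hblock2, Circuit.outcomeProb, normSq]
    refine Finset.sum_congr rfl fun x _ => ?_
    simp [block]
  rw [key, normSq_inputState, conjTranspose_mul, ← Matrix.mul_assoc, Matrix.mul_assoc R, hρ]

end QPP

/-! ### The Fejér–Riesz theorem -/

section FejerRiesz

open Polynomial

theorem infinite_unit_circle : {z : ℂ | ‖z‖ = 1}.Infinite := by
  have h : (Set.Icc (0 : ℝ) 1).Infinite := Set.Icc_infinite one_pos
  have hinj : Set.InjOn (fun t : ℝ => Complex.exp (t * Complex.I)) (Set.Icc 0 1) := by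
    intro s hs t ht hst
    have := congrArg Complex.im hst
    simp only [Complex.exp_ofReal_mul_I_im] at this
    have hpi := Real.pi_gt_three
    exact Real.injOn_sin ⟨by linarith [hs.1], by linarith [hs.2]⟩
      ⟨by linarith [ht.1], by linarith [ht.2]⟩ this
  refine (h.image hinj).mono ?_
  rintro _ ⟨t, _, rfl⟩
  simp [Complex.norm_exp_ofReal_mul_I]

theorem polynomial_eq_of_eqOn_unit_circle {p q : ℂ[X]}
    (h : ∀ z : ℂ, ‖z‖ = 1 → p.eval z = q.eval z) : p = q :=
  Polynomial.eq_of_infinite_eval_eq p q (infinite_unit_circle.mono fun z hz => h z hz)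

/-- The conjugate reversal of a polynomial of formal degree `N`. -/
def conjReflect (N : ℕ) (p : ℂ[X]) : ℂ[X] := (p.map (starRingEnd ℂ)).reflect N

theorem eval_conjReflect {N : ℕ} {p : ℂ[X]} (hp : p.natDegree ≤ N) {z : ℂ} (hz : z ≠ 0) :
    (conjReflect N p).eval z = z ^ N * starRingEnd ℂ (p.eval (starRingEnd ℂ z)⁻¹) := by
  have hz' : starRingEnd ℂ z ≠ 0 := by simpa using hz
  have hdeg : (conjReflect N p).natDegree ≤ N := by
    have h : (p.map (starRingEnd ℂ)).natDegree ≤ N := natDegree_map_le.trans hp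
    exact natDegree_reflect_le.trans (max_le le_rfl h)
  let _ : Invertible z := invertibleOfNonzero hz
  have h := eval₂_reflect_mul_pow (RingHom.id ℂ) z N (conjReflect N p) hdeg
  rw [← eval₂_id, ← h, conjReflect, reflect_reflect, mul_comm, eval₂_id, invOf_eq_inv,
    eval_map]
  congr 1
  rw [show z⁻¹ = starRingEnd ℂ (starRingEnd ℂ z)⁻¹ by simp, eval₂_hom]

/-- Makes complex conjugation on the circle a polynomial operation, so identities between values on
the circle become identities between coefficients. -/
theorem eval_conjReflect_of_norm_eq_one {N : ℕ} {p : ℂ[X]} (hp : p.natDegree ≤ N) {z : ℂ}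
    (hz : ‖z‖ = 1) : (conjReflect N p).eval z = z ^ N * starRingEnd ℂ (p.eval z) := by
  have h0 : z ≠ 0 := by rintro rfl; simp at hz
  rw [eval_conjReflect hp h0, ← Complex.inv_eq_conj hz, inv_inv]

theorem coeff_conjReflect {N : ℕ} {p : ℂ[X]} {i : ℕ} (hi : i ≤ N) :
    (conjReflect N p).coeff i = starRingEnd ℂ (p.coeff (N - i)) := by
  rw [conjReflect, coeff_reflect, revAt_le hi, coeff_map]

/-- The **Fejér–Riesz theorem** for trigonometric polynomials that are positive on the circle. -/
theorem fejer_riesz (n : ℕ) (w : ℂ[X]) (hdeg : w.natDegree ≤ 2 * n)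
    (hpos : ∀ z : ℂ, ‖z‖ = 1 → ∃ r : ℝ, 0 < r ∧ w.eval z = r * z ^ n) :
    ∃ p : ℂ[X], p.natDegree ≤ n ∧
      ∀ z : ℂ, ‖z‖ = 1 → w.eval z = ((‖p.eval z‖ ^ 2 : ℝ) : ℂ) * z ^ n := by
  induction n generalizing w with
  | zero =>
    obtain ⟨r, hr, h1⟩ := hpos 1 (by simp)
    rw [eq_C_of_natDegree_le_zero hdeg] at h1 ⊢
    refine ⟨C (Real.sqrt r : ℂ), by simp, fun z _ => ?_⟩
    simp only [eval_C, pow_zero, mul_one] at h1 ⊢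
    rw [h1, Complex.norm_real, Real.norm_eq_abs, sq_abs, Real.sq_sqrt hr.le]
  | succ n ih =>
    -- `w(z) / z^(n+1)` is real on the circle, hence `w` is self-reciprocal: its zeros come in pairs
    -- `r`, `1 / conj r`, and its extreme coefficients vanish together.
    have hself : conjReflect (2 * (n + 1)) w = w := by
      apply polynomial_eq_of_eqOn_unit_circle
      intro z hz
      obtain ⟨r, hr, h1⟩ := hpos z hz
      rw [eval_conjReflect_of_norm_eq_one hdeg hz, h1]
      have : z * starRingEnd ℂ z = 1 := by rw [Complex.mul_conj']; simp [hz]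
      calc z ^ (2 * (n + 1)) * starRingEnd ℂ (r * z ^ (n + 1))
          = r * z ^ (n + 1) * (z * starRingEnd ℂ z) ^ (n + 1) := by
            simp only [map_mul, map_pow, Complex.conj_ofReal]; ring
        _ = _ := by rw [this, one_pow, mul_one]
    by_cases h0 : w.coeff 0 = 0
    · obtain ⟨v, hv⟩ := X_dvd_iff.2 h0
      have htop : w.coeff (2 * (n + 1)) = 0 := by
        have := coeff_conjReflect (p := w) (le_refl (2 * (n + 1)))
        rw [hself, Nat.sub_self, h0, map_zero] at this
        exact this
      have hvdeg : v.natDegree ≤ 2 * n := by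
        rw [natDegree_le_iff_coeff_eq_zero]
        intro k hk
        have hk' : w.coeff (k + 1) = v.coeff k := by rw [hv, coeff_X_mul]
        rw [← hk']
        rcases Nat.lt_or_ge (2 * (n + 1)) (k + 1) with h | h
        · exact coeff_eq_zero_of_natDegree_lt (hdeg.trans_lt h)
        · rw [show k + 1 = 2 * (n + 1) by omega, htop]
      obtain ⟨p, hp, hpw⟩ := ih v hvdeg (fun z hz => by
        obtain ⟨r, hr, h1⟩ := hpos z hz
        have hz0 : z ≠ 0 := by rintro rfl; simp at hz
        refine ⟨r, hr, mul_left_cancel₀ hz0 ?_⟩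
        have : w.eval z = z * v.eval z := by rw [hv]; simp
        rw [← this, h1]; ring)
      refine ⟨p, hp.trans (Nat.le_succ n), fun z hz => ?_⟩
      have : w.eval z = z * v.eval z := by rw [hv]; simp
      rw [this, hpw z hz]; ring
    · have htop : w.coeff (2 * (n + 1)) ≠ 0 := by
        have := coeff_conjReflect (p := w) (le_refl (2 * (n + 1)))
        rw [hself, Nat.sub_self] at this
        rw [this]; simpa using h0
      have hw0 : w ≠ 0 := by rintro rfl; simp at h0
      have hdegpos : w.degree ≠ 0 := by
        intro h
        have : w.natDegree = 0 := natDegree_eq_of_degree_eq_some h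
        exact htop (coeff_eq_zero_of_natDegree_lt (by omega))
      obtain ⟨r, hr⟩ := Complex.isAlgClosed.exists_root w hdegpos
      have hr0 : r ≠ 0 := by
        rintro rfl
        rw [IsRoot, ← coeff_zero_eq_eval_zero] at hr
        exact h0 hr
      -- Strict positivity on the circle is used here: without zeros on the circle, the two members
      -- of a pair are distinct and can be divided out together.
      have hnorm : ‖r‖ ≠ 1 := by
        intro h
        obtain ⟨t, ht, h1⟩ := hpos r h
        rw [hr] at h1
        have : (t : ℂ) * r ^ (n + 1) ≠ 0 :=
          mul_ne_zero (by exact_mod_cast ht.ne') (pow_ne_zero _ hr0)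
        exact this h1.symm
      set r' := (starRingEnd ℂ r)⁻¹ with hr'
      have hcr : starRingEnd ℂ r ≠ 0 := by simpa using hr0
      have hr'root : w.IsRoot r' := by
        have hr'0 : r' ≠ 0 := inv_ne_zero hcr
        have := eval_conjReflect hdeg hr'0
        rw [hself, hr', map_inv₀, Complex.conj_conj, inv_inv, hr, map_zero, mul_zero] at this
        exact this
      have hne : r' ≠ r := by
        intro h
        rw [hr'] at h
        have h2 : r * starRingEnd ℂ r = 1 := by
          nth_rewrite 1 [← h]; exact inv_mul_cancel₀ hcr
        rw [Complex.mul_conj'] at h2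
        have h3 : ‖r‖ ^ 2 = 1 := by exact_mod_cast h2
        exact hnorm (by nlinarith [norm_nonneg r])
      obtain ⟨u, hu⟩ := dvd_iff_isRoot.2 hr
      have hur : u.IsRoot r' := by
        have h : w.eval r' = 0 := hr'root
        rw [hu] at h
        simp only [eval_mul, eval_sub, eval_X, eval_C] at h
        exact (mul_eq_zero.1 h).resolve_left (sub_ne_zero.2 hne)
      obtain ⟨v, hv⟩ := dvd_iff_isRoot.2 hur
      -- Normalized so that the removed factor is `(z - r)(1 - conj r · z)`, which equals `z |z -
      -- r|²` on the circle; the quotient then inherits positivity.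
      set v' := C (-(starRingEnd ℂ r)⁻¹) * v with hv'
      have hwv : w = (X - C r) * (1 - C (starRingEnd ℂ r) * X) * v' := by
        have : (1 - C (starRingEnd ℂ r) * X) * C (-(starRingEnd ℂ r)⁻¹) = X - C r' := by
          rw [hr', C_neg, mul_neg, sub_mul, one_mul, mul_right_comm, ← C_mul,
            mul_inv_cancel₀ hcr, C_1]
          ring
        rw [hv', ← mul_assoc, mul_assoc (X - C r), this, mul_assoc, ← hv, ← hu]
      have hv'0 : v' ≠ 0 := by rintro h; rw [h, mul_zero] at hwv; exact hw0 hwv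
      have hvdeg : v'.natDegree ≤ 2 * n := by
        have hq0 : (1 - C (starRingEnd ℂ r) * X : ℂ[X]) ≠ 0 := by
          rintro h; rw [h, mul_zero, zero_mul] at hwv; exact hw0 hwv
        have h1 : (1 - C (starRingEnd ℂ r) * X : ℂ[X]).natDegree = 1 := by
          have : (1 - C (starRingEnd ℂ r) * X : ℂ[X]) = C (-starRingEnd ℂ r) * X + C 1 := by
            simp; ring
          rw [this]
          exact natDegree_linear (by simpa using hcr)
        have := congrArg natDegree hwv
        rw [natDegree_mul (mul_ne_zero (X_sub_C_ne_zero r) hq0) hv'0,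
          natDegree_mul (X_sub_C_ne_zero r) hq0, natDegree_X_sub_C, h1] at this
        omega
      have hfac : ∀ z : ℂ, ‖z‖ = 1 →
          w.eval z = ((‖z - r‖ ^ 2 : ℝ) : ℂ) * z * v'.eval z := by
        intro z hz
        have hz1 : z * starRingEnd ℂ z = 1 := by rw [Complex.mul_conj']; simp [hz]
        have h2 : ((‖z - r‖ ^ 2 : ℝ) : ℂ) = (z - r) * (starRingEnd ℂ z - starRingEnd ℂ r) := by
          rw [← map_sub, Complex.mul_conj']; push_cast; rfl
        have : w.eval z = (z - r) * (1 - starRingEnd ℂ r * z) * v'.eval z := by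
          conv_lhs => rw [hwv]
          simp
        rw [this, h2]
        linear_combination (-(z - r) * v'.eval z) * hz1
      obtain ⟨p, hp, hpw⟩ := ih v' hvdeg (fun z hz => by
        obtain ⟨t, ht, h1⟩ := hpos z hz
        have hz0 : z ≠ 0 := by rintro rfl; simp at hz
        have hzr : ‖z - r‖ ≠ 0 := by
          rw [norm_ne_zero_iff, sub_ne_zero]; rintro rfl; exact hnorm hz
        refine ⟨t / ‖z - r‖ ^ 2, by positivity, ?_⟩
        have h2 := hfac z hz
        rw [h1] at h2
        have h3 : ((‖z - r‖ ^ 2 : ℝ) : ℂ) ≠ 0 := by exact_mod_cast pow_ne_zero 2 hzr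
        rw [Complex.ofReal_div, div_mul_eq_mul_div, eq_div_iff h3]
        apply mul_left_cancel₀ hz0
        linear_combination -h2)
      refine ⟨(X - C r) * p, ?_, fun z hz => ?_⟩
      · refine natDegree_mul_le.trans ?_
        rw [natDegree_X_sub_C]; omega
      · rw [hfac z hz, hpw z hz]
        simp only [eval_mul, eval_sub, eval_X, eval_C, norm_mul]
        push_cast
        ring

end FejerRiesz

section PhaseProcessingCompleteness

/-! ### Completeness of quantum phase processing -/

open Polynomial

theorem Ry_mul_Rz_apply (θ φ : ℝ) :
    (Ry θ * Rz φ).1 0 0 = (Real.cos (θ / 2) : ℂ) * Complex.exp (-((φ / 2 : ℝ) * Complex.I)) ∧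
    (Ry θ * Rz φ).1 0 1 = -(Real.sin (θ / 2) : ℂ) * Complex.exp ((φ / 2 : ℝ) * Complex.I) ∧
    (Ry θ * Rz φ).1 1 0 = (Real.sin (θ / 2) : ℂ) * Complex.exp (-((φ / 2 : ℝ) * Complex.I)) ∧
    (Ry θ * Rz φ).1 1 1 = (Real.cos (θ / 2) : ℂ) * Complex.exp ((φ / 2 : ℝ) * Complex.I) := by
  refine ⟨?_, ?_, ?_, ?_⟩ <;> simp [Ry, Rz]

theorem conj_exp_mul_I (x : ℝ) :
    starRingEnd ℂ (Complex.exp (x * Complex.I)) = Complex.exp (-(x * Complex.I)) := by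
  rw [← Complex.exp_conj]; simp

theorem conj_exp_neg_mul_I (x : ℝ) :
    starRingEnd ℂ (Complex.exp (-(x * Complex.I))) = Complex.exp (x * Complex.I) := by
  rw [← Complex.exp_conj]; simp

/-- Up to a phase, every unit vector is the second row of `R_y(θ) R_z(φ)`. -/
theorem exists_Ry_mul_Rz_row (a b : ℂ) (h : ‖a‖ ^ 2 + ‖b‖ ^ 2 = 1) :
    ∃ (θ φ : ℝ) (c : ℂ), ‖c‖ = 1 ∧ a = c * (Ry θ * Rz φ).1 1 0 ∧
      b = c * (Ry θ * Rz φ).1 1 1 := by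
  have hb : ‖b‖ ≤ 1 := by nlinarith [norm_nonneg b, sq_nonneg ‖a‖]
  have hcos : Real.cos (Real.arccos ‖b‖) = ‖b‖ :=
    Real.cos_arccos (by linarith [norm_nonneg b]) hb
  have hsin : Real.sin (Real.arccos ‖b‖) = ‖a‖ := by
    rw [Real.sin_arccos, ← h, add_sub_cancel_right, Real.sqrt_sq (norm_nonneg a)]
  refine ⟨2 * Real.arccos ‖b‖, b.arg - a.arg,
    Complex.exp (((a.arg + b.arg) / 2 : ℝ) * Complex.I), Complex.norm_exp_ofReal_mul_I _, ?_, ?_⟩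
  · rw [(Ry_mul_Rz_apply _ _).2.2.1, mul_div_cancel_left₀ _ two_ne_zero, hsin, mul_left_comm,
      ← Complex.exp_add]
    conv_lhs => rw [← Complex.norm_mul_exp_arg_mul_I a]
    congr 2
    push_cast; ring
  · rw [(Ry_mul_Rz_apply _ _).2.2.2, mul_div_cancel_left₀ _ two_ne_zero, hcos, mul_left_comm,
      ← Complex.exp_add]
    conv_lhs => rw [← Complex.norm_mul_exp_arg_mul_I b]
    congr 2
    push_cast; ring

/-- The layer to be stripped off must be orthogonal to the lowest coefficients and parallel to the
highest ones. In two dimensions this is possible because the two coefficient vectors are orthogonal;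
`v` itself is used, or the complement of `u` if `v = 0`. -/
theorem exists_unit_vector_orthogonal (u0 u1 v0 v1 : ℂ)
    (h : u0 * starRingEnd ℂ v0 + u1 * starRingEnd ℂ v1 = 0) :
    ∃ w0 w1 : ℂ, ‖w0‖ ^ 2 + ‖w1‖ ^ 2 = 1 ∧
      u0 * starRingEnd ℂ w0 + u1 * starRingEnd ℂ w1 = 0 ∧ v0 * w1 - v1 * w0 = 0 := by
  have norm_case : ∀ x y : ℂ, ¬ (x = 0 ∧ y = 0) →
      u0 * starRingEnd ℂ x + u1 * starRingEnd ℂ y = 0 → v0 * y - v1 * x = 0 →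
      ∃ w0 w1 : ℂ, ‖w0‖ ^ 2 + ‖w1‖ ^ 2 = 1 ∧
      u0 * starRingEnd ℂ w0 + u1 * starRingEnd ℂ w1 = 0 ∧ v0 * w1 - v1 * w0 = 0 := by
    intro x y hxy h1 h2
    have hpos : 0 < ‖x‖ ^ 2 + ‖y‖ ^ 2 := by
      by_cases hx : x = 0
      · have hy : y ≠ 0 := fun hy => hxy ⟨hx, hy⟩
        have := norm_pos_iff.2 hy
        positivity
      · have := norm_pos_iff.2 hx
        positivity
    set r := Real.sqrt (‖x‖ ^ 2 + ‖y‖ ^ 2)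
    have hr : 0 < r := Real.sqrt_pos.2 hpos
    have hr2 : r ^ 2 = ‖x‖ ^ 2 + ‖y‖ ^ 2 := Real.sq_sqrt hpos.le
    refine ⟨x * (r⁻¹ : ℝ), y * (r⁻¹ : ℝ), ?_, ?_, ?_⟩
    · rw [norm_mul, norm_mul, mul_pow, mul_pow, ← add_mul, ← hr2, Complex.norm_real,
        Real.norm_eq_abs, sq_abs, ← mul_pow, mul_inv_cancel₀ hr.ne', one_pow]
    · simp only [map_mul, Complex.conj_ofReal]
      linear_combination ((r⁻¹ : ℝ) : ℂ) * h1
    · linear_combination ((r⁻¹ : ℝ) : ℂ) * h2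
  by_cases hv : v0 = 0 ∧ v1 = 0
  · obtain ⟨rfl, rfl⟩ := hv
    by_cases hu : u0 = 0 ∧ u1 = 0
    · obtain ⟨rfl, rfl⟩ := hu
      exact ⟨1, 0, by simp⟩
    · refine norm_case (-starRingEnd ℂ u1) (starRingEnd ℂ u0) ?_ ?_ (by simp)
      · simpa [and_comm] using hu
      · simp; ring
  · exact norm_case v0 v1 hv h (by ring)

theorem qppRow_congr (ω : ℝ) {θ φ θ' φ' : ℕ → ℝ} (k : ℕ) (hθ : ∀ i ≤ k, θ i = θ' i)
    (hφ : ∀ i ≤ k, φ i = φ' i) : qppRow ω θ φ k = qppRow ω θ' φ' k := by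
  induction k with
  | zero => simp [qppRow, hθ 0 le_rfl, hφ 0 le_rfl]
  | succ k ih =>
    have := ih (fun i hi => hθ i (hi.trans (Nat.le_succ k)))
      (fun i hi => hφ i (hi.trans (Nat.le_succ k)))
    funext b
    simp only [qppRow, this, hθ (k + 1) le_rfl, hφ (k + 1) le_rfl]

/-- Layer stripping: multiplying by the inverse of a suitable rotation lowers the degree of the
first entry and makes the second divisible by the variable, so both entries drop to degree `L` after
undoing one signal. Unitarity on the circle survives. -/
theorem exists_qppRow (L : ℕ) (v : Fin 2 → ℂ[X]) (hdeg : ∀ b, (v b).natDegree ≤ L)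
    (hunit : ∀ z : ℂ, ‖z‖ = 1 → ‖(v 0).eval z‖ ^ 2 + ‖(v 1).eval z‖ ^ 2 = 1) :
    ∃ (ω : ℝ) (θ φ : ℕ → ℝ) (c : ℂ), ‖c‖ = 1 ∧ ∀ b, v b = C c * qppRow ω θ φ L b := by
  induction L generalizing v with
  | zero =>
    have h0 := eq_C_of_natDegree_le_zero (hdeg 0)
    have h1 := eq_C_of_natDegree_le_zero (hdeg 1)
    have h := hunit 1 (by simp)
    rw [h0, h1, eval_C, eval_C] at h
    obtain ⟨θ, φ, c, hc, ha, hb⟩ := exists_Ry_mul_Rz_row _ _ h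
    have hz : Rz 0 = 1 := by
      apply Subtype.ext
      ext i j
      fin_cases i <;> fin_cases j <;> simp [Rz]
    refine ⟨0, fun _ => θ, fun _ => φ, c, hc, fun b => ?_⟩
    fin_cases b
    · simp only [Fin.zero_eta]
      rw [h0, ha, qppRow, hz, one_mul, C_mul]
    · simp only [Fin.mk_one]
      rw [h1, hb, qppRow, hz, one_mul, C_mul]
  | succ L ih =>
    -- The norm condition on the circle is a polynomial identity with right-hand side `X ^ (L + 1)`;
    -- its constant coefficient is this orthogonality.
    have horth : (v 0).coeff 0 * starRingEnd ℂ ((v 0).coeff (L + 1)) +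
        (v 1).coeff 0 * starRingEnd ℂ ((v 1).coeff (L + 1)) = 0 := by
      have hpoly : v 0 * conjReflect (L + 1) (v 0) + v 1 * conjReflect (L + 1) (v 1) =
          X ^ (L + 1) := by
        apply polynomial_eq_of_eqOn_unit_circle
        intro z hz
        rw [eval_add, eval_mul, eval_mul, eval_conjReflect_of_norm_eq_one (hdeg 0) hz,
          eval_conjReflect_of_norm_eq_one (hdeg 1) hz, eval_pow, eval_X]
        have h := hunit z hz
        have h' : eval z (v 0) * starRingEnd ℂ (eval z (v 0)) +
            eval z (v 1) * starRingEnd ℂ (eval z (v 1)) = 1 := by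
          rw [Complex.mul_conj', Complex.mul_conj']
          exact_mod_cast h
        linear_combination z ^ (L + 1) * h'
      have := congrArg (fun p => coeff p 0) hpoly
      simpa [mul_coeff_zero, coeff_conjReflect, coeff_X_pow] using this
    obtain ⟨w0, w1, hw, hu, hv⟩ := exists_unit_vector_orthogonal _ _ _ _ horth
    obtain ⟨θ₀, φ₀, c₀, hc₀, ha, hb⟩ := exists_Ry_mul_Rz_row _ _ hw
    obtain ⟨e00, e01, e10, e11⟩ := Ry_mul_Rz_apply θ₀ φ₀
    set A := (Ry θ₀ * Rz φ₀).1 with hA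
    have hc₀' : c₀ ≠ 0 := by rintro rfl; simp at hc₀
    have k00 : starRingEnd ℂ (A 0 0) = A 1 1 := by
      rw [e00, e11, map_mul, Complex.conj_ofReal, conj_exp_neg_mul_I]
    have k01 : starRingEnd ℂ (A 0 1) = -A 1 0 := by
      rw [e01, e10, map_mul, map_neg, Complex.conj_ofReal, conj_exp_mul_I, neg_mul]
    have k10 : starRingEnd ℂ (A 1 0) = -A 0 1 := by
      rw [e01, e10, map_mul, Complex.conj_ofReal, conj_exp_neg_mul_I, neg_mul, neg_neg]
    have k11 : starRingEnd ℂ (A 1 1) = A 0 0 := by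
      rw [e00, e11, map_mul, Complex.conj_ofReal, conj_exp_mul_I]
    have hdet : A 0 0 * A 1 1 - A 0 1 * A 1 0 = 1 := by
      have hexp : Complex.exp (-((φ₀ / 2 : ℝ) * Complex.I)) *
          Complex.exp ((φ₀ / 2 : ℝ) * Complex.I) = 1 := by
        rw [← Complex.exp_add, neg_add_cancel, Complex.exp_zero]
      have htrig : (Real.cos (θ₀ / 2) : ℂ) ^ 2 + (Real.sin (θ₀ / 2) : ℂ) ^ 2 = 1 := by
        exact_mod_cast Real.cos_sq_add_sin_sq (θ₀ / 2)
      rw [e00, e01, e10, e11]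
      linear_combination ((Real.cos (θ₀ / 2) : ℂ) ^ 2 + (Real.sin (θ₀ / 2) : ℂ) ^ 2) * hexp + htrig
    have hu' : (v 0).coeff 0 * (-A 0 1) + (v 1).coeff 0 * A 0 0 = 0 := by
      rw [ha, hb, map_mul, map_mul, k10, k11] at hu
      have : starRingEnd ℂ c₀ * ((v 0).coeff 0 * (-A 0 1) + (v 1).coeff 0 * A 0 0) = 0 := by
        linear_combination hu
      exact (mul_eq_zero.1 this).resolve_left (by simpa using hc₀')
    have hv' : (v 0).coeff (L + 1) * A 1 1 - (v 1).coeff (L + 1) * A 1 0 = 0 := by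
      rw [ha, hb] at hv
      have : c₀ * ((v 0).coeff (L + 1) * A 1 1 - (v 1).coeff (L + 1) * A 1 0) = 0 := by
        linear_combination hv
      exact (mul_eq_zero.1 this).resolve_left hc₀'
    -- `(x, y)` is the row `v` times the inverse of `A`, which has determinant 1.
    set x : ℂ[X] := C (A 1 1) * v 0 - C (A 1 0) * v 1 with hx
    set y : ℂ[X] := C (A 0 0) * v 1 - C (A 0 1) * v 0 with hy
    have hy0 : y.coeff 0 = 0 := by
      rw [hy, coeff_sub, coeff_C_mul, coeff_C_mul]; linear_combination hu'
    have hxL : x.coeff (L + 1) = 0 := by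
      rw [hx, coeff_sub, coeff_C_mul, coeff_C_mul]; linear_combination hv'
    obtain ⟨y', hy'⟩ := X_dvd_iff.2 hy0
    have hcoeff : ∀ k, L + 1 < k → (v 0).coeff k = 0 ∧ (v 1).coeff k = 0 := fun k hk =>
      ⟨coeff_eq_zero_of_natDegree_lt ((hdeg 0).trans_lt hk),
        coeff_eq_zero_of_natDegree_lt ((hdeg 1).trans_lt hk)⟩
    have hxdeg : x.natDegree ≤ L := by
      rw [natDegree_le_iff_coeff_eq_zero]
      intro k hk
      rcases Nat.lt_or_ge (L + 1) k with h | h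
      · rw [hx, coeff_sub, coeff_C_mul, coeff_C_mul, (hcoeff k h).1, (hcoeff k h).2]; simp
      · rw [show k = L + 1 by omega, hxL]
    have hydeg : y'.natDegree ≤ L := by
      rw [natDegree_le_iff_coeff_eq_zero]
      intro k hk
      have : y.coeff (k + 1) = y'.coeff k := by rw [hy', coeff_X_mul]
      rw [← this, hy, coeff_sub, coeff_C_mul, coeff_C_mul, (hcoeff (k + 1) (by omega)).1,
        (hcoeff (k + 1) (by omega)).2]
      simp
    obtain ⟨ω, θ, φ, c, hc, hrow⟩ := ih ![x, y'] (by
      intro b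
      fin_cases b
      · exact hxdeg
      · exact hydeg) (by
      intro z hz
      have h1 : ‖y'.eval z‖ = ‖y.eval z‖ := by rw [hy', eval_mul, eval_X, norm_mul, hz, one_mul]
      have h := hunit z hz
      have h' : eval z (v 0) * starRingEnd ℂ (eval z (v 0)) +
          eval z (v 1) * starRingEnd ℂ (eval z (v 1)) = 1 := by
        rw [Complex.mul_conj', Complex.mul_conj']
        exact_mod_cast h
      have h2 : eval z x * starRingEnd ℂ (eval z x) +
          eval z y * starRingEnd ℂ (eval z y) = 1 := by
        rw [hx, hy]
        simp only [eval_sub, eval_mul, eval_C, map_sub, map_mul, k00, k01, k10, k11]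
        linear_combination h' + (eval z (v 0) * starRingEnd ℂ (eval z (v 0)) +
          eval z (v 1) * starRingEnd ℂ (eval z (v 1))) * hdet
      rw [Complex.mul_conj', Complex.mul_conj'] at h2
      simp only [cons_val_zero, cons_val_one, h1]
      exact_mod_cast h2)
    have hx2 : x = C c * qppRow ω θ φ L 0 := hrow 0
    have hy2 : y' = C c * qppRow ω θ φ L 1 := hrow 1
    refine ⟨ω, Function.update θ (L + 1) θ₀, Function.update φ (L + 1) φ₀, c, hc, fun b => ?_⟩
    have hcongr : qppRow ω (Function.update θ (L + 1) θ₀) (Function.update φ (L + 1) φ₀) L =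
        qppRow ω θ φ L :=
      qppRow_congr ω L (fun i hi => Function.update_of_ne (by omega) _ _)
        (fun i hi => Function.update_of_ne (by omega) _ _)
    have hb : C c * qppRow ω (Function.update θ (L + 1) θ₀) (Function.update φ (L + 1) φ₀) (L + 1) b
        = x * C (A 0 b) + y * C (A 1 b) := by
      rw [qppRow, hcongr, Function.update_self, Function.update_self, ← hA, hx2, hy', hy2]
      ring
    have hdetC : C (A 0 0) * C (A 1 1) - C (A 0 1) * C (A 1 0) = (1 : ℂ[X]) := by
      rw [← C_mul, ← C_mul, ← C_sub, hdet, C_1]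
    rw [hb, hx, hy]
    fin_cases b
    · simp only [Fin.zero_eta]
      linear_combination (-v 0) * hdetC
    · simp only [Fin.mk_one]
      linear_combination (-v 1) * hdetC

theorem natDegree_laurentLift_le (d : ℕ) (Q : ℝ[X]) (hd : Q.natDegree ≤ d) :
    (laurentLift d Q).natDegree ≤ 2 * d := by
  rw [laurentLift]
  refine natDegree_sum_le_of_forall_le _ _ fun i hi => ?_
  have hi' : i ≤ d := by rw [Finset.mem_range] at hi; omega
  refine (natDegree_C_mul_le _ _).trans (natDegree_mul_le.trans ?_)
  have h1 : (X ^ (d - i) : ℂ[X]).natDegree ≤ d - i := natDegree_X_pow_le _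
  have h2 : ((C (1 / 2) * (X ^ 2 + 1) : ℂ[X]) ^ i).natDegree ≤ i * 2 := by
    refine natDegree_pow_le_of_le i ((natDegree_C_mul_le _ _).trans ?_)
    refine (natDegree_add_le _ _).trans ?_
    simp
  omega

theorem eval_laurentLift (d : ℕ) (Q : ℝ[X]) (hd : Q.natDegree ≤ d) (z : ℂ) (hz : ‖z‖ = 1) :
    (laurentLift d Q).eval z = z ^ d * (Q.eval z.re : ℝ) := by
  have h0 : z ≠ 0 := by rintro rfl; simp at hz
  have h := aeval_laurentLift z z⁻¹ (mul_inv_cancel₀ h0) (inv_mul_cancel₀ h0) d Q hd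
  rw [coe_aeval_eq_eval] at h
  rw [h, coe_aeval_eq_eval, eval_map]
  congr 1
  have : algebraMap ℂ ℂ (1 / 2) * (z + z⁻¹) = algebraMap ℝ ℂ z.re := by
    rw [Complex.inv_eq_conj hz, Complex.add_conj]
    simp
  rw [this, eval₂_at_apply]
  rfl

/-- Phase processing realizes every bounded real polynomial. -/
theorem exists_qppParams (Q : ℝ[X]) (d : ℕ) (hd : Q.natDegree ≤ d)
    (hQ : ∀ x ∈ Set.Icc (-1 : ℝ) 1, |Q.eval x| ≤ 1 / 2) :
    ∃ p : QPPParams, p.L = 2 * d ∧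
      ∀ (n m : ℕ) (ρ : Matrix (Reg n) (Reg n) ℂ) (U : unitaryGroup (OracleReg n m) ℂ),
        IsPurifiedOracle U ρ → Circuit.outcomeProb U (qppCircuit p) 1 =
          (aeval ρ (Q.map (algebraMap ℝ ℂ)) * ρ *
            (aeval ρ (Q.map (algebraMap ℝ ℂ)))ᴴ).trace.re := by
  have hre : ∀ z : ℂ, ‖z‖ = 1 → |Q.eval z.re| ≤ 1 / 2 := fun z hz => by
    have := abs_le.1 (Complex.abs_re_le_norm z)
    rw [hz] at this
    exact hQ _ this
  set q := laurentLift d Q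
  have hqdeg : q.natDegree ≤ 2 * d := natDegree_laurentLift_le d Q hd
  -- On the circle `z^(2d) - q² = z^(2d) (1 - Q(Re z)²)`. The bound `1/2` on `Q` makes the bracket
  -- strictly positive, and `r` completes `q` to a unit row.
  obtain ⟨r, hrdeg, hr⟩ := fejer_riesz (2 * d) (X ^ (2 * d) - q ^ 2) (by
      refine (natDegree_sub_le _ _).trans (max_le ?_ ?_)
      · exact (natDegree_X_pow_le _).trans (by omega)
      · exact natDegree_pow_le_of_le 2 hqdeg) (by
      intro z hz
      refine ⟨1 - Q.eval z.re ^ 2, ?_, ?_⟩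
      · have := abs_le.1 (hre z hz)
        nlinarith
      · rw [eval_sub, eval_pow, eval_pow, eval_X, eval_laurentLift d Q hd z hz]
        push_cast; ring)
  obtain ⟨ω, θ, φ, c, hc, hrow⟩ := exists_qppRow (2 * d) ![q, r] (by
      intro b
      fin_cases b
      · exact hqdeg
      · exact hrdeg) (by
      intro z hz
      have h := hr z hz
      have h0 : z ≠ 0 := by rintro rfl; simp at hz
      rw [eval_sub, eval_pow, eval_pow, eval_X, eval_laurentLift d Q hd z hz] at h
      have h2 : ((1 - Q.eval z.re ^ 2 : ℝ) : ℂ) = ((‖r.eval z‖ ^ 2 : ℝ) : ℂ) := by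
        apply mul_right_cancel₀ (pow_ne_zero (2 * d) h0)
        rw [← h]
        push_cast; ring
      have h3 : 1 - Q.eval z.re ^ 2 = ‖r.eval z‖ ^ 2 := by exact_mod_cast h2
      simp only [cons_val_zero, cons_val_one]
      rw [← h3, eval_laurentLift d Q hd z hz, norm_mul, norm_pow, hz, one_pow, one_mul,
        Complex.norm_real, Real.norm_eq_abs, sq_abs]
      ring)
  have hc0 : c ≠ 0 := by rintro rfl; simp at hc
  refine ⟨⟨2 * d, ω, θ, φ⟩, rfl, fun n m ρ U hU => ?_⟩
  refine outcomeProb_qppCircuit U hU _ d rfl Q hd c⁻¹ (by rw [norm_inv, hc, inv_one]) ?_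
  have h0 : q = C c * qppRow ω θ φ (2 * d) 0 := hrow 0
  change qppRow ω θ φ (2 * d) 0 = C c⁻¹ * q
  rw [h0, ← mul_assoc, ← C_mul, inv_mul_cancel₀ hc0, C_1, one_mul]

end PhaseProcessingCompleteness

/-! ### Amplitude amplification -/

section Grover

variable {n m : ℕ} (U : unitaryGroup (OracleReg n m) ℂ)

/-- The state of a circuit that is run on the all-zero state. -/
def Circuit.state (c : Circuit n m) : FullReg n m → ℂ :=
  (Circuit.eval U c).1 *ᵥ Pi.single (0, ((0, 0), (0, 0))) 1

/-- The part of a state vector in which the ancilla has the value `b`. -/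
def ancillaPart (b : Fin 2) (v : FullReg n m → ℂ) : FullReg n m → ℂ :=
  fun x => if x.1 = b then v x else 0

theorem ancillaPart_add (v : FullReg n m → ℂ) : ancillaPart 0 v + ancillaPart 1 v = v := by
  funext ⟨a, x⟩
  fin_cases a <;> simp [ancillaPart]

theorem outcomeProb_eq_normSq (c : Circuit n m) (b : Fin 2) :
    c.outcomeProb U b = normSq (ancillaPart b (c.state U)) := by
  rw [normSq, Fintype.sum_prod_type, Fintype.sum_eq_single b]
  · simp [ancillaPart, Circuit.outcomeProb, Circuit.state]
  · intro a ha
    simp [ancillaPart, ha]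

theorem outcomeProb_nonneg (c : Circuit n m) (b : Fin 2) : 0 ≤ c.outcomeProb U b :=
  Finset.sum_nonneg fun _ _ => by positivity

theorem star_dotProduct_ancillaPart (b : Fin 2) (v : FullReg n m → ℂ) :
    star v ⬝ᵥ ancillaPart b v = (normSq (ancillaPart b v) : ℝ) := by
  rw [normSq_eq_dotProduct, dotProduct, dotProduct]
  refine Finset.sum_congr rfl fun x _ => ?_
  by_cases h : x.1 = b <;> simp [ancillaPart, h]

theorem outcomeProb_zero_add_one (c : Circuit n m) :
    c.outcomeProb U 0 + c.outcomeProb U 1 = 1 := by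
  have h1 : normSq (c.state U) = 1 := by
    rw [Circuit.state, normSq_unitary_mulVec, normSq, Fintype.sum_eq_single (0, ((0, 0), (0, 0)))]
    · simp
    · intro x hx; simp [hx]
  have h2 : ((normSq (c.state U) : ℝ) : ℂ) = (c.outcomeProb U 0 + c.outcomeProb U 1 : ℝ) := by
    rw [normSq_eq_dotProduct]
    nth_rewrite 2 [← ancillaPart_add (c.state U)]
    rw [dotProduct_add, star_dotProduct_ancillaPart, star_dotProduct_ancillaPart,
      outcomeProb_eq_normSq, outcomeProb_eq_normSq]
    push_cast; rfl
  rw [h1] at h2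
  exact_mod_cast h2.symm

theorem reflector_mulVec {X : Type*} [Fintype X] [DecidableEq X] (x₀ : X) (v : X → ℂ) :
    (reflector x₀).1 *ᵥ v = (2 * v x₀) • Pi.single x₀ 1 - v := by
  funext x
  rw [reflector, mulVec_diagonal]
  by_cases h : x = x₀
  · subst h; simp; ring
  · simp [h]

/-- Conjugating the reflection about the all-zero state by the circuit gives the reflection about
the state that the circuit prepares. -/
theorem eval_grover_mulVec (A : Circuit n m) (v : FullReg n m → ℂ) :
    (Circuit.eval U (grover A)).1 *ᵥ v =
      (2 * (star (A.state U) ⬝ᵥ ((onAncilla (reflector 0) : unitaryGroup (FullReg n m) ℂ).1 *ᵥ v)))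
        • A.state U - (onAncilla (reflector 0) : unitaryGroup (FullReg n m) ℂ).1 *ᵥ v := by
  have e : Circuit.eval U (grover A) = Circuit.eval U A *
      reflector (0, ((0, 0), (0, 0))) * (Circuit.eval U A)⁻¹ * onAncilla (reflector 0) := by
    rw [grover, Circuit.eval_append, Circuit.eval_append, Circuit.eval_append, Circuit.eval_inv]
    simp [Circuit.eval, Gate.eval, mul_assoc]
  set W := Circuit.eval U A
  rw [e, Submonoid.coe_mul, Submonoid.coe_mul, Submonoid.coe_mul, ← mulVec_mulVec,
    ← mulVec_mulVec, ← mulVec_mulVec]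
  set u := (onAncilla (reflector 0) : unitaryGroup (FullReg n m) ℂ).1 *ᵥ v
  have hinv : W.1 *ᵥ ((W⁻¹).1 *ᵥ u) = u := by
    rw [mulVec_mulVec, ← Submonoid.coe_mul, mul_inv_cancel]; simp
  have hcoord : ((W⁻¹).1 *ᵥ u) (0, ((0, 0), (0, 0))) = star (A.state U) ⬝ᵥ u := by
    rw [mulVec, dotProduct, dotProduct]
    refine Finset.sum_congr rfl fun x _ => ?_
    simp [Circuit.state, W, star_apply]
  rw [reflector_mulVec, mulVec_sub, mulVec_smul, hinv, hcoord, Circuit.state]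

theorem onAncilla_reflector_mulVec (a b : ℂ) (v : FullReg n m → ℂ) :
    (onAncilla (reflector 0) : unitaryGroup (FullReg n m) ℂ).1 *ᵥ
      (a • ancillaPart 0 v + b • ancillaPart 1 v) =
        a • ancillaPart 0 v - b • ancillaPart 1 v := by
  funext ⟨c, x⟩
  rw [onAncilla, onLeft_mulVec, Fintype.sum_eq_single c]
  · fin_cases c <;> simp [ancillaPart, reflector]
  · intro d hd
    simp [reflector, diagonal_apply_ne _ hd.symm]

theorem normSq_smul_eq {X : Type*} [Fintype X] (c : ℂ) (v : X → ℂ) :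
    normSq (c • v) = ‖c‖ ^ 2 * normSq v := by
  simp [normSq, mul_pow, Finset.mul_sum]

theorem state_amplified_succ (A : Circuit n m) (k : ℕ) :
    (amplified A (k + 1)).state U =
      (Circuit.eval U (grover A)).1 *ᵥ (amplified A k).state U := by
  have : amplified A (k + 1) = amplified A k ++ grover A := by
    simp [amplified, List.replicate_succ']
  rw [this, Circuit.state, Circuit.eval_append, Submonoid.coe_mul, ← mulVec_mulVec, Circuit.state]

/-- The plane spanned by the two ancilla components is invariant, and the Grover operator rotates it
by `2θ`. The components are left unnormalized, hence the divisions by `cos θ` and `sin θ`. -/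
theorem state_amplified (A : Circuit n m) (θ : ℝ) (hA : A.outcomeProb U 1 = Real.sin θ ^ 2)
    (hs : Real.sin θ ≠ 0) (hc : Real.cos θ ≠ 0) (k : ℕ) :
    (amplified A k).state U =
      ((Real.cos ((2 * k + 1) * θ) / Real.cos θ : ℝ) : ℂ) • ancillaPart 0 (A.state U) +
        ((Real.sin ((2 * k + 1) * θ) / Real.sin θ : ℝ) : ℂ) • ancillaPart 1 (A.state U) := by
  have h0 : normSq (ancillaPart 0 (A.state U)) = Real.cos θ ^ 2 := by
    have := outcomeProb_zero_add_one U A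
    rw [hA, outcomeProb_eq_normSq] at this
    linarith [Real.sin_sq_add_cos_sq θ]
  have h1 : normSq (ancillaPart 1 (A.state U)) = Real.sin θ ^ 2 := by
    rw [← outcomeProb_eq_normSq, hA]
  induction k with
  | zero =>
    simp only [Nat.cast_zero, mul_zero, zero_add, one_mul, div_self hs, div_self hc,
      Complex.ofReal_one, one_smul, ancillaPart_add]
    simp [amplified]
  | succ k ih =>
    rw [state_amplified_succ, ih, eval_grover_mulVec, onAncilla_reflector_mulVec,
      dotProduct_sub, dotProduct_smul, dotProduct_smul, star_dotProduct_ancillaPart,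
      star_dotProduct_ancillaPart, h0, h1]
    set φ := (2 * (k : ℝ) + 1) * θ with hφ
    have hφ' : (2 * ((k + 1 : ℕ) : ℝ) + 1) * θ = φ + 2 * θ := by rw [hφ]; push_cast; ring
    rw [hφ']
    have e : (2 * (((Real.cos φ / Real.cos θ : ℝ) : ℂ) • ((Real.cos θ ^ 2 : ℝ) : ℂ) -
        ((Real.sin φ / Real.sin θ : ℝ) : ℂ) • ((Real.sin θ ^ 2 : ℝ) : ℂ))) =
        ((2 * Real.cos (φ + θ) : ℝ) : ℂ) := by
      rw [smul_eq_mul, smul_eq_mul, ← Complex.ofReal_mul, ← Complex.ofReal_mul,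
        ← Complex.ofReal_sub, Real.cos_add]
      have : Real.cos φ / Real.cos θ * Real.cos θ ^ 2 - Real.sin φ / Real.sin θ * Real.sin θ ^ 2 =
          Real.cos φ * Real.cos θ - Real.sin φ * Real.sin θ := by
        field_simp
      rw [this]
      push_cast; ring
    rw [e]
    nth_rewrite 1 [← ancillaPart_add (A.state U)]
    have c1 : 2 * Real.cos (φ + θ) - Real.cos φ / Real.cos θ =
        Real.cos (φ + 2 * θ) / Real.cos θ := by
      rw [show φ + 2 * θ = (φ + θ) + θ by ring]
      nth_rewrite 2 [show φ = (φ + θ) - θ by ring]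
      rw [Real.cos_sub, Real.cos_add (φ + θ) θ]
      field_simp
      ring
    have c2 : 2 * Real.cos (φ + θ) + Real.sin φ / Real.sin θ =
        Real.sin (φ + 2 * θ) / Real.sin θ := by
      rw [show φ + 2 * θ = (φ + θ) + θ by ring]
      nth_rewrite 2 [show φ = (φ + θ) - θ by ring]
      rw [Real.sin_sub, Real.sin_add (φ + θ) θ]
      field_simp
      ring
    rw [← c1, ← c2]
    push_cast
    module

/-- Amplification multiplies the angle of the success amplitude by `2 k + 1`. -/
theorem outcomeProb_amplified (A : Circuit n m) (θ : ℝ)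
    (hA : A.outcomeProb U 1 = Real.sin θ ^ 2) (hs : Real.sin θ ≠ 0) (hc : Real.cos θ ≠ 0)
    (k : ℕ) : (amplified A k).outcomeProb U 1 = Real.sin ((2 * k + 1) * θ) ^ 2 := by
  rw [outcomeProb_eq_normSq, state_amplified U A θ hA hs hc]
  have : ancillaPart 1
      (((Real.cos ((2 * k + 1) * θ) / Real.cos θ : ℝ) : ℂ) • ancillaPart 0 (A.state U) +
        ((Real.sin ((2 * k + 1) * θ) / Real.sin θ : ℝ) : ℂ) • ancillaPart 1 (A.state U)) =
      ((Real.sin ((2 * k + 1) * θ) / Real.sin θ : ℝ) : ℂ) • ancillaPart 1 (A.state U) := by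
    funext ⟨a, x⟩
    fin_cases a <;> simp [ancillaPart]
  rw [this, normSq_smul_eq, ← outcomeProb_eq_normSq, hA, Complex.norm_real, Real.norm_eq_abs,
    sq_abs]
  field_simp

theorem Circuit.queries_append (c d : Circuit n m) :
    Circuit.queries (c ++ d) = c.queries + d.queries := by
  simp [Circuit.queries]

theorem Circuit.queries_inv (c : Circuit n m) : c.inv.queries = c.queries := by
  simp only [Circuit.queries, Circuit.inv, List.countP_reverse, List.countP_map]
  congr 1
  funext g
  cases g <;> rfl

theorem queries_signal (l : ℕ) : (signal l : Circuit n m).queries = 2 := by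
  rw [signal]
  split_ifs
  · rw [ctrlBlockEncodingInv, Circuit.queries_inv]; rfl
  · rfl

theorem queries_qppCircuit (p : QPPParams) :
    (qppCircuit p : Circuit n m).queries = 2 * p.L + 1 := by
  have h : ∀ k, (qppLayers p.ω p.θ p.φ k : Circuit n m).queries = 2 * k := by
    intro k
    induction k with
    | zero => rfl
    | succ k ih =>
      rw [qppLayers, Circuit.queries_append, Circuit.queries_append, queries_signal, ih]
      simp [Circuit.queries, Gate.isQuery]
      ring
  have h2 := h p.L
  rw [qppCircuit]
  simp only [Circuit.queries, List.countP_cons] at h2 ⊢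
  simp [h2, Gate.isQuery]

theorem queries_amplified (A : Circuit n m) (k : ℕ) :
    (amplified A k).queries = (2 * k + 1) * A.queries := by
  have hg : (grover A).queries = 2 * A.queries := by
    rw [grover, Circuit.queries_append, Circuit.queries_append, Circuit.queries_append,
      Circuit.queries_inv]
    simp [Circuit.queries, Gate.isQuery]
    ring
  induction k with
  | zero => simp [amplified]
  | succ k ih =>
    have : amplified A (k + 1) = amplified A k ++ grover A := by
      simp [amplified, List.replicate_succ']
    rw [this, Circuit.queries_append, ih, hg]
    ring

end Grover

/-! ### Sampling algorithms -/

section Sampling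

variable {χ : Type} {n m : ℕ} (circ : χ → Circuit n m) (U : unitaryGroup (OracleReg n m) ℂ)

/-- Runs an algorithm and continues according to its output. -/
def Algorithm.bind : Algorithm χ → (ℝ → Algorithm χ) → Algorithm χ
  | .output v, f => f v
  | .measure c next, f => .measure c fun b => (next b).bind f

theorem Algorithm.prob_measure (E : ℝ → ℕ → Prop) (c : χ) (next : Fin 2 → Algorithm χ) (q : ℕ) :
    Algorithm.prob circ U E (.measure c next) q =
      (1 - (circ c).outcomeProb U 1) *
          Algorithm.prob circ U E (next 0) (q + (circ c).queries) +
        (circ c).outcomeProb U 1 * Algorithm.prob circ U E (next 1) (q + (circ c).queries) := by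
  rw [Algorithm.prob, Fin.sum_univ_two]
  congr 2
  linarith [outcomeProb_zero_add_one U (circ c)]

theorem outcomeProb_le_one (c : Circuit n m) (b : Fin 2) : c.outcomeProb U b ≤ 1 := by
  have := outcomeProb_zero_add_one U c
  have h0 := outcomeProb_nonneg U c 0
  have h1 := outcomeProb_nonneg U c 1
  fin_cases b
  · change c.outcomeProb U 0 ≤ 1; linarith
  · change c.outcomeProb U 1 ≤ 1; linarith

theorem Algorithm.prob_nonneg (E : ℝ → ℕ → Prop) (t : Algorithm χ) (q : ℕ) :
    0 ≤ Algorithm.prob circ U E t q := by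
  induction t generalizing q with
  | output v => rw [Algorithm.prob]; split_ifs <;> norm_num
  | measure c next ih =>
    rw [Algorithm.prob]
    exact Finset.sum_nonneg fun b _ => mul_nonneg (outcomeProb_nonneg U _ b) (ih b _)

theorem Algorithm.prob_mono {E E' : ℝ → ℕ → Prop} (h : ∀ v q, E v q → E' v q)
    (t : Algorithm χ) (q : ℕ) :
    Algorithm.prob circ U E t q ≤ Algorithm.prob circ U E' t q := by
  induction t generalizing q with
  | output v =>
    rw [Algorithm.prob, Algorithm.prob]
    by_cases h1 : E v q
    · rw [if_pos h1, if_pos (h _ _ h1)]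
    · rw [if_neg h1]; split_ifs <;> norm_num
  | measure c next ih =>
    rw [Algorithm.prob, Algorithm.prob]
    exact Finset.sum_le_sum fun b _ => mul_le_mul_of_nonneg_left (ih b _) (outcomeProb_nonneg U _ b)

theorem Algorithm.mul_le_prob_bind {E E' : ℝ → ℕ → Prop} {f : ℝ → Algorithm χ} {x : ℝ}
    (h : ∀ v q, E v q → x ≤ Algorithm.prob circ U E' (f v) q) (t : Algorithm χ) (q : ℕ) :
    Algorithm.prob circ U E t q * x ≤ Algorithm.prob circ U E' (t.bind f) q := by
  induction t generalizing q with
  | output v =>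
    rw [Algorithm.prob, Algorithm.bind]
    by_cases h1 : E v q
    · rw [if_pos h1, one_mul]; exact h v q h1
    · rw [if_neg h1, zero_mul]; exact Algorithm.prob_nonneg circ U _ _ _
  | measure c next ih =>
    rw [Algorithm.bind, Algorithm.prob, Algorithm.prob, Finset.sum_mul]
    refine Finset.sum_le_sum fun b _ => ?_
    rw [mul_assoc]
    exact mul_le_mul_of_nonneg_left (ih b _) (outcomeProb_nonneg U _ b)

/-- Union bound for a sequential composition of algorithms. -/
theorem Algorithm.le_prob_bind {E E' : ℝ → ℕ → Prop} {f : ℝ → Algorithm χ} {δ₁ δ₂ : ℝ}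
    (t : Algorithm χ) (q : ℕ) (h1 : 1 - δ₁ ≤ Algorithm.prob circ U E t q) (h01 : 0 ≤ δ₁)
    (h02 : 0 ≤ δ₂) (h2 : ∀ v q, E v q → 1 - δ₂ ≤ Algorithm.prob circ U E' (f v) q) :
    1 - (δ₁ + δ₂) ≤ Algorithm.prob circ U E' (t.bind f) q := by
  -- The product `(1 - δ₁)(1 - δ₂)` can be compared only if its second factor is nonnegative; for
  -- `δ₂ > 1` the claim is trivial.
  rcases le_or_gt δ₂ 1 with h | h
  · refine le_trans ?_ (Algorithm.mul_le_prob_bind circ U h2 t q)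
    have := mul_le_mul_of_nonneg_right h1 (sub_nonneg.2 h)
    nlinarith [mul_nonneg h01 h02]
  · exact le_trans (by linarith) (Algorithm.prob_nonneg circ U _ _ _)

/-- Runs the circuit `c` a number of times and outputs `s` plus the number of outcomes `1`. -/
def sampleCount (c : χ) : ℕ → ℝ → Algorithm χ
  | 0, s => .output s
  | R + 1, s => .measure c fun b => sampleCount c R (s + if b = 1 then 1 else 0)

/-- Chebyshev's inequality for the number of outcomes `1`. -/
theorem le_prob_sampleCount (c : χ) {p t μ : ℝ} (hp : (circ c).outcomeProb U 1 = p) (ht : 0 < t)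
    (Q R : ℕ) (s : ℝ) (q : ℕ) (hq : q + R * (circ c).queries = Q) :
    1 - (R * (p * (1 - p)) + (s + R * p - μ) ^ 2) / t ^ 2 ≤
      Algorithm.prob circ U (fun v q => |v - μ| < t ∧ q = Q) (sampleCount c R s) q := by
  induction R generalizing s q with
  | zero =>
    rw [sampleCount, Algorithm.prob]
    have hq' : q = Q := by simpa using hq
    by_cases h : |s - μ| < t
    · rw [if_pos ⟨h, hq'⟩]
      have : 0 ≤ (((0 : ℕ) : ℝ) * (p * (1 - p)) + (s + (0 : ℕ) * p - μ) ^ 2) / t ^ 2 := by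
        simp only [Nat.cast_zero, zero_mul, zero_add]
        positivity
      linarith
    · rw [if_neg (fun h' => h h'.1), sub_nonpos, one_le_div (by positivity)]
      simp only [Nat.cast_zero, zero_mul, zero_add, add_zero]
      rw [← sq_abs (s - μ)]
      exact pow_le_pow_left₀ ht.le (not_lt.1 h) 2
  | succ R ih =>
    have hp0 : 0 ≤ p := hp ▸ outcomeProb_nonneg U _ _
    have hp1 : p ≤ 1 := hp ▸ outcomeProb_le_one U _ _
    rw [sampleCount, Algorithm.prob_measure, hp]
    have hq' : q + (circ c).queries + R * (circ c).queries = Q := by rw [← hq]; ring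
    have h0 := mul_le_mul_of_nonneg_left (ih (s + 0) _ hq') (sub_nonneg.2 hp1)
    have h1 := mul_le_mul_of_nonneg_left (ih (s + 1) _ hq') hp0
    simp only [Fin.isValue, zero_ne_one, if_false, if_true]
    -- Variance plus squared bias is preserved exactly when averaged over one more outcome, so the
    -- induction loses nothing.
    refine le_trans (le_of_eq ?_) (add_le_add h0 h1)
    push_cast
    field_simp
    ring

/-- Runs the circuit `c` until the outcome `1` was seen `r` times, but at most `fuel` times, and
outputs `t` plus the number of runs. -/
def inverseSample (c : χ) : ℕ → ℕ → ℝ → Algorithm χ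
  | 0, _, t => .output t
  | _ + 1, 0, t => .output t
  | fuel + 1, r + 1, t => .measure c fun b =>
      inverseSample c fuel (if b = 1 then r else r + 1) (t + 1)

/-- Chebyshev for a sum of `r` geometric waiting times, each of mean `1/p` and variance `(1-p)/p²`.
Running out of fuel is harmless: by then the count is already at `μ + t` or more, so the right-hand
bound is nonpositive. The output is the number of runs, hence it also determines the number of
queries. -/
theorem le_prob_inverseSample_aux (c : χ) {p t μ : ℝ} (hp : (circ c).outcomeProb U 1 = p)
    (hp0 : 0 < p) (ht : 0 < t) (fuel r : ℕ) (k : ℝ) (hfuel : μ + t ≤ k + fuel) (q : ℕ)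
    (hq : (q : ℝ) = k * (circ c).queries) :
    1 - (r * ((1 - p) / p ^ 2) + (k + r / p - μ) ^ 2) / t ^ 2 ≤
      Algorithm.prob circ U (fun v q => |v - μ| < t ∧ (q : ℝ) = v * (circ c).queries)
        (inverseSample c fuel r k) q := by
  have hp1 : p ≤ 1 := hp ▸ outcomeProb_le_one U _ _
  have hvar : 0 ≤ (1 - p) / p ^ 2 := div_nonneg (sub_nonneg.2 hp1) (by positivity)
  induction fuel generalizing r k q with
  | zero =>
    refine le_trans ?_ (Algorithm.prob_nonneg circ U _ _ _)
    rw [sub_nonpos, one_le_div (by positivity)]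
    have h1 : 0 ≤ (r : ℝ) / p := by positivity
    have h2 : t ≤ k + r / p - μ := by
      simp only [Nat.cast_zero, add_zero] at hfuel; linarith
    have h3 := pow_le_pow_left₀ ht.le h2 2
    have h4 : 0 ≤ (r : ℝ) * ((1 - p) / p ^ 2) := by positivity
    linarith
  | succ fuel ih =>
    cases r with
    | zero =>
      rw [inverseSample, Algorithm.prob]
      by_cases h : |k - μ| < t
      · rw [if_pos ⟨h, hq⟩]
        have : 0 ≤ (((0 : ℕ) : ℝ) * ((1 - p) / p ^ 2) + (k + (0 : ℕ) / p - μ) ^ 2) / t ^ 2 := by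
          simp only [Nat.cast_zero, zero_mul, zero_add]
          positivity
        linarith
      · rw [if_neg (fun h' => h h'.1), sub_nonpos, one_le_div (by positivity)]
        simp only [Nat.cast_zero, zero_mul, zero_add, zero_div, add_zero]
        rw [← sq_abs (k - μ)]
        exact pow_le_pow_left₀ ht.le (not_lt.1 h) 2
    | succ r =>
      rw [inverseSample, Algorithm.prob_measure, hp]
      have hf : μ + t ≤ k + 1 + fuel := by push_cast at hfuel; linarith
      have hq' : ((q + (circ c).queries : ℕ) : ℝ) = (k + 1) * (circ c).queries := by
        push_cast; rw [hq]; ring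
      have h0 := mul_le_mul_of_nonneg_left (ih (r + 1) (k + 1) hf _ hq') (sub_nonneg.2 hp1)
      have h1 := mul_le_mul_of_nonneg_left (ih r (k + 1) hf _ hq') hp0.le
      simp only [Fin.isValue, zero_ne_one, if_false, if_true]
      refine le_trans (le_of_eq ?_) (add_le_add h0 h1)
      push_cast
      field_simp
      ring

/-- The number of runs needed to see `r` outcomes `1` estimates `r / p`, where `p` is the
probability of the outcome `1`, with relative error `τ`. -/
theorem le_prob_inverseSample (c : χ) {p τ δ : ℝ} (hp : (circ c).outcomeProb U 1 = p)
    (hp0 : 0 < p) (hτ : 0 < τ) (hτ1 : τ ≤ 1) {fuel r : ℕ} (hr : 0 < r) (hfuel : 2 * r / p ≤ fuel)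
    (hδ : 1 / (r * τ ^ 2) ≤ δ) :
    1 - δ ≤ Algorithm.prob circ U
      (fun v q => |v - r / p| < τ * (r / p) ∧ (q : ℝ) = v * (circ c).queries)
        (inverseSample c fuel r 0) 0 := by
  have hr' : (0 : ℝ) < r := by exact_mod_cast hr
  have hrp : 0 < (r : ℝ) / p := by positivity
  have h := le_prob_inverseSample_aux circ U c hp hp0 (mul_pos hτ hrp) (μ := r / p) fuel r 0
    (by
      have : (2 : ℝ) * r / p = 2 * (r / p) := by ring
      rw [this] at hfuel
      nlinarith) 0 (by simp)
  refine le_trans ?_ h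
  -- The powers of `p` in variance and squared mean cancel: `r` can be fixed without knowing `p`.
  have e : ((r : ℝ) * ((1 - p) / p ^ 2) + (0 + r / p - r / p) ^ 2) / (τ * (r / p)) ^ 2 =
      (1 - p) * (1 / (r * τ ^ 2)) := by
    field_simp
    ring
  rw [e]
  have : 0 ≤ 1 / ((r : ℝ) * τ ^ 2) := by positivity
  nlinarith

end Sampling

/-! ### Polynomial approximation of negative powers -/

section Approximation

open Polynomial

theorem multichoose_succ_mul (t : ℝ) (k : ℕ) :
    Ring.multichoose t (k + 1) * (k + 1) = Ring.multichoose t k * (t + k) := by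
  have h1 := Ring.factorial_nsmul_multichoose_eq_ascPochhammer t (k + 1)
  have h2 := Ring.factorial_nsmul_multichoose_eq_ascPochhammer t k
  rw [Polynomial.ascPochhammer_smeval_eq_eval, nsmul_eq_mul] at h1 h2
  rw [ascPochhammer_succ_eval, ← h2, Nat.factorial_succ] at h1
  have h3 : ((k.factorial : ℕ) : ℝ) ≠ 0 := by exact_mod_cast k.factorial_ne_zero
  apply mul_left_cancel₀ h3
  push_cast at h1
  linear_combination h1

/-- Consecutive coefficients have ratio `(t + k) / (k + 1) ≤ 1`. Nonnegativity makes partial sums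
lower bounds; the bound by 1 permits comparison with geometric series. -/
theorem multichoose_mem_Icc {t : ℝ} (ht0 : 0 ≤ t) (ht1 : t ≤ 1) (k : ℕ) :
    0 ≤ Ring.multichoose t k ∧ Ring.multichoose t k ≤ 1 := by
  induction k with
  | zero => simp
  | succ k ih =>
    have h := multichoose_succ_mul t k
    have hk : (0 : ℝ) < k + 1 := by positivity
    have h' : Ring.multichoose t (k + 1) = Ring.multichoose t k * (t + k) / (k + 1) := by
      rw [eq_div_iff hk.ne', h]
    rw [h']
    refine ⟨div_nonneg (mul_nonneg ih.1 (by positivity)) hk.le, ?_⟩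
    rw [div_le_one hk]
    have : Ring.multichoose t k * (t + k) ≤ 1 * (1 + k) :=
      mul_le_mul ih.2 (by linarith) (by positivity) zero_le_one
    linarith

theorem hasSum_multichoose_mul_pow (t : ℝ) {y : ℝ} (hy : |y| < 1) :
    HasSum (fun k : ℕ => Ring.multichoose t k * y ^ k) ((1 - y) ^ (-t)) := by
  have h := (Real.one_div_one_sub_rpow_hasFPowerSeriesOnBall_zero t).hasSum (y := y)
    (by simpa [enorm_eq_nnnorm, ← NNReal.coe_lt_coe] using hy)
  have h1 : 0 ≤ 1 - y := by have := (abs_lt.1 hy).2; linarith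
  simp only [FormalMultilinearSeries.ofScalars_apply_eq, ← Ring.multichoose_eq, smul_eq_mul,
    zero_add, one_div, ← Real.rpow_neg h1] at h
  exact h

/-- Binomial expansion of `(e^{iτ} - e^{-iτ})^(2k)`. With `x = cos τ` it is the Chebyshev expansion
of `(1 - x²)^k`, with weights of a symmetric binomial distribution. -/
theorem sin_sq_pow_eq_sum (k : ℕ) (τ : ℝ) :
    (Real.sin τ ^ 2) ^ k = ∑ j ∈ Finset.range (2 * k + 1),
      ((2 * k).choose j : ℝ) / 4 ^ k * ((-1) ^ (k + j) * Real.cos ((2 * j - 2 * k : ℝ) * τ)) := by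
  have h1 : (Complex.exp (τ * Complex.I) + -Complex.exp (-(τ * Complex.I))) =
      2 * Complex.I * Complex.sin τ := by
    rw [Complex.sin]
    have := Complex.I_mul_I
    rw [neg_mul]
    linear_combination (Complex.exp (τ * Complex.I) - Complex.exp (-(τ * Complex.I))) * this
  have h2 := add_pow (Complex.exp (τ * Complex.I)) (-Complex.exp (-(τ * Complex.I))) (2 * k)
  rw [h1] at h2
  have h3 : (2 * Complex.I * Complex.sin τ) ^ (2 * k) =
      (((-1) ^ k * 4 ^ k * (Real.sin τ ^ 2) ^ k : ℝ) : ℂ) := by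
    rw [pow_mul, mul_pow, mul_pow, mul_pow 2 Complex.I, Complex.I_sq, mul_pow]
    rw [show (2 : ℂ) ^ 2 = 4 by norm_num]
    push_cast
    ring
  rw [h3] at h2
  have h4 := congrArg Complex.re h2
  rw [Complex.ofReal_re, Complex.re_sum] at h4
  have h5 : ∀ j ∈ Finset.range (2 * k + 1),
      (Complex.exp (τ * Complex.I) ^ j * (-Complex.exp (-(τ * Complex.I))) ^ (2 * k - j) *
        ((2 * k).choose j : ℂ)).re =
      (-1) ^ j * Real.cos ((2 * j - 2 * k : ℝ) * τ) * (2 * k).choose j := by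
    intro j hj
    have hj' : j ≤ 2 * k := by rw [Finset.mem_range] at hj; omega
    have hs : (-1 : ℂ) ^ (2 * k - j) = (((-1) ^ j : ℝ) : ℂ) := by
      push_cast
      rcases Nat.even_or_odd j with hev | hodd
      · rw [hev.neg_one_pow, Even.neg_one_pow]
        rw [Nat.even_sub hj']; simp [hev]
      · rw [hodd.neg_one_pow, Odd.neg_one_pow]
        have h1 : ¬ Even j := Nat.not_even_iff_odd.2 hodd
        have h2 : ¬ Odd (2 * k) := Nat.not_odd_iff_even.2 (even_two_mul k)
        rw [Nat.odd_sub hj']; simp only [h1, h2]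
    rw [neg_pow, ← Complex.exp_nat_mul, ← Complex.exp_nat_mul, hs]
    have e : Complex.exp (j * (τ * Complex.I)) * ((((-1) ^ j : ℝ) : ℂ) *
        Complex.exp (((2 * k - j : ℕ) : ℂ) * -(τ * Complex.I))) * ((2 * k).choose j : ℂ) =
        (((-1) ^ j * (2 * k).choose j : ℝ) : ℂ) *
          Complex.exp ((((2 * j - 2 * k : ℝ) * τ : ℝ) : ℂ) * Complex.I) := by
      have : Complex.exp ((((2 * j - 2 * k : ℝ) * τ : ℝ) : ℂ) * Complex.I) =
          Complex.exp (j * (τ * Complex.I)) *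
            Complex.exp (((2 * k - j : ℕ) : ℂ) * -(τ * Complex.I)) := by
        rw [← Complex.exp_add]
        congr 1
        push_cast [Nat.cast_sub hj']
        ring
      rw [this]
      push_cast
      ring
    rw [e, Complex.re_ofReal_mul, Complex.exp_ofReal_mul_I_re]
    ring
  rw [Finset.sum_congr rfl h5] at h4
  have h6 : ((-1 : ℝ) ^ k) * (-1) ^ k = 1 := by rw [← mul_pow]; norm_num
  have h7 : (4 : ℝ) ^ k ≠ 0 := by positivity
  have h8 : (Real.sin τ ^ 2) ^ k = (-1) ^ k / 4 ^ k *
      ((-1) ^ k * 4 ^ k * (Real.sin τ ^ 2) ^ k) := by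
    field_simp
    linear_combination (-(Real.sin τ ^ 2) ^ k) * h6
  rw [h8, h4, Finset.mul_sum]
  refine Finset.sum_congr rfl fun j _ => ?_
  rw [pow_add]
  ring

/-- The moment generating function of the centred binomial weights, needed for a Chernoff bound on
the discarded terms. -/
theorem sum_choose_mul_exp (k : ℕ) (l : ℝ) :
    ∑ j ∈ Finset.range (2 * k + 1), ((2 * k).choose j : ℝ) / 4 ^ k * Real.exp (l * (j - k)) =
      (Real.cosh (l / 2) ^ 2) ^ k := by
  have h := add_pow (Real.exp (l / 2)) (Real.exp (-(l / 2))) (2 * k)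
  have h1 : Real.cosh (l / 2) = (Real.exp (l / 2) + Real.exp (-(l / 2))) / 2 := Real.cosh_eq _
  rw [h1, ← pow_mul, div_pow, h, Finset.sum_div, pow_mul]
  refine Finset.sum_congr rfl fun j hj => ?_
  have hj' : j ≤ 2 * k := by rw [Finset.mem_range] at hj; omega
  have : Real.exp (l * (j - k)) =
      Real.exp (l / 2) ^ j * Real.exp (-(l / 2)) ^ (2 * k - j) := by
    rw [← Real.exp_nat_mul, ← Real.exp_nat_mul, ← Real.exp_add]
    congr 1
    push_cast [Nat.cast_sub hj']
    ring
  rw [this]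
  norm_num
  ring

/-- The truncated Chebyshev expansion of `(1 - x ^ 2) ^ k`. -/
def truncatedPow (k D : ℕ) : ℝ[X] :=
  ∑ j ∈ (Finset.range (2 * k + 1)).filter (fun j => j ≤ k + D ∧ k ≤ j + D),
    C (((2 * k).choose j : ℝ) / 4 ^ k * (-1) ^ (k + j)) * Chebyshev.T ℝ (2 * j - 2 * k)

theorem natDegree_truncatedPow_le (k D : ℕ) : (truncatedPow k D).natDegree ≤ 2 * D := by
  refine natDegree_sum_le_of_forall_le _ _ fun j hj => ?_
  refine (natDegree_C_mul_le _ _).trans ?_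
  rw [Chebyshev.natDegree_T]
  have := (Finset.mem_filter.1 hj).2
  omega

theorem abs_truncatedPow_sub_le {k K D : ℕ} (hk : k ≤ K) (hK : 0 < K) {x : ℝ}
    (hx : x ∈ Set.Icc (-1 : ℝ) 1) :
    |(truncatedPow k D).eval x - (1 - x ^ 2) ^ k| ≤ 6 * Real.exp (-(D / Real.sqrt K)) := by
  set τ := Real.arccos x
  have hcos : Real.cos τ = x := Real.cos_arccos hx.1 hx.2
  have hsin : 1 - x ^ 2 = Real.sin τ ^ 2 := by rw [← hcos, Real.sin_sq]
  -- This exponent keeps `l² k ≤ 1`, so each exponential moment is below 3; the two tails together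
  -- give the constant 6.
  set l := 1 / Real.sqrt K with hl
  have hKpos : (0 : ℝ) < K := by exact_mod_cast hK
  have hl0 : 0 < l := by positivity
  have hl2 : l ^ 2 * k ≤ 1 := by
    rw [hl, div_pow, Real.sq_sqrt hKpos.le, one_pow, one_div, inv_mul_le_iff₀ hKpos, mul_one]
    exact_mod_cast hk
  have hT : ∀ j : ℕ, (Chebyshev.T ℝ (2 * j - 2 * k)).eval x =
      Real.cos ((2 * j - 2 * k : ℝ) * τ) := by
    intro j
    rw [← hcos, Chebyshev.T_real_cos]
    push_cast
    rfl
  have heval : (truncatedPow k D).eval x - (1 - x ^ 2) ^ k =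
      -∑ j ∈ (Finset.range (2 * k + 1)).filter (fun j => ¬ (j ≤ k + D ∧ k ≤ j + D)),
        ((2 * k).choose j : ℝ) / 4 ^ k * ((-1) ^ (k + j) * Real.cos ((2 * j - 2 * k : ℝ) * τ)) := by
    rw [hsin, sin_sq_pow_eq_sum, truncatedPow, eval_finsetSum,
      ← Finset.sum_filter_add_sum_filter_not (Finset.range (2 * k + 1))
        (fun j => j ≤ k + D ∧ k ≤ j + D)]
    rw [sub_eq_iff_eq_add, neg_add_eq_sub, eq_sub_iff_add_eq, add_left_inj]
    refine Finset.sum_congr rfl fun j _ => ?_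
    rw [eval_mul, eval_C, hT, mul_assoc]
  have hbad : ∀ j ∈ (Finset.range (2 * k + 1)).filter (fun j => ¬ (j ≤ k + D ∧ k ≤ j + D)),
      |((2 * k).choose j : ℝ) / 4 ^ k * ((-1) ^ (k + j) * Real.cos ((2 * j - 2 * k : ℝ) * τ))| ≤
      Real.exp (-(D / Real.sqrt K)) * (((2 * k).choose j : ℝ) / 4 ^ k * Real.exp (l * (j - k)) +
        ((2 * k).choose j : ℝ) / 4 ^ k * Real.exp (-l * (j - k))) := by
    intro j hj
    have hw : (0 : ℝ) ≤ ((2 * k).choose j : ℝ) / 4 ^ k := by positivity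
    rw [abs_mul, abs_mul, abs_pow, abs_neg, abs_one, one_pow, one_mul, abs_of_nonneg hw, ← mul_add,
      mul_left_comm]
    refine mul_le_mul_of_nonneg_left ?_ hw
    refine (Real.abs_cos_le_one _).trans ?_
    have hD : (D : ℝ) / Real.sqrt K = l * D := by rw [hl]; ring
    rw [hD, mul_add, ← Real.exp_add, ← Real.exp_add]
    have hj' := (Finset.mem_filter.1 hj).2
    by_cases h : j ≤ k + D
    · have h2 : (j : ℝ) + D ≤ k := by
        have : j + D ≤ k := by omega
        exact_mod_cast this
      have h3 : 1 ≤ Real.exp (-(l * D) + -l * (j - k)) := by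
        rw [Real.one_le_exp_iff]
        nlinarith
      linarith [Real.exp_pos (-(l * D) + l * (j - k))]
    · have h2 : (k : ℝ) + D ≤ j := by
        have : k + D ≤ j := by omega
        exact_mod_cast this
      have h3 : 1 ≤ Real.exp (-(l * D) + l * (j - k)) := by
        rw [Real.one_le_exp_iff]
        nlinarith
      linarith [Real.exp_pos (-(l * D) + -l * (j - k))]
  have hcosh : ∀ l' : ℝ, l' ^ 2 = l ^ 2 → (Real.cosh (l' / 2) ^ 2) ^ k ≤ 3 := by
    intro l' hl'
    have h1 := Real.cosh_le_exp_half_sq (l' / 2)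
    have h2 : (Real.cosh (l' / 2) ^ 2) ^ k ≤ (Real.exp ((l' / 2) ^ 2 / 2) ^ 2) ^ k := by
      have := (Real.cosh_pos (l' / 2)).le
      gcongr
    refine h2.trans ?_
    rw [← pow_mul, ← Real.exp_nat_mul]
    refine (Real.exp_le_exp.2 (?_ : _ ≤ (1 : ℝ))).trans Real.exp_one_lt_three.le
    push_cast
    have : (2 * (k : ℝ)) * ((l' / 2) ^ 2 / 2) = l' ^ 2 * k / 4 := by ring
    rw [this, hl']
    linarith
  rw [heval, abs_neg]
  refine (Finset.abs_sum_le_sum_abs _ _).trans ((Finset.sum_le_sum hbad).trans ?_)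
  refine (Finset.sum_le_sum_of_subset_of_nonneg (Finset.filter_subset _ _)
    fun j _ _ => by positivity).trans ?_
  rw [← Finset.mul_sum, Finset.sum_add_distrib, sum_choose_mul_exp, sum_choose_mul_exp]
  have h1 := hcosh l rfl
  have h2 := hcosh (-l) (neg_sq l)
  have h3 := Real.exp_pos (-((D : ℝ) / Real.sqrt K))
  nlinarith

/-- The logarithmic factor of the degree of the approximation. -/
def logFactor (γ τ : ℝ) : ℝ := Real.log (2 + 1 / (γ * τ))

theorem one_le_logFactor {γ τ : ℝ} (hγ : 0 < γ) (hγ1 : γ ≤ 1) (hτ : 0 < τ) (hτ1 : τ ≤ 1) :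
    1 ≤ logFactor γ τ := by
  have h1 : 1 ≤ 1 / (γ * τ) := by
    rw [le_div_iff₀ (by positivity)]; nlinarith
  rw [logFactor, Real.le_log_iff_exp_le (by positivity)]
  linarith [Real.exp_one_lt_three]

/-- The truncated binomial series of `(1 - y) ^ (-s / 2)` in `y = 1 - x ^ 2`. -/
def negPowApprox (s : ℝ) (K D : ℕ) : ℝ[X] :=
  ∑ k ∈ Finset.range (K + 1), C (Ring.multichoose (s / 2) k) * truncatedPow k D

theorem abs_negPowApprox_sub_le {s : ℝ} (hs : 0 ≤ s) (hs1 : s ≤ 1) {K D : ℕ} (hK : 0 < K) {x : ℝ}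
    (hx : x ∈ Set.Icc (-1 : ℝ) 1) :
    |(negPowApprox s K D).eval x -
      ∑ k ∈ Finset.range (K + 1), Ring.multichoose (s / 2) k * (1 - x ^ 2) ^ k| ≤
      (K + 1) * (6 * Real.exp (-(D / Real.sqrt K))) := by
  rw [negPowApprox, eval_finsetSum, ← Finset.sum_sub_distrib]
  refine (Finset.abs_sum_le_sum_abs _ _).trans ?_
  have : ∀ k ∈ Finset.range (K + 1),
      |(C (Ring.multichoose (s / 2) k) * truncatedPow k D).eval x -
        Ring.multichoose (s / 2) k * (1 - x ^ 2) ^ k| ≤ 6 * Real.exp (-(D / Real.sqrt K)) := by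
    intro k hk
    obtain ⟨h0, h1⟩ := multichoose_mem_Icc (t := s / 2) (by linarith) (by linarith) k
    rw [eval_mul, eval_C, ← mul_sub, abs_mul, abs_of_nonneg h0]
    have h2 := abs_truncatedPow_sub_le (D := D)
      (Nat.lt_succ_iff.1 (Finset.mem_range.1 hk)) hK hx
    calc _ ≤ 1 * |(truncatedPow k D).eval x - (1 - x ^ 2) ^ k| :=
          mul_le_mul_of_nonneg_right h1 (abs_nonneg _)
      _ ≤ _ := by rwa [one_mul]
  refine (Finset.sum_le_sum this).trans ?_
  simp

theorem sq_rpow_neg_half {x : ℝ} (hx : 0 < x) (s : ℝ) : (x ^ 2) ^ (-(s / 2)) = x ^ (-s) := by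
  rw [← Real.rpow_natCast, ← Real.rpow_mul hx.le]
  congr 1
  push_cast
  ring

/-- `K` of order `ℓ/γ²` makes `(1 - γ²)^K` negligible and `D` of order `ℓ√K` makes the Chebyshev
tails negligible. With `X' = 1/(γτ)` and `e^ℓ = 2 + X'`, the factors 3 and 7 turn the exponentials
into powers of `2 + X'` that beat `1/γ²`, `1/τ` and `K`. -/
theorem exists_truncation_parameters {γ τ : ℝ} (hγ : 0 < γ) (hγ1 : γ ≤ 1) (hτ : 0 < τ)
    (hτ1 : τ ≤ 1) :
    ∃ K D : ℕ, 0 < K ∧ (K : ℝ) ≤ 4 * logFactor γ τ / γ ^ 2 ∧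
      (D : ℝ) ≤ 15 * logFactor γ τ ^ 2 / γ ∧
      (K + 1) * (6 * Real.exp (-(D / Real.sqrt K))) ≤ τ / 2 ∧
      Real.exp (-(γ ^ 2 * K)) / γ ^ 2 ≤ τ / 2 := by
  obtain ⟨ℓ, hℓdef⟩ : ∃ ℓ, ℓ = logFactor γ τ := ⟨_, rfl⟩
  rw [← hℓdef]
  have hℓ : 1 ≤ ℓ := hℓdef ▸ one_le_logFactor hγ hγ1 hτ hτ1
  obtain ⟨X', hX'⟩ : ∃ X', X' = 1 / (γ * τ) := ⟨_, rfl⟩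
  have hX1 : 1 ≤ X' := by
    rw [hX', le_div_iff₀ (by positivity)]; nlinarith
  have hexpℓ : Real.exp ℓ = 2 + X' := by
    rw [hℓdef, logFactor, Real.exp_log (by positivity), hX']
  have hℓX : ℓ ≤ 2 + X' := by
    rw [← hexpℓ]; linarith [Real.add_one_le_exp ℓ]
  have hinv : 1 / (γ ^ 2 * τ) ≤ X' ^ 2 := by
    rw [hX', div_pow, one_pow]
    apply one_div_le_one_div_of_le (by positivity)
    rw [mul_pow]
    have : τ ^ 2 ≤ τ := by nlinarith
    exact mul_le_mul_of_nonneg_left this (by positivity)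
  have hγ2 : 0 < γ ^ 2 := by positivity
  have hone : 1 ≤ ℓ / γ ^ 2 := by
    rw [le_div_iff₀ hγ2]; nlinarith
  obtain ⟨K, hK⟩ : ∃ K : ℕ, K = ⌈3 * ℓ / γ ^ 2⌉₊ := ⟨_, rfl⟩
  have hKge : 3 * ℓ / γ ^ 2 ≤ K := hK ▸ Nat.le_ceil _
  have hKle : (K : ℝ) ≤ 4 * ℓ / γ ^ 2 := by
    have h1 : (K : ℝ) < 3 * ℓ / γ ^ 2 + 1 := hK ▸ Nat.ceil_lt_add_one (by positivity)
    have h2 : 4 * ℓ / γ ^ 2 = 3 * ℓ / γ ^ 2 + ℓ / γ ^ 2 := by ring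
    linarith
  have hKpos' : (0 : ℝ) < K := lt_of_lt_of_le (by positivity) hKge
  have hKpos : 0 < K := by exact_mod_cast hKpos'
  have hsqrt : Real.sqrt K ≤ 2 * ℓ / γ := by
    apply Real.sqrt_le_iff.2 ⟨by positivity, hKle.trans ?_⟩
    rw [div_pow]
    apply div_le_div_of_nonneg_right _ hγ2.le
    nlinarith
  have hsqrtpos : 0 < Real.sqrt K := Real.sqrt_pos.2 hKpos'
  obtain ⟨D, hD⟩ : ∃ D : ℕ, D = ⌈7 * ℓ * Real.sqrt K⌉₊ := ⟨_, rfl⟩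
  have hDge : 7 * ℓ * Real.sqrt K ≤ D := hD ▸ Nat.le_ceil _
  have hDle : (D : ℝ) ≤ 15 * ℓ ^ 2 / γ := by
    have h1 : (D : ℝ) < 7 * ℓ * Real.sqrt K + 1 := hD ▸ Nat.ceil_lt_add_one (by positivity)
    have h2 : 7 * ℓ * Real.sqrt K ≤ 7 * ℓ * (2 * ℓ / γ) :=
      mul_le_mul_of_nonneg_left hsqrt (by positivity)
    have h3 : 1 ≤ ℓ ^ 2 / γ := by rw [le_div_iff₀ hγ]; nlinarith
    have h4 : 15 * ℓ ^ 2 / γ = 7 * ℓ * (2 * ℓ / γ) + ℓ ^ 2 / γ := by ring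
    linarith
  have herr1 : (K + 1) * (6 * Real.exp (-(D / Real.sqrt K))) ≤ τ / 2 := by
    have h1 : 7 * ℓ ≤ D / Real.sqrt K := by rwa [le_div_iff₀ hsqrtpos]
    have h2 : Real.exp (-(D / Real.sqrt K)) ≤ ((2 + X') ^ 7)⁻¹ := by
      rw [← hexpℓ, ← Real.exp_nat_mul, ← Real.exp_neg]
      apply Real.exp_le_exp.2
      push_cast
      linarith
    have h3 : (K : ℝ) + 1 ≤ 5 * ℓ / γ ^ 2 := by
      have : 5 * ℓ / γ ^ 2 = 4 * ℓ / γ ^ 2 + ℓ / γ ^ 2 := by ring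
      linarith
    have h4 : ((K : ℝ) + 1) / τ ≤ 5 * (2 + X') ^ 3 := by
      calc ((K : ℝ) + 1) / τ ≤ (5 * ℓ / γ ^ 2) / τ := div_le_div_of_nonneg_right h3 hτ.le
        _ = 5 * ℓ * (1 / (γ ^ 2 * τ)) := by field_simp
        _ ≤ 5 * (2 + X') * X' ^ 2 := by gcongr
        _ ≤ _ := by nlinarith
    have h5 : 60 * (2 + X') ^ 3 ≤ (2 + X') ^ 7 := by
      have h6 : (3 : ℝ) ^ 4 ≤ (2 + X') ^ 4 := pow_le_pow_left₀ (by norm_num) (by linarith) 4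
      have h7 : 0 < (2 + X') ^ 3 := by positivity
      calc 60 * (2 + X') ^ 3 ≤ (2 + X') ^ 4 * (2 + X') ^ 3 :=
            mul_le_mul_of_nonneg_right (by linarith) h7.le
        _ = _ := by ring
    have h6 : ((K : ℝ) + 1) ≤ 5 * (2 + X') ^ 3 * τ := by rwa [div_le_iff₀ hτ] at h4
    have h7 : 0 < (2 + X') ^ 7 := by positivity
    calc (K + 1) * (6 * Real.exp (-(D / Real.sqrt K)))
        ≤ (5 * (2 + X') ^ 3 * τ) * (6 * ((2 + X') ^ 7)⁻¹) := by gcongr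
      _ = (60 * (2 + X') ^ 3) / (2 + X') ^ 7 * (τ / 2) := by field_simp; ring
      _ ≤ 1 * (τ / 2) := by
          apply mul_le_mul_of_nonneg_right _ (by positivity)
          rwa [div_le_one h7]
      _ = τ / 2 := one_mul _
  have herr2 : Real.exp (-(γ ^ 2 * K)) / γ ^ 2 ≤ τ / 2 := by
    have h1 : 3 * ℓ ≤ γ ^ 2 * K := by
      rw [div_le_iff₀ hγ2] at hKge; linarith
    have h2 : Real.exp (-(γ ^ 2 * K)) ≤ ((2 + X') ^ 3)⁻¹ := by
      rw [← hexpℓ, ← Real.exp_nat_mul, ← Real.exp_neg]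
      apply Real.exp_le_exp.2
      push_cast
      linarith
    have h3 : 2 * X' ^ 2 ≤ (2 + X') ^ 3 := by nlinarith [sq_nonneg X']
    have h4 : 1 / γ ^ 2 ≤ X' ^ 2 * τ := by
      have := (div_le_iff₀ (by positivity : 0 < γ ^ 2 * τ)).1 hinv
      rw [div_le_iff₀ hγ2]; linarith
    have h7 : 0 < (2 + X') ^ 3 := by positivity
    calc Real.exp (-(γ ^ 2 * K)) / γ ^ 2 = Real.exp (-(γ ^ 2 * K)) * (1 / γ ^ 2) := by ring
      _ ≤ ((2 + X') ^ 3)⁻¹ * (X' ^ 2 * τ) := by gcongr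
      _ = (2 * X' ^ 2) / (2 + X') ^ 3 * (τ / 2) := by field_simp
      _ ≤ 1 * (τ / 2) := by
          apply mul_le_mul_of_nonneg_right _ (by positivity)
          rwa [div_le_one h7]
      _ = τ / 2 := one_mul _
  exact ⟨K, D, hKpos, hKle, hDle, herr1, herr2⟩

/-- The partial sum of the binomial series of `|x| ^ (-s)` in `1 - x ^ 2`. -/
def negPowPartial (s : ℝ) (K : ℕ) (x : ℝ) : ℝ :=
  ∑ k ∈ Finset.range (K + 1), Ring.multichoose (s / 2) k * (1 - x ^ 2) ^ k

theorem hasSum_negPow {s x : ℝ} (hx : x ∈ Set.Icc (-1 : ℝ) 1) (hx0 : x ≠ 0) :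
    HasSum (fun k : ℕ => Ring.multichoose (s / 2) k * (1 - x ^ 2) ^ k) (|x| ^ (-s)) := by
  have hxpos : 0 < |x| := abs_pos.2 hx0
  have h1 : 0 ≤ 1 - x ^ 2 := by nlinarith [hx.1, hx.2]
  have hy : |1 - x ^ 2| < 1 := by
    rw [abs_of_nonneg h1]
    have := pow_pos hxpos 2
    rw [sq_abs] at this; linarith
  have hsum := hasSum_multichoose_mul_pow (s / 2) hy
  rwa [sub_sub_cancel, ← sq_abs x, sq_rpow_neg_half hxpos, sq_abs] at hsum

theorem negPowPartial_nonneg {s : ℝ} (hs : 0 ≤ s) (hs1 : s ≤ 1) (K : ℕ) {x : ℝ}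
    (hx : x ∈ Set.Icc (-1 : ℝ) 1) : 0 ≤ negPowPartial s K x :=
  Finset.sum_nonneg fun k _ => mul_nonneg
    (multichoose_mem_Icc (t := s / 2) (by linarith) (by linarith) k).1
    (pow_nonneg (by nlinarith [hx.1, hx.2]) _)

theorem negPowPartial_le {s : ℝ} (hs : 0 ≤ s) (hs1 : s ≤ 1) (K : ℕ) {x : ℝ}
    (hx : x ∈ Set.Icc (-1 : ℝ) 1) (hx0 : x ≠ 0) : negPowPartial s K x ≤ |x| ^ (-s) :=
  sum_le_hasSum _ (fun k _ => mul_nonneg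
    (multichoose_mem_Icc (t := s / 2) (by linarith) (by linarith) k).1
    (pow_nonneg (by nlinarith [hx.1, hx.2]) _)) (hasSum_negPow hx hx0)

/-- The coefficients are at most 1, so the tail is dominated by a geometric series with ratio `1 -
x² ≤ 1 - γ²`. -/
theorem sub_negPowPartial_le {s γ : ℝ} (hs : 0 ≤ s) (hs1 : s ≤ 1) (hγ : 0 < γ) (K : ℕ) {x : ℝ}
    (hx : x ∈ Set.Icc γ 1) :
    x ^ (-s) - negPowPartial s K x ≤ Real.exp (-(γ ^ 2 * K)) / γ ^ 2 := by
  have hx0 : 0 < x := hγ.trans_le hx.1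
  have hγ2 : 0 < γ ^ 2 := by positivity
  have hy0 : 0 ≤ 1 - x ^ 2 := by nlinarith [hx.2]
  have hy1 : 1 - x ^ 2 ≤ 1 - γ ^ 2 := by nlinarith [hx.1]
  have hy2 : 1 - x ^ 2 < 1 := by nlinarith
  have hsum := hasSum_negPow (s := s) (x := x) ⟨by linarith, hx.2⟩ hx0.ne'
  rw [abs_of_pos hx0] at hsum
  have htail := (hasSum_nat_add_iff' (K + 1)).2 hsum
  have hgeom := (hasSum_geometric_of_lt_one hy0 hy2).mul_left ((1 - x ^ 2) ^ (K + 1))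
  have htail1 : x ^ (-s) - negPowPartial s K x ≤
      (1 - x ^ 2) ^ (K + 1) * (1 - (1 - x ^ 2))⁻¹ := by
    refine hasSum_le (fun k => ?_) htail hgeom
    rw [← pow_add, add_comm (K + 1) k]
    exact mul_le_of_le_one_left (pow_nonneg hy0 _)
      (multichoose_mem_Icc (t := s / 2) (by linarith) (by linarith) _).2
  refine htail1.trans ?_
  rw [sub_sub_cancel, div_eq_mul_inv]
  have h1 : (1 - x ^ 2) ^ (K + 1) ≤ Real.exp (-(γ ^ 2 * K)) := by
    have h2 : 1 - x ^ 2 ≤ Real.exp (-γ ^ 2) := by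
      have := Real.add_one_le_exp (-γ ^ 2); linarith
    calc (1 - x ^ 2) ^ (K + 1) ≤ (1 - x ^ 2) ^ K :=
          pow_le_pow_of_le_one hy0 hy2.le (Nat.le_succ K)
      _ ≤ Real.exp (-γ ^ 2) ^ K := pow_le_pow_left₀ hy0 h2 K
      _ = Real.exp (-(γ ^ 2 * K)) := by rw [← Real.exp_nat_mul]; congr 1; ring
  have h3 : (x ^ 2)⁻¹ ≤ (γ ^ 2)⁻¹ := by
    apply inv_anti₀ hγ2; nlinarith [hx.1]
  exact mul_le_mul h1 h3 (by positivity) (Real.exp_pos _).le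

/-- Near 0 the power itself is unbounded, but its partial sum is at most the sum of the first `K +
1` coefficients. Inserting weights `(1 - u)^k ≥ 1/2` costs a factor 2 and compares that sum with the
full series at `1 - u`, which is `u^(-s/2)`; `u = γ²/(8ℓ)` is small enough for `K u ≤ 1/2`. -/
theorem negPowPartial_le_mul_rpow {s γ ℓ : ℝ} (hs : 0 ≤ s) (hs1 : s ≤ 1) (hγ : 0 < γ)
    (hγ1 : γ ≤ 1) (hℓ : 1 ≤ ℓ) {K : ℕ} (hKle : (K : ℝ) ≤ 4 * ℓ / γ ^ 2) {x : ℝ}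
    (hx : x ∈ Set.Icc (-1 : ℝ) 1) : negPowPartial s K x ≤ 6 * ℓ * γ ^ (-s) := by
  have ha := fun k => multichoose_mem_Icc (t := s / 2) (by linarith) (by linarith) k
  set u := γ ^ 2 / (8 * ℓ) with hu
  have hu0 : 0 < u := by positivity
  have hu1 : u ≤ 1 / 8 := by
    rw [hu, div_le_iff₀ (by positivity)]; nlinarith
  have hpow : 1 / 2 ≤ (1 - u) ^ K := by
    have h2 := one_add_mul_le_pow (a := -u) (by linarith) K
    have h3 : K * u ≤ 1 / 2 := by
      calc K * u ≤ (4 * ℓ / γ ^ 2) * u := mul_le_mul_of_nonneg_right hKle hu0.le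
        _ = 1 / 2 := by rw [hu]; field_simp; norm_num
    rw [← sub_eq_add_neg] at h2
    linarith
  have hsum := hasSum_multichoose_mul_pow (s / 2) (y := 1 - u)
    (by rw [abs_lt]; constructor <;> linarith)
  rw [sub_sub_cancel] at hsum
  have hpartial : ∑ k ∈ Finset.range (K + 1), Ring.multichoose (s / 2) k * (1 - u) ^ k ≤
      u ^ (-(s / 2)) :=
    sum_le_hasSum _ (fun k _ => mul_nonneg (ha k).1 (pow_nonneg (by linarith) _)) hsum
  have hcoef : negPowPartial s K x ≤
      2 * ∑ k ∈ Finset.range (K + 1), Ring.multichoose (s / 2) k * (1 - u) ^ k := by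
    rw [negPowPartial, Finset.mul_sum]
    refine Finset.sum_le_sum fun k hk => ?_
    have hkK : k ≤ K := Nat.lt_succ_iff.1 (Finset.mem_range.1 hk)
    have h2 : (1 - x ^ 2) ^ k ≤ 1 :=
      pow_le_one₀ (by nlinarith [hx.1, hx.2]) (by nlinarith)
    have h3 : (1 - u) ^ K ≤ (1 - u) ^ k :=
      pow_le_pow_of_le_one (by linarith) (by linarith) hkK
    rw [mul_left_comm]
    exact mul_le_mul_of_nonneg_left (by linarith) (ha k).1
  have hupow : u ^ (-(s / 2)) ≤ 3 * ℓ * γ ^ (-s) := by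
    have e : u = (8 * ℓ)⁻¹ * γ ^ 2 := by rw [hu]; ring
    rw [e, Real.mul_rpow (by positivity) (by positivity), sq_rpow_neg_half hγ]
    apply mul_le_mul_of_nonneg_right _ (Real.rpow_nonneg hγ.le _)
    rw [Real.inv_rpow (by positivity), Real.rpow_neg (by positivity), inv_inv]
    calc (8 * ℓ) ^ (s / 2) ≤ (8 * ℓ) ^ (1 / 2 : ℝ) :=
          Real.rpow_le_rpow_of_exponent_le (by linarith) (by linarith)
      _ = Real.sqrt (8 * ℓ) := (Real.sqrt_eq_rpow _).symm
      _ ≤ 3 * ℓ := by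
          apply Real.sqrt_le_iff.2 ⟨by positivity, ?_⟩
          nlinarith
  linarith

/-- The two global bounds serve the two ranges of `α`: the first normalizes the approximation for `α
< 1`; the second, free of `γ`, serves `α > 1`, where a positive power of `x` is multiplied on. -/
theorem exists_negPow_approx {s γ τ : ℝ} (hs : 0 ≤ s) (hs1 : s ≤ 1) (hγ : 0 < γ) (hγ1 : γ ≤ 1)
    (hτ : 0 < τ) (hτ1 : τ ≤ 1) :
    ∃ r : ℝ[X], (r.natDegree : ℝ) ≤ 30 * logFactor γ τ ^ 2 / γ ∧
      (∀ x ∈ Set.Icc γ 1, |r.eval x - x ^ (-s)| ≤ τ) ∧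
      (∀ x ∈ Set.Icc (-1 : ℝ) 1, |r.eval x| ≤ 10 * logFactor γ τ * γ ^ (-s)) ∧
      ∀ x ∈ Set.Icc (-1 : ℝ) 1, |x| * |r.eval x| ≤ 2 := by
  obtain ⟨K, D, hKpos, hKle, hDle, herr1, herr2⟩ := exists_truncation_parameters hγ hγ1 hτ hτ1
  have hℓ : 1 ≤ logFactor γ τ := one_le_logFactor hγ hγ1 hτ hτ1
  have hclose : ∀ x ∈ Set.Icc (-1 : ℝ) 1,
      |(negPowApprox s K D).eval x - negPowPartial s K x| ≤ τ / 2 :=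
    fun x hx => (abs_negPowApprox_sub_le hs hs1 hKpos hx).trans herr1
  refine ⟨negPowApprox s K D, ?_, fun x hx => ?_, fun x hx => ?_, fun x hx => ?_⟩
  · have h1 : (negPowApprox s K D).natDegree ≤ 2 * D := by
      refine natDegree_sum_le_of_forall_le _ _ fun k _ => ?_
      exact (natDegree_C_mul_le _ _).trans (natDegree_truncatedPow_le k D)
    have h2 : ((negPowApprox s K D).natDegree : ℝ) ≤ 2 * D := by exact_mod_cast h1
    have h3 : 30 * logFactor γ τ ^ 2 / γ = 2 * (15 * logFactor γ τ ^ 2 / γ) := by ring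
    linarith
  · have hx0 : 0 < x := hγ.trans_le hx.1
    have hx' : x ∈ Set.Icc (-1 : ℝ) 1 := ⟨by linarith, hx.2⟩
    have h1 := hclose x hx'
    have h2 := sub_negPowPartial_le hs hs1 hγ K hx
    have h3 := negPowPartial_le hs hs1 K hx' hx0.ne'
    rw [abs_of_pos hx0] at h3
    rw [abs_le] at h1 ⊢
    constructor <;> linarith
  · have h1 := hclose x hx
    have h0 := negPowPartial_nonneg hs hs1 K hx
    have h2 := negPowPartial_le_mul_rpow hs hs1 hγ hγ1 hℓ hKle hx
    have hγs : 1 ≤ γ ^ (-s) := Real.one_le_rpow_of_pos_of_le_one_of_nonpos hγ hγ1 (by linarith)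
    have hprod : 1 ≤ logFactor γ τ * γ ^ (-s) := one_le_mul_of_one_le_of_one_le hℓ hγs
    rw [abs_le] at h1 ⊢
    constructor <;> linarith
  · rcases eq_or_ne x 0 with rfl | hx0
    · simp
    have hxpos : 0 < |x| := abs_pos.2 hx0
    have hx1 : |x| ≤ 1 := abs_le.2 hx
    have hpartial := negPowPartial_le hs hs1 K hx hx0
    have h1 := hclose x hx
    have h0 := negPowPartial_nonneg hs hs1 K hx
    have h2 : |(negPowApprox s K D).eval x| ≤ |x| ^ (-s) + 1 / 2 := by
      rw [abs_le] at h1 ⊢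
      have := Real.rpow_nonneg hxpos.le (-s)
      constructor <;> linarith
    have h3 : |x| * |x| ^ (-s) ≤ 1 := by
      nth_rewrite 1 [← Real.rpow_one |x|]
      rw [← Real.rpow_add hxpos]
      exact Real.rpow_le_one hxpos.le hx1 (by linarith)
    calc |x| * |(negPowApprox s K D).eval x| ≤ |x| * (|x| ^ (-s) + 1 / 2) :=
          mul_le_mul_of_nonneg_left h2 hxpos.le
      _ ≤ 2 := by rw [mul_add]; linarith

end Approximation

/-! ### Spectral sums -/

section Spectral

open Polynomial

variable {X : Type*} [Fintype X] [DecidableEq X] {ρ : Matrix X X ℂ}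

theorem trace_cfc_re (hρ : ρ.IsHermitian) (f : ℝ → ℝ) :
    (cfc f ρ).trace.re = ∑ i, f (hρ.eigenvalues i) := by
  rw [hρ.cfc_eq, IsHermitian.cfc, Unitary.conjStarAlgAut_apply, trace_mul_cycle,
    Unitary.coe_star_mul_self, one_mul, trace_diagonal, Complex.re_sum]
  rfl

theorem trace_aeval_mul_mul_re (hρ : ρ.IsHermitian) (Q : ℝ[X]) :
    (aeval ρ (Q.map (algebraMap ℝ ℂ)) * ρ *
      (aeval ρ (Q.map (algebraMap ℝ ℂ)))ᴴ).trace.re =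
      ∑ i, hρ.eigenvalues i * Q.eval (hρ.eigenvalues i) ^ 2 := by
  have hsa : IsSelfAdjoint ρ := hρ
  have h1 : aeval ρ (Q.map (algebraMap ℝ ℂ)) = aeval ρ Q := aeval_map_algebraMap ℂ ρ Q
  have h2 : (aeval ρ Q)ᴴ = aeval ρ Q := by
    rw [← cfc_polynomial Q ρ hsa]
    exact cfc_predicate (R := ℝ) (p := IsSelfAdjoint) _ ρ
  have h3 : aeval ρ Q * ρ * aeval ρ Q = aeval ρ (Q * Polynomial.X * Q) := by simp
  rw [h1, h2, h3, ← cfc_polynomial (Q * Polynomial.X * Q) ρ hsa, trace_cfc_re hρ]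
  refine Finset.sum_congr rfl fun i _ => ?_
  simp only [eval_mul, eval_X]
  ring

theorem IsDensityMatrix.sum_eigenvalues (h : IsDensityMatrix ρ) :
    ∑ i, h.1.1.eigenvalues i = 1 := by
  have h1 := h.1.1.trace_eq_sum_eigenvalues
  have h2 := congrArg Complex.re (h.2.symm.trans h1)
  simp only [Complex.one_re, Complex.re_sum] at h2
  exact h2.symm

theorem IsDensityMatrix.eigenvalues_le_one (h : IsDensityMatrix ρ) (i : X) :
    h.1.1.eigenvalues i ≤ 1 := by
  rw [← h.sum_eigenvalues]
  exact Finset.single_le_sum (fun j _ => h.1.eigenvalues_nonneg j) (Finset.mem_univ i)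

theorem IsDensityMatrix.eigenvalues_eq_zero_or {γ : ℝ} (h : IsDensityMatrix ρ)
    (hspec : ∀ p ∈ spectrum ℝ ρ, p ≠ 0 → γ ≤ p) (i : X) :
    h.1.1.eigenvalues i = 0 ∨ h.1.1.eigenvalues i ∈ Set.Icc γ 1 := by
  by_cases h0 : h.1.1.eigenvalues i = 0
  · exact Or.inl h0
  · exact Or.inr ⟨hspec _ (h.1.1.eigenvalues_mem_spectrum_real i) h0, h.eigenvalues_le_one i⟩

theorem IsDensityMatrix.gamma_le_one {γ : ℝ} (h : IsDensityMatrix ρ)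
    (hspec : ∀ p ∈ spectrum ℝ ρ, p ≠ 0 → γ ≤ p) : γ ≤ 1 := by
  by_contra hγ
  have : ∀ i, h.1.1.eigenvalues i = 0 := fun i =>
    (h.eigenvalues_eq_zero_or hspec i).resolve_right fun h' => hγ (h'.1.trans h'.2)
  have h1 := h.sum_eigenvalues
  simp [this] at h1

theorem IsDensityMatrix.tracePow_eq (h : IsDensityMatrix ρ) (α : ℝ) :
    tracePow α ρ = ∑ i, h.1.1.eigenvalues i ^ α := trace_cfc_re h.1.1 _

/-- Comparison of a spectral sum with `tr(ρ ^ α)`. -/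
theorem IsDensityMatrix.sum_le_sum {γ : ℝ} (h : IsDensityMatrix ρ)
    (hspec : ∀ p ∈ spectrum ℝ ρ, p ≠ 0 → γ ≤ p) (hγ : 0 < γ) {f g : ℝ → ℝ}
    (hfg : ∀ x ∈ Set.Icc γ 1, f x ≤ g x) :
    ∑ i, h.1.1.eigenvalues i * f (h.1.1.eigenvalues i) ≤
      ∑ i, h.1.1.eigenvalues i * g (h.1.1.eigenvalues i) := by
  refine Finset.sum_le_sum fun i _ => ?_
  rcases h.eigenvalues_eq_zero_or hspec i with h0 | h1
  · rw [h0, zero_mul, zero_mul]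
  · exact mul_le_mul_of_nonneg_left (hfg _ h1) (hγ.le.trans h1.1)

/-- Reads `tr(ρ^α)` as a mean of `x^(α-1)` under the eigenvalue distribution, so only values on `[γ,
1]` matter. -/
theorem IsDensityMatrix.tracePow_eq_sum_mul {γ : ℝ} (h : IsDensityMatrix ρ)
    (hspec : ∀ p ∈ spectrum ℝ ρ, p ≠ 0 → γ ≤ p)
    {α : ℝ} (hα : α ≠ 0) (hγ : 0 < γ) (c : ℝ) :
    c * tracePow α ρ = ∑ i, h.1.1.eigenvalues i * (c * h.1.1.eigenvalues i ^ (α - 1)) := by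
  rw [h.tracePow_eq, Finset.mul_sum]
  refine Finset.sum_congr rfl fun i _ => ?_
  rcases h.eigenvalues_eq_zero_or hspec i with h0 | h1
  · rw [h0, Real.zero_rpow hα]; simp
  · have hpos := hγ.trans_le h1.1
    rw [mul_left_comm]
    congr 1
    nth_rewrite 2 [← Real.rpow_one (h.1.1.eigenvalues i)]
    rw [← Real.rpow_add hpos]
    congr 1; ring

theorem IsDensityMatrix.tracePow_bounds_of_lt_one {γ : ℝ} (h : IsDensityMatrix ρ)
    (hspec : ∀ p ∈ spectrum ℝ ρ, p ≠ 0 → γ ≤ p)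
    {α : ℝ} (hα : 0 < α) (hα1 : α < 1)
    (hγ : 0 < γ) : 1 ≤ tracePow α ρ ∧ tracePow α ρ ≤ γ ^ (α - 1) := by
  have h0 := h.tracePow_eq_sum_mul hspec hα.ne' hγ 1
  simp only [one_mul] at h0
  rw [h0]
  constructor
  · have := h.sum_le_sum hspec hγ (f := fun _ => 1) (g := fun x => x ^ (α - 1))
      (fun x hx => Real.one_le_rpow_of_pos_of_le_one_of_nonpos (hγ.trans_le hx.1) hx.2
        (by linarith))
    simpa [h.sum_eigenvalues] using this
  · have := h.sum_le_sum hspec hγ (f := fun x => x ^ (α - 1)) (g := fun _ => γ ^ (α - 1))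
      (fun x hx => Real.rpow_le_rpow_of_nonpos hγ hx.1 (by linarith))
    rw [← Finset.sum_mul, h.sum_eigenvalues, one_mul] at this
    exact this

theorem IsDensityMatrix.tracePow_bounds_of_one_lt {γ : ℝ} (h : IsDensityMatrix ρ)
    (hspec : ∀ p ∈ spectrum ℝ ρ, p ≠ 0 → γ ≤ p)
    {α : ℝ} (hα1 : 1 < α)
    (hγ : 0 < γ) : γ ^ (α - 1) ≤ tracePow α ρ ∧ tracePow α ρ ≤ 1 := by
  have hα : α ≠ 0 := by linarith
  have h0 := h.tracePow_eq_sum_mul hspec hα hγ 1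
  simp only [one_mul] at h0
  rw [h0]
  constructor
  · have := h.sum_le_sum hspec hγ (f := fun _ => γ ^ (α - 1)) (g := fun x => x ^ (α - 1))
      (fun x hx => Real.rpow_le_rpow hγ.le hx.1 (by linarith))
    rw [← Finset.sum_mul, h.sum_eigenvalues, one_mul] at this
    exact this
  · have := h.sum_le_sum hspec hγ (f := fun x => x ^ (α - 1)) (g := fun _ => 1)
      (fun x hx => Real.rpow_le_one (hγ.le.trans hx.1) hx.2 (by linarith))
    simpa [h.sum_eigenvalues] using this

end Spectral

/-! ### Approximating polynomials and the outcome probability they produce -/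

/-- The bounded polynomial `Q` approximates `√(κ x ^ (α - 1))` on `[γ, 1]` with relative error
`τ`. -/
structure IsPowerApprox (α γ τ κ : ℝ) (Q : Polynomial ℝ) : Prop where
  bound : ∀ x ∈ Set.Icc (-1 : ℝ) 1, |Q.eval x| ≤ 1 / 2
  lower : ∀ x ∈ Set.Icc γ 1, (1 - τ) * (κ * x ^ (α - 1)) ≤ Q.eval x ^ 2
  upper : ∀ x ∈ Set.Icc γ 1, Q.eval x ^ 2 ≤ (1 + τ) * (κ * x ^ (α - 1))

/-- The spectral sum `tr(ρ Q(ρ) ^ 2)`. -/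
def spectralProb {X : Type*} [Fintype X] [DecidableEq X] (Q : Polynomial ℝ)
    (ρ : Matrix X X ℂ) : ℝ :=
  (Polynomial.aeval ρ (Q.map (algebraMap ℝ ℂ)) * ρ *
    (Polynomial.aeval ρ (Q.map (algebraMap ℝ ℂ)))ᴴ).trace.re

theorem IsPowerApprox.spectralProb_bounds {X : Type*} [Fintype X] [DecidableEq X]
    {ρ : Matrix X X ℂ} {α γ τ κ : ℝ} {Q : Polynomial ℝ} (hQ : IsPowerApprox α γ τ κ Q)
    (h : IsDensityMatrix ρ) (hspec : ∀ p ∈ spectrum ℝ ρ, p ≠ 0 → γ ≤ p) (hα : α ≠ 0)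
    (hγ : 0 < γ) :
    (1 - τ) * (κ * tracePow α ρ) ≤ spectralProb Q ρ ∧
      spectralProb Q ρ ≤ (1 + τ) * (κ * tracePow α ρ) ∧ spectralProb Q ρ ≤ 1 / 4 := by
  rw [spectralProb, trace_aeval_mul_mul_re h.1.1]
  refine ⟨?_, ?_, ?_⟩
  · rw [← mul_assoc, h.tracePow_eq_sum_mul hspec hα hγ]
    exact h.sum_le_sum hspec hγ (f := fun x => (1 - τ) * κ * x ^ (α - 1))
      (g := fun x => Q.eval x ^ 2) (fun x hx => by rw [mul_assoc]; exact hQ.lower x hx)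
  · rw [← mul_assoc, h.tracePow_eq_sum_mul hspec hα hγ]
    exact h.sum_le_sum hspec hγ (g := fun x => (1 + τ) * κ * x ^ (α - 1))
      (f := fun x => Q.eval x ^ 2) (fun x hx => by rw [mul_assoc]; exact hQ.upper x hx)
  · have := h.sum_le_sum hspec hγ (f := fun x => Q.eval x ^ 2) (g := fun _ => 1 / 4)
      (fun x hx => by
        have := abs_le.1 (hQ.bound x ⟨by linarith [hx.1], hx.2⟩)
        nlinarith)
    rw [← Finset.sum_mul, h.sum_eigenvalues, one_mul] at this
    exact this

/-! ### Amplitude estimation by successive refinement -/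

/-- Mean value bounds for the sine: its derivative lies between `4/5` and 1 on the relevant
interval, since `cos (arcsin (3/5)) = 4/5`. -/
theorem arcsin_sub_bounds {x y : ℝ} (hx : 0 ≤ x) (hxy : x ≤ y) (hy : y ≤ 3 / 5) :
    y - x ≤ Real.arcsin y - Real.arcsin x ∧
      Real.arcsin y - Real.arcsin x ≤ 5 / 4 * (y - x) := by
  have hsx : Real.sin (Real.arcsin x) = x := Real.sin_arcsin (by linarith) (by linarith)
  have hsy : Real.sin (Real.arcsin y) = y := Real.sin_arcsin (by linarith) (by linarith)
  have hmono : Real.arcsin x ≤ Real.arcsin y := Real.monotone_arcsin hxy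
  have hx0 : 0 ≤ Real.arcsin x := Real.arcsin_nonneg.2 hx
  have hy1 : Real.arcsin y ≤ Real.arcsin (3 / 5) := Real.monotone_arcsin hy
  have htop : Real.arcsin (3 / 5) ≤ Real.pi / 2 := Real.arcsin_le_pi_div_two _
  constructor
  · have := (convex_univ (𝕜 := ℝ) (E := ℝ)).image_sub_le_mul_sub_of_deriv_le
      Real.continuous_sin.continuousOn Real.differentiable_sin.differentiableOn (C := 1)
      (fun z _ => by rw [Real.deriv_sin]; exact Real.cos_le_one z)
      (Real.arcsin x) trivial (Real.arcsin y) trivial hmono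
    rw [hsx, hsy] at this
    linarith
  · have := (convex_Icc (0 : ℝ) (Real.arcsin (3 / 5))).mul_sub_le_image_sub_of_le_deriv
      Real.continuous_sin.continuousOn Real.differentiable_sin.differentiableOn (C := 4 / 5)
      (fun z hz => by
        rw [interior_Icc] at hz
        rw [Real.deriv_sin]
        have h1 : Real.cos (Real.arcsin (3 / 5)) = 4 / 5 := by
          rw [Real.cos_arcsin, show (1 : ℝ) - (3 / 5) ^ 2 = (4 / 5) ^ 2 by norm_num]
          exact Real.sqrt_sq (by norm_num)
        rw [← h1]
        exact Real.cos_le_cos_of_nonneg_of_le_pi hz.1.le (by linarith [Real.pi_pos]) hz.2.le)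
      (Real.arcsin x) ⟨hx0, hmono.trans hy1⟩ (Real.arcsin y) ⟨hx0.trans hmono, hy1⟩ hmono
    rw [hsx, hsy] at this
    linarith

theorem sin_sq_add_nat_mul_pi (j : ℕ) (D : ℝ) :
    Real.sin (Real.pi * j + Real.pi / 4 + D) ^ 2 = (1 + Real.sin (2 * D)) / 2 := by
  have h1 : Real.sin (2 * D) = -Real.cos (2 * (Real.pi * j + Real.pi / 4 + D)) := by
    rw [show 2 * (Real.pi * j + Real.pi / 4 + D) =
      2 * D + Real.pi / 2 + (j : ℕ) * (2 * Real.pi) by ring, Real.cos_add_nat_mul_two_pi,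
      Real.cos_add_pi_div_two, neg_neg]
  rw [h1, Real.cos_two_mul']
  linarith [Real.sin_sq_add_cos_sq (Real.pi * j + Real.pi / 4 + D)]

theorem mul_sin_le_sin_mul {ρ θ : ℝ} (hρ0 : 0 ≤ ρ) (hρ1 : ρ ≤ 1) (hθ0 : 0 ≤ θ)
    (hθ1 : θ ≤ Real.pi) : ρ * Real.sin θ ≤ Real.sin (ρ * θ) := by
  have := strictConcaveOn_sin_Icc.concaveOn.2 (x := 0) (y := θ) ⟨le_rfl, Real.pi_pos.le⟩
    ⟨hθ0, hθ1⟩ (sub_nonneg.2 hρ1) hρ0 (by ring)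
  simpa using this

/-- For an amplitude near `c`, the multiplier `m` of the angle and the damping factor `l` by which
the amplitude `c` is mapped to an outcome probability `1 / 2`. -/
theorem exists_alignment {c w : ℝ} (hw : 0 < w) (hwc : 15 * w ≤ c) (hc : c + w ≤ 3 / 5) :
    ∃ (k j : ℕ) (l : ℝ), 0 < l ∧ l ≤ 1 ∧ ((2 * k + 1 : ℕ) : ℝ) * w ≤ 3 / 5 ∧
      (2 * k + 1) * Real.arcsin (l * c) = Real.pi * j + Real.pi / 4 ∧
      3 / 10 ≤ (2 * k + 1) * (l * w) := by
  have hc0 : 0 < c := by linarith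
  have hx : 15 ≤ 3 / 5 / w := by rw [le_div_iff₀ hw]; linarith
  -- The largest odd multiplier with `(2k+1) w ≤ 3/5`. Deviations of the amplified angle then stay
  -- below `5/4 · 3/5 = 3/4`, within the monotone range of `sin (2D)`.
  set k := ⌊(3 / 5 / w - 1) / 2⌋₊
  have hk1 : (k : ℝ) ≤ (3 / 5 / w - 1) / 2 := Nat.floor_le (by linarith)
  have hk2 : (3 / 5 / w - 1) / 2 < k + 1 := Nat.lt_floor_add_one _
  obtain ⟨M, hM⟩ : ∃ M : ℝ, M = 2 * (k : ℝ) + 1 := ⟨_, rfl⟩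
  have hM1 : M * w ≤ 3 / 5 := by
    have : M ≤ 3 / 5 / w := by rw [hM]; linarith
    rwa [le_div_iff₀ hw] at this
  have hM2 : 13 / 25 ≤ M * w := by
    have h1 : 3 / 5 / w - 2 ≤ M := by rw [hM]; linarith
    have h2 : 13 / 15 * (3 / 5 / w) ≤ M := by linarith
    have h3 := mul_le_mul_of_nonneg_right h2 hw.le
    have h4 : 13 / 15 * (3 / 5 / w) * w = 13 / 25 := by field_simp; norm_num
    linarith
  have hMpos : 0 < M := by rw [hM]; positivity
  set θ := Real.arcsin c
  have hsinθ : Real.sin θ = c := Real.sin_arcsin (by linarith) (by linarith)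
  have hθc : c ≤ θ := by
    have h0 : 0 ≤ θ := Real.arcsin_nonneg.2 hc0.le
    rw [← hsinθ]; exact Real.sin_le h0
  have hθ0 : 0 < θ := hc0.trans_le hθc
  have hθ1 : θ ≤ Real.pi / 2 := Real.arcsin_le_pi_div_two _
  have hMθ : 39 / 5 ≤ M * θ := by
    have : M * (15 * w) ≤ M * θ := mul_le_mul_of_nonneg_left (hwc.trans hθc) hMpos.le
    nlinarith
  have hpi := Real.pi_pos
  have hpi3 := Real.pi_lt_d2
  -- Rounds the amplified angle down to the nearest angle congruent to `π/4` modulo `π`, where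
  -- `sin²` is `1/2` and rising with maximal slope. At most `π` out of at least `39/5` is lost, so
  -- by concavity of the sine the damping factor stays above `29/50`.
  set j := ⌊(M * θ - Real.pi / 4) / Real.pi⌋₊
  have hj1 : (j : ℝ) ≤ (M * θ - Real.pi / 4) / Real.pi :=
    Nat.floor_le (div_nonneg (by linarith) hpi.le)
  have hj2 : (M * θ - Real.pi / 4) / Real.pi < j + 1 := Nat.lt_floor_add_one _
  rw [le_div_iff₀ hpi] at hj1
  rw [div_lt_iff₀ hpi] at hj2
  obtain ⟨t, ht⟩ : ∃ t, t = Real.pi * j + Real.pi / 4 := ⟨_, rfl⟩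
  have ht1 : t ≤ M * θ := by rw [ht]; linarith
  have ht2 : M * θ - Real.pi ≤ t := by rw [ht]; linarith
  have ht0 : 0 < t := by rw [ht]; positivity
  have htM : t / M ≤ θ := by rw [div_le_iff₀ hMpos]; linarith
  have hsin1 : Real.sin (t / M) ≤ c := by
    rw [← hsinθ]
    exact Real.sin_le_sin_of_le_of_le_pi_div_two
      (by have : 0 ≤ t / M := by positivity
          linarith) hθ1 htM
  have hsin2 : 29 / 50 * c ≤ Real.sin (t / M) := by
    have hr0 : 0 ≤ t / (M * θ) := by positivity
    have hr1 : t / (M * θ) ≤ 1 := by rw [div_le_one (by positivity)]; exact ht1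
    have hr2 : 29 / 50 ≤ t / (M * θ) := by
      rw [le_div_iff₀ (by positivity)]; nlinarith
    have h := mul_sin_le_sin_mul hr0 hr1 hθ0.le (by linarith)
    have e : t / (M * θ) * θ = t / M := by field_simp
    rw [e, hsinθ] at h
    exact (mul_le_mul_of_nonneg_right hr2 hc0.le).trans h
  have hsinpos : 0 < Real.sin (t / M) := lt_of_lt_of_le (by positivity) hsin2
  refine ⟨k, j, Real.sin (t / M) / c, by positivity, by rwa [div_le_one hc0], ?_, ?_, ?_⟩
  · push_cast
    rw [← hM]; exact hM1
  · rw [div_mul_cancel₀ _ hc0.ne', Real.arcsin_sin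
      (by have : 0 ≤ t / M := by positivity
          linarith) (htM.trans hθ1), ← hM, ← ht]
    field_simp
  · have h1 : 29 / 50 ≤ Real.sin (t / M) / c := by rw [le_div_iff₀ hc0]; exact hsin2
    rw [← hM]
    have h2 : 13 / 25 * (29 / 50) ≤ (M * w) * (Real.sin (t / M) / c) :=
      mul_le_mul hM2 h1 (by norm_num) (by linarith)
    have h3 : M * (Real.sin (t / M) / c * w) = (M * w) * (Real.sin (t / M) / c) := by ring
    rw [h3]
    linarith

theorem sin_two_mul_ge {D : ℝ} (h1 : 3 / 20 ≤ D) (h2 : D ≤ 3 / 4) : 1 / 5 ≤ Real.sin (2 * D) := by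
  have h3 : Real.sin (3 / 10) ≤ Real.sin (2 * D) :=
    Real.sin_le_sin_of_le_of_le_pi_div_two (by linarith [Real.pi_pos])
      (by linarith [Real.pi_gt_three]) (by linarith)
  have h4 := Real.sin_gt_sub_cube (x := 3 / 10) (by norm_num)
  norm_num at h4
  linarith

/-- The outcome probability of the circuits that `exists_alignment` selects. -/
theorem aligned_prob_bounds {c w a M l : ℝ} {j : ℕ} (hc : c + w ≤ 3 / 5) (hwc : 15 * w ≤ c)
    (hw : 0 < w) (hM : 0 < M) (hl0 : 0 < l) (hl1 : l ≤ 1) (hMw : M * w ≤ 3 / 5)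
    (ht : M * Real.arcsin (l * c) = Real.pi * j + Real.pi / 4) (hMlw : 3 / 10 ≤ M * (l * w))
    (ha : |a - c| ≤ w) :
    (c + w / 2 ≤ a → 1 / 2 + 1 / 10 ≤ Real.sin (M * Real.arcsin (l * a)) ^ 2) ∧
      (a ≤ c - w / 2 → Real.sin (M * Real.arcsin (l * a)) ^ 2 ≤ 1 / 2 - 1 / 10) := by
  rw [abs_le] at ha
  have hlc : l * c ≤ 3 / 5 := by nlinarith
  have hla : l * a ≤ 3 / 5 := by nlinarith
  have hlc0 : 0 ≤ l * c := mul_nonneg hl0.le (by linarith)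
  have hla0 : 0 ≤ l * a := mul_nonneg hl0.le (by linarith)
  obtain ⟨D, hD⟩ : ∃ D, D = M * (Real.arcsin (l * a) - Real.arcsin (l * c)) := ⟨_, rfl⟩
  have hsin : Real.sin (M * Real.arcsin (l * a)) ^ 2 = (1 + Real.sin (2 * D)) / 2 := by
    rw [← sin_sq_add_nat_mul_pi j, ← ht, hD]
    congr 2
    ring
  have hMl : M * l ≤ M := mul_le_of_le_one_right hM.le hl1
  rw [hsin]
  constructor
  · intro h
    obtain ⟨h1, h2⟩ := arcsin_sub_bounds hlc0 (mul_le_mul_of_nonneg_left (by linarith) hl0.le) hla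
    have h3 := mul_le_mul_of_nonneg_left h1 hM.le
    have h4 := mul_le_mul_of_nonneg_left h2 hM.le
    rw [← hD] at h3 h4
    have h5 : M * l * (w / 2) ≤ M * l * (a - c) :=
      mul_le_mul_of_nonneg_left (by linarith) (by positivity)
    have h6 : M * l * (a - c) ≤ M * w :=
      mul_le_mul hMl (by linarith) (by linarith) hM.le
    have := sin_two_mul_ge (D := D) (by nlinarith) (by nlinarith)
    linarith
  · intro h
    obtain ⟨h1, h2⟩ := arcsin_sub_bounds hla0 (mul_le_mul_of_nonneg_left (by linarith) hl0.le) hlc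
    have h3 := mul_le_mul_of_nonneg_left h1 hM.le
    have h4 := mul_le_mul_of_nonneg_left h2 hM.le
    have hD' : -D = M * (Real.arcsin (l * c) - Real.arcsin (l * a)) := by rw [hD]; ring
    rw [← hD'] at h3 h4
    have h5 : M * l * (w / 2) ≤ M * l * (c - a) :=
      mul_le_mul_of_nonneg_left (by linarith) (by positivity)
    have h6 : M * l * (c - a) ≤ M * w :=
      mul_le_mul hMl (by linarith) (by linarith) hM.le
    have := sin_two_mul_ge (D := -D) (by nlinarith) (by nlinarith)
    rw [mul_neg, Real.sin_neg] at this
    linarith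

open Polynomial in
theorem spectralProb_C_mul {X : Type*} [Fintype X] [DecidableEq X] {ρ : Matrix X X ℂ}
    (hρ : ρ.IsHermitian) (l : ℝ) (Q : ℝ[X]) :
    spectralProb (C l * Q) ρ = l ^ 2 * spectralProb Q ρ := by
  rw [spectralProb, spectralProb, trace_aeval_mul_mul_re hρ, trace_aeval_mul_mul_re hρ,
    Finset.mul_sum]
  refine Finset.sum_congr rfl fun i _ => ?_
  rw [eval_mul, eval_C]
  ring

/-- A circuit that distinguishes the amplitudes above `c + w / 2` from those below `c - w / 2`. -/
theorem exists_test_circuit (Q : Polynomial ℝ) (d : ℕ) (hd : Q.natDegree ≤ d)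
    (hQ : ∀ x ∈ Set.Icc (-1 : ℝ) 1, |Q.eval x| ≤ 1 / 2) {c w : ℝ} (hw : 0 < w)
    (hwc : 15 * w ≤ c) (hc : c + w ≤ 3 / 5) :
    ∃ x : QPPParams × ℕ, ∀ (n m : ℕ) (ρ : Matrix (Reg n) (Reg n) ℂ)
      (U : unitaryGroup (OracleReg n m) ℂ), ρ.IsHermitian → IsPurifiedOracle U ρ →
        |Real.sqrt (spectralProb Q ρ) - c| ≤ w →
        ((amplified (qppCircuit x.1) x.2 : Circuit n m).queries : ℝ) * w ≤ 3 / 5 * (4 * d + 1) ∧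
        (c + w / 2 ≤ Real.sqrt (spectralProb Q ρ) → 1 / 2 + 1 / 10 ≤
          (amplified (qppCircuit x.1) x.2).outcomeProb U 1) ∧
        (Real.sqrt (spectralProb Q ρ) ≤ c - w / 2 →
          (amplified (qppCircuit x.1) x.2).outcomeProb U 1 ≤ 1 / 2 - 1 / 10) := by
  obtain ⟨k, j, l, hl0, hl1, hkw, ht, hklw⟩ := exists_alignment hw hwc hc
  obtain ⟨p, hpL, hp⟩ := exists_qppParams (Polynomial.C l * Q) d
    ((Polynomial.natDegree_C_mul_le _ _).trans hd) (fun x hx => by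
      rw [Polynomial.eval_mul, Polynomial.eval_C, abs_mul, abs_of_pos hl0]
      exact (mul_le_of_le_one_left (abs_nonneg _) hl1).trans (hQ x hx))
  refine ⟨(p, k), fun n m ρ U hρ hU ha => ?_⟩
  have hq : ((amplified (qppCircuit p) k : Circuit n m).queries : ℝ) * w ≤
      3 / 5 * (4 * d + 1) := by
    rw [queries_amplified, queries_qppCircuit, hpL]
    have h1 := mul_le_mul_of_nonneg_right hkw (show (0 : ℝ) ≤ 4 * d + 1 by positivity)
    push_cast at h1 ⊢
    linarith
  obtain ⟨a, haa⟩ : ∃ a, a = Real.sqrt (spectralProb Q ρ) := ⟨_, rfl⟩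
  rw [← haa] at ha ⊢
  have ha0 : 0 < a := by linarith [(abs_le.1 ha).1]
  -- `Real.sqrt` is 0 on negative numbers, so `a > 0` already excludes a negative spectral sum.
  have hP : spectralProb Q ρ = a ^ 2 := by
    rw [haa, Real.sq_sqrt]
    by_contra hneg
    rw [haa, Real.sqrt_eq_zero_of_nonpos (not_le.1 hneg).le] at ha0
    exact lt_irrefl _ ha0
  have hla0 : 0 < l * a := mul_pos hl0 ha0
  have hla : l * a ≤ 3 / 5 := by nlinarith [(abs_le.1 ha).2]
  -- Damping needs no extra gate: it is the scaling of the polynomial by `l`.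
  have hprob : (qppCircuit p : Circuit n m).outcomeProb U 1 =
      Real.sin (Real.arcsin (l * a)) ^ 2 := by
    rw [hp n m ρ U hU, Real.sin_arcsin (by linarith) (by linarith), mul_pow, ← hP,
      ← spectralProb_C_mul hρ]
    rfl
  have hs : Real.sin (Real.arcsin (l * a)) ≠ 0 := by
    rw [Real.sin_arcsin (by linarith) (by linarith)]; exact hla0.ne'
  have hcos : Real.cos (Real.arcsin (l * a)) ≠ 0 := by
    rw [Real.cos_arcsin]
    exact (Real.sqrt_pos.2 (by nlinarith)).ne'
  have hout := outcomeProb_amplified U (qppCircuit p) _ hprob hs hcos k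
  have hb := aligned_prob_bounds (M := 2 * (k : ℝ) + 1) hc hwc hw (by positivity) hl0 hl1
    (by push_cast at hkw; exact hkw) ht hklw ha
  refine ⟨hq, ?_, ?_⟩
  · rw [hout]; exact hb.1
  · rw [hout]; exact hb.2

/-- Successive refinement of an estimate `c` with error `w` by majority votes. -/
def refineEstimate {χ : Type} (lab : ℝ → ℝ → χ) (R : ℕ) : ℕ → ℝ → ℝ → Algorithm χ
  | 0, c, _ => .output c
  | J + 1, c, w => (sampleCount (lab c w) R 0).bind fun v =>
      open Classical in
      if (R : ℝ) / 2 ≤ v then refineEstimate lab R J (c + w / 4) (3 / 4 * w)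
      else refineEstimate lab R J (c - w / 4) (3 / 4 * w)

/-- A vote discards one outer quarter of `[c - w, c + w]`; the rest is an interval of half-width
`3w/4` centred at `c ± w/4`. The overlap of the two choices covers the amplitudes on which the vote
is uninformative. The conditions `15 w ≤ c` and `c + w ≤ 3/5` persist. -/
theorem le_prob_refineEstimate {χ : Type} {n m : ℕ} (circ : χ → Circuit n m)
    (U : unitaryGroup (OracleReg n m) ℂ) (lab : ℝ → ℝ → χ) {R : ℕ} (hR : 0 < R) {a B : ℝ}
    (hlab : ∀ c w : ℝ, 0 < w → 15 * w ≤ c → c + w ≤ 3 / 5 → |a - c| ≤ w →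
      ((circ (lab c w)).queries : ℝ) * w ≤ B ∧
      (c + w / 2 ≤ a → 1 / 2 + 1 / 10 ≤ (circ (lab c w)).outcomeProb U 1) ∧
      (a ≤ c - w / 2 → (circ (lab c w)).outcomeProb U 1 ≤ 1 / 2 - 1 / 10))
    (J : ℕ) {c w : ℝ} (hw : 0 < w) (hwc : 15 * w ≤ c) (hc : c + w ≤ 3 / 5) (ha : |a - c| ≤ w)
    (q₀ : ℕ) :
    1 - J * (25 / R) ≤ Algorithm.prob circ U
      (fun v q => |a - v| ≤ (3 / 4) ^ J * w ∧ (q : ℝ) ≤ q₀ + J * R * (B / ((3 / 4) ^ J * w)))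
      (refineEstimate lab R J c w) q₀ := by
  induction J generalizing c w q₀ with
  | zero =>
    rw [refineEstimate, Algorithm.prob, if_pos]
    · simp
    · simpa using ha
  | succ J ih =>
    have hR' : (0 : ℝ) < R := by exact_mod_cast hR
    obtain ⟨h1, h2, h3⟩ := hlab c w hw hwc hc ha
    obtain ⟨p, hp⟩ : ∃ p, p = (circ (lab c w)).outcomeProb U 1 := ⟨_, rfl⟩
    rw [← hp] at h2 h3
    have hsample := le_prob_sampleCount circ U (lab c w) hp.symm (t := R / 10) (μ := R * p)
      (by positivity) (q₀ + R * (circ (lab c w)).queries) R 0 q₀ rfl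
    -- The deviation `R/10` matches the margin `1/10` of the test, and `p(1-p) ≤ 1/4` gives `25/R`.
    have hcheb : 1 - 25 / R ≤ 1 - (R * (p * (1 - p)) + (0 + R * p - R * p) ^ 2) / (R / 10) ^ 2 := by
      have e : (R * (p * (1 - p)) + (0 + R * p - R * p) ^ 2) / (R / 10) ^ 2 =
          100 * (p * (1 - p)) / R := by field_simp; ring
      rw [e]
      apply sub_le_sub_left
      apply div_le_div_of_nonneg_right _ hR'.le
      nlinarith [sq_nonneg (p - 1 / 2)]
    rw [refineEstimate]
    have hfin : 1 - (25 / (R : ℝ) + J * (25 / R)) = 1 - ((J + 1 : ℕ) : ℝ) * (25 / R) := by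
      push_cast; ring
    rw [← hfin]
    refine Algorithm.le_prob_bind circ U _ _ (hcheb.trans hsample) (by positivity) (by positivity)
      ?_
    rintro v q ⟨hv, rfl⟩
    rw [abs_lt] at hv
    have ha' := abs_le.1 ha
    have hpow : (0 : ℝ) < (3 / 4) ^ J := by positivity
    have hw' : 0 < 3 / 4 * w := by positivity
    have hscale : (3 / 4 : ℝ) ^ (J + 1) * w = (3 / 4) ^ J * (3 / 4 * w) := by ring
    -- Every round is charged at the rate of the final width, the largest one; this only costs a
    -- factor `J`.
    have hcost : ((circ (lab c w)).queries : ℝ) ≤ B / ((3 / 4) ^ (J + 1) * w) := by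
      rw [le_div_iff₀ (by positivity)]
      refine le_trans ?_ h1
      apply mul_le_mul_of_nonneg_left _ (Nat.cast_nonneg _)
      exact mul_le_of_le_one_left hw.le (pow_le_one₀ (by norm_num) (by norm_num))
    have hmono : ∀ (v : ℝ) (q : ℕ),
        (|a - v| ≤ (3 / 4) ^ J * (3 / 4 * w) ∧
          (q : ℝ) ≤ ((q₀ + R * (circ (lab c w)).queries : ℕ) : ℝ) +
            J * R * (B / ((3 / 4) ^ J * (3 / 4 * w)))) →
        (|a - v| ≤ (3 / 4) ^ (J + 1) * w ∧
          (q : ℝ) ≤ q₀ + ((J + 1 : ℕ) : ℝ) * R * (B / ((3 / 4) ^ (J + 1) * w))) := by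
      rintro v q ⟨e1, e2⟩
      rw [hscale]
      refine ⟨e1, e2.trans ?_⟩
      rw [hscale] at hcost
      have := mul_le_mul_of_nonneg_left hcost hR'.le
      push_cast
      linarith
    split_ifs with hmaj
    · have hlow : c - w / 2 < a := by
        by_contra hcon
        have := h3 (not_lt.1 hcon)
        nlinarith
      refine (ih hw' (by linarith) (by linarith) ?_ _).trans
        (Algorithm.prob_mono circ U hmono _ _)
      rw [abs_le]; constructor <;> linarith
    · have hupp : a < c + w / 2 := by
        by_contra hcon
        have := h2 (not_lt.1 hcon)
        rw [not_le] at hmaj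
        nlinarith
      refine (ih hw' (by linarith) (by linarith) ?_ _).trans
        (Algorithm.prob_mono circ U hmono _ _)
      rw [abs_le]; constructor <;> linarith

theorem abs_log_sub_log_le {x y τ : ℝ} (hx : 0 < x) (hy : 0 < y) (hτ : 0 < τ) (hτ1 : τ ≤ 1 / 2)
    (h1 : (1 - τ) * x ≤ (1 + τ) * y) (h2 : (1 - τ) * y ≤ (1 + τ) * x) :
    |Real.log x - Real.log y| ≤ 4 * τ := by
  have key : ∀ {x y : ℝ}, 0 < x → 0 < y → (1 - τ) * x ≤ (1 + τ) * y →
      Real.log x - Real.log y ≤ 4 * τ := by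
    intro x y hx hy h
    rw [← Real.log_div hx.ne' hy.ne']
    refine (Real.log_le_sub_one_of_pos (by positivity)).trans ?_
    rw [sub_le_iff_le_add, div_le_iff₀ hy]
    have h3 : (1 - τ) * x ≤ (1 - τ) * ((4 * τ + 1) * y) := by
      refine h.trans ?_
      rw [← mul_assoc]
      apply mul_le_mul_of_nonneg_right _ hy.le
      nlinarith
    exact le_of_mul_le_mul_left h3 (by linarith)
  rw [abs_le]
  constructor
  · have := key hy hx h2; linarith
  · exact key hx hy h1

/-! ### Estimation algorithms -/

theorem IsDensityMatrix.min_le_tracePow {X : Type*} [Fintype X] [DecidableEq X]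
    {ρ : Matrix X X ℂ} {γ : ℝ} (h : IsDensityMatrix ρ)
    (hspec : ∀ p ∈ spectrum ℝ ρ, p ≠ 0 → γ ≤ p) {α : ℝ} (hα : 0 < α) (hα1 : α ≠ 1) (hγ : 0 < γ) :
    min 1 (γ ^ (α - 1)) ≤ tracePow α ρ := by
  rcases lt_or_gt_of_ne hα1 with h1 | h1
  · exact (min_le_left _ _).trans (h.tracePow_bounds_of_lt_one hspec hα h1 hγ).1
  · exact (min_le_right _ _).trans (h.tracePow_bounds_of_one_lt hspec h1 hγ).1

theorem abs_renyi_sub_le {X : Type*} [Fintype X] [DecidableEq X] {ρ : Matrix X X ℂ}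
    {α ε x : ℝ} (hα1 : α ≠ 1) (h : |x - Real.log (tracePow α ρ)| ≤ |1 - α| * ε) :
    |1 / (1 - α) * x - renyiEntropy α ρ| ≤ ε := by
  have hpos : 0 < |1 - α| := abs_pos.2 (sub_ne_zero.2 hα1.symm)
  rw [renyiEntropy, ← mul_sub, abs_mul, abs_div, abs_one, one_div, inv_mul_le_iff₀ hpos]
  exact h

theorem inverse_sample_bounds {v r P t : ℝ} (hr : 0 < r) (hP : 0 < P) (ht1 : t < 1)
    (h : |v - r / P| < t * (r / P)) :
    0 < v ∧ (1 - t) * (r / v) ≤ P ∧ P ≤ (1 + t) * (r / v) ∧ v ≤ (1 + t) * (r / P) := by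
  rw [abs_lt] at h
  have hrP : 0 < r / P := by positivity
  have hv : 0 < v := by nlinarith
  have e : r / P * P = r := div_mul_cancel₀ _ hP.ne'
  refine ⟨hv, ?_, ?_, by linarith⟩
  · rw [← mul_div_assoc, div_le_iff₀ hv]
    have : (1 - t) * (r / P) * P ≤ v * P := mul_le_mul_of_nonneg_right (by linarith) hP.le
    rw [mul_assoc, e] at this
    linarith
  · rw [← mul_div_assoc, le_div_iff₀ hv]
    have : v * P ≤ (1 + t) * (r / P) * P := mul_le_mul_of_nonneg_right (by linarith) hP.le
    rw [mul_assoc, e] at this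
    linarith

theorem abs_log_spectralProb_sub_le {P κ T τ : ℝ} (hP : 0 < P) (hκ : 0 < κ) (hT : 0 < T)
    (hτ : 0 < τ) (hτ1 : τ ≤ 1 / 2) (h1 : (1 - τ) * (κ * T) ≤ P) (h2 : P ≤ (1 + τ) * (κ * T)) :
    |Real.log (P / κ) - Real.log T| ≤ 4 * τ := by
  have e : P / κ * κ = P := div_mul_cancel₀ _ hκ.ne'
  have hPκ : 0 < P / κ := by positivity
  apply abs_log_sub_log_le hPκ hT hτ hτ1
  · have h3 : P / κ ≤ (1 + τ) * T := by
      rw [div_le_iff₀ hκ]; linarith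
    nlinarith
  · have h3 : (1 - τ) * T ≤ P / κ := by
      rw [le_div_iff₀ hκ]; linarith
    nlinarith

/-- Estimation by inverse binomial sampling. -/
theorem estimableByMeasurement_of_approx {α γ ε δ τ κ : ℝ} (hα : 0 < α) (hα1 : α ≠ 1)
    (hγ : 0 < γ) (hδ : 0 < δ) (hδ1 : δ < 1) (hτ : 0 < τ) (hτ1 : τ ≤ 1 / 16)
    (hτε : 16 * τ ≤ |1 - α| * ε) (hκ : 0 < κ) {Q : Polynomial ℝ} (hQ : IsPowerApprox α γ τ κ Q)
    {d : ℕ} (hd : Q.natDegree ≤ d) {B : ℝ → ℝ}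
    (hB : ∀ (n : ℕ) (ρ : Matrix (Reg n) (Reg n) ℂ), IsDensityMatrix ρ →
      (∀ p ∈ spectrum ℝ ρ, p ≠ 0 → γ ≤ p) →
      8 * (4 * d + 1) / (δ * τ ^ 2 * (κ * tracePow α ρ)) ≤ B (renyiEta α ρ)) :
    EstimableByMeasurement α γ ε δ B := by
  obtain ⟨p, hpL, hp⟩ := exists_qppParams Q d hd hQ.bound
  set T₀ := min 1 (γ ^ (α - 1)) with hT₀
  have hT₀pos : 0 < T₀ := lt_min one_pos (Real.rpow_pos_of_pos hγ _)
  obtain ⟨r, hr⟩ : ∃ r : ℕ, r = ⌈1 / (δ * τ ^ 2)⌉₊ := ⟨_, rfl⟩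
  have hx1 : 1 ≤ 1 / (δ * τ ^ 2) := by
    rw [le_div_iff₀ (by positivity), one_mul]; nlinarith
  have hr1 : 1 / (δ * τ ^ 2) ≤ r := hr ▸ Nat.le_ceil _
  have hr2 : (r : ℝ) ≤ 2 / (δ * τ ^ 2) := by
    have h1 : (r : ℝ) < 1 / (δ * τ ^ 2) + 1 := hr ▸ Nat.ceil_lt_add_one (by positivity)
    have h2 : 2 / (δ * τ ^ 2) = 1 / (δ * τ ^ 2) + 1 / (δ * τ ^ 2) := by ring
    linarith
  have hrpos : (0 : ℝ) < r := by linarith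
  have hrnat : 0 < r := by exact_mod_cast hrpos
  -- The fuel only keeps the decision tree finite; it uses a lower bound `T₀` on `tr(ρ^α)` common to
  -- all admissible states and does not enter the query bound.
  obtain ⟨fuel, hfuel⟩ := exists_nat_ge (2 * r / ((1 - τ) * (κ * T₀)))
  refine ⟨(inverseSample p fuel r 0).bind fun v =>
    .output (1 / (1 - α) * Real.log (r / v / κ)), fun n m ρ U hρ hU hspec => ?_⟩
  have hTlo := hρ.min_le_tracePow hspec hα hα1 hγ
  obtain ⟨T, hTdef⟩ : ∃ T, T = tracePow α ρ := ⟨_, rfl⟩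
  rw [← hTdef] at hTlo
  have hT : 0 < T := hT₀pos.trans_le hTlo
  obtain ⟨hP1, hP2, -⟩ := hQ.spectralProb_bounds hρ hspec hα.ne' hγ
  have hprob := hp n m ρ U hU
  change _ = spectralProb Q ρ at hprob
  obtain ⟨P, hPdef⟩ : ∃ P, P = spectralProb Q ρ := ⟨_, rfl⟩
  rw [← hPdef, ← hTdef] at hP1 hP2
  rw [← hPdef] at hprob
  have hκT : 0 < κ * T := by positivity
  have hP : 0 < P := lt_of_lt_of_le (mul_pos (by linarith) hκT) hP1
  have hfuel' : 2 * r / P ≤ fuel := by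
    refine le_trans ?_ hfuel
    apply div_le_div_of_nonneg_left (by positivity)
      (mul_pos (by linarith) (by positivity))
    refine le_trans ?_ hP1
    have : κ * T₀ ≤ κ * T := mul_le_mul_of_nonneg_left hTlo hκ.le
    exact mul_le_mul_of_nonneg_left this (by linarith)
  have hδr : 1 / (r * τ ^ 2) ≤ δ := by
    rw [div_le_iff₀ (by positivity)] at hr1 ⊢
    linarith
  have hsample := le_prob_inverseSample (fun p : QPPParams => (qppCircuit p : Circuit n m)) U p
    hprob hP hτ (by linarith) hrnat hfuel' hδr
  have := Algorithm.le_prob_bind (fun p : QPPParams => (qppCircuit p : Circuit n m)) U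
    (E' := fun v q => |v - renyiEntropy α ρ| ≤ ε ∧ (q : ℝ) ≤ B (renyiEta α ρ))
    (f := fun v => .output (1 / (1 - α) * Real.log (r / v / κ))) (δ₂ := 0)
    (inverseSample p fuel r 0) 0 hsample hδ.le le_rfl
  rw [add_zero] at this
  refine this ?_
  rintro v q ⟨hv, hq⟩
  obtain ⟨hv0, hv1, hv2, hv3⟩ := inverse_sample_bounds hrpos hP (by linarith) hv
  rw [Algorithm.prob, if_pos, sub_zero]
  refine ⟨?_, ?_⟩
  · apply abs_renyi_sub_le hα1
    rw [← hTdef]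
    have hrv : 0 < r / v := by positivity
    -- Polynomial approximation and sampling each contribute at most `4τ`, within the allowance
    -- `16τ`.
    have h1 := abs_log_spectralProb_sub_le hP hκ hT hτ (by linarith) hP1 hP2
    have h2 := abs_log_sub_log_le hrv hP hτ (by linarith) (by nlinarith) (by nlinarith)
    rw [Real.log_div hP.ne' hκ.ne'] at h1
    rw [Real.log_div hrv.ne' hκ.ne']
    rw [abs_le] at h1 h2 ⊢
    constructor <;> linarith
  · refine le_trans ?_ (hB n ρ hρ hspec)
    rw [hq, queries_qppCircuit, hpL, ← hTdef]
    have h1 : v ≤ 4 / (δ * τ ^ 2 * (κ * T)) := by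
      have h3 : (r : ℝ) / P ≤ (2 / (δ * τ ^ 2)) / ((1 - τ) * (κ * T)) :=
        div_le_div₀ (by positivity) hr2 (mul_pos (by linarith) hκT) hP1
      calc v ≤ (1 + τ) * (r / P) := hv3
        _ ≤ (1 + τ) * ((2 / (δ * τ ^ 2)) / ((1 - τ) * (κ * T))) :=
            mul_le_mul_of_nonneg_left h3 (by linarith)
        _ = ((1 + τ) / (1 - τ)) * (2 / (δ * τ ^ 2 * (κ * T))) := by
            have : 1 - τ ≠ 0 := by linarith
            field_simp
        _ ≤ 2 * (2 / (δ * τ ^ 2 * (κ * T))) := by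
            apply mul_le_mul_of_nonneg_right _ (by positivity)
            rw [div_le_iff₀ (by linarith)]; linarith
        _ = _ := by ring
    push_cast
    calc v * (2 * (2 * (d : ℝ)) + 1) ≤ 4 / (δ * τ ^ 2 * (κ * T)) * (2 * (2 * (d : ℝ)) + 1) :=
          mul_le_mul_of_nonneg_right h1 (by positivity)
      _ = 4 * (4 * d + 1) / (δ * τ ^ 2 * (κ * T)) := by ring
      _ ≤ _ := by
        apply div_le_div_of_nonneg_right _ (by positivity)
        have : (0 : ℝ) ≤ 4 * d + 1 := by positivity
        linarith

theorem amplified_zero {n m : ℕ} (A : Circuit n m) : amplified A 0 = A := by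
  simp [amplified]

theorem exists_round_count {τ : ℝ} (hτ : 0 < τ) (hτ1 : τ ≤ 1) :
    ∃ J : ℕ, 0 < J ∧ (3 / 4 : ℝ) ^ J ≤ τ ∧ 3 / 4 * τ ≤ (3 / 4 : ℝ) ^ J ∧
      (J : ℝ) ≤ 4 * Real.log (1 / τ) + 1 := by
  obtain ⟨k, hk1, hk2⟩ := exists_nat_pow_near_of_lt_one hτ hτ1 (y := (3 / 4 : ℝ)) (by norm_num)
    (by norm_num)
  refine ⟨k + 1, Nat.succ_pos k, hk1.le, ?_, ?_⟩
  · rw [pow_succ]; linarith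
  · have h1 : Real.log τ ≤ k * Real.log (3 / 4) := by
      rw [← Real.log_pow]; exact Real.log_le_log hτ hk2
    have h2 : Real.log (3 / 4) ≤ 3 / 4 - 1 := Real.log_le_sub_one_of_pos (by norm_num)
    have h3 : (k : ℝ) * Real.log (3 / 4) ≤ k * (3 / 4 - 1) :=
      mul_le_mul_of_nonneg_left h2 (Nat.cast_nonneg k)
    rw [one_div, Real.log_inv]
    push_cast
    linarith

/-- The rough estimate of the amplitude that starts the refinement. -/
theorem initial_amplitude_bounds {P P' a c : ℝ} (hP' : 0 < P')
    (h1 : (1 - 1 / 16) * P' ≤ P) (h2 : P ≤ (1 + 1 / 16) * P') (ha : a = Real.sqrt P)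
    (hc : c = Real.sqrt P') (hP4 : P ≤ 1 / 4) :
    0 < c ∧ |a - c| ≤ c / 16 ∧ c + c / 16 ≤ 3 / 5 := by
  have hP : 0 < P := by linarith
  have hc0 : 0 < c := hc ▸ Real.sqrt_pos.2 hP'
  have ha0 : 0 < a := ha ▸ Real.sqrt_pos.2 hP
  have hc2 : c ^ 2 = P' := by rw [hc, Real.sq_sqrt hP'.le]
  have ha2 : a ^ 2 = P := by rw [ha, Real.sq_sqrt hP.le]
  refine ⟨hc0, ?_, ?_⟩
  · rw [abs_le]
    constructor
    · have : 15 / 16 * c ≤ a := by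
        apply le_of_sq_le_sq _ ha0.le
        rw [mul_pow, hc2, ha2]; linarith
      linarith
    · have : a ≤ 17 / 16 * c := by
        apply le_of_sq_le_sq _ (by positivity)
        rw [mul_pow, hc2, ha2]; linarith
      linarith
  · have : c ≤ 14 / 25 := by
      apply le_of_sq_le_sq _ (by norm_num)
      rw [hc2]; linarith
    linarith

theorem relative_error_bounds {a c τ : ℝ} (ha : 0 < a) (hτ : 0 < τ) (hτ1 : τ ≤ 1 / 16)
    (h : |a - c| ≤ τ * a) :
    0 < c ∧ (1 - τ) * c ≤ (1 + τ) * a ∧ (1 - τ) * a ≤ (1 + τ) * c := by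
  rw [abs_le] at h
  have h1 : τ * a ≤ 1 / 16 * a := mul_le_mul_of_nonneg_right hτ1 ha.le
  have hc : 0 < c := by linarith
  have h2 : 0 < τ * c := mul_pos hτ hc
  refine ⟨hc, ?_, ?_⟩ <;> linarith

/-- The total number of queries of the rough estimate and its refinement. -/
theorem refinement_cost_bound {δ τ ℓ X r P a c₀ v q q' : ℝ} {J R d : ℕ} (hδ : 0 < δ) (hτ : 0 < τ)
    (hτ1 : τ ≤ 1) (hℓ : 1 ≤ ℓ) (hX : 0 < X) (hJRcost : (J : ℝ) * R ≤ 1275 * ℓ ^ 2 / δ)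
    (hr2 : r ≤ 513 / δ) (hP : 0 < P) (hP1' : 15 / 16 * X ≤ P) (hP4 : P ≤ 1 / 4)
    (ha : a = Real.sqrt P) (hJ2 : 3 / 4 * τ ≤ (3 / 4 : ℝ) ^ J) (hac : |a - c₀| ≤ c₀ / 16)
    (hv3 : v ≤ (1 + 1 / 16) * (r / P)) (hq : q = v * (4 * d + 1))
    (hq' : q' ≤ q + J * R * (3 / 5 * (4 * d + 1) / ((3 / 4) ^ J * (c₀ / 16)))) :
    q' ≤ 20000 * ℓ ^ 2 * (4 * d + 1) / (δ * τ * X) := by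
  have hac' := (abs_le.1 hac).2
  have hd0 : (0 : ℝ) ≤ 4 * d + 1 := by positivity
  have hℓ2 : 1 ≤ ℓ ^ 2 := one_le_pow₀ hℓ
  have hbase : 0 ≤ (4 * d + 1) / (δ * τ * X) := by positivity
  have hv4 : v ≤ 600 / (δ * τ * X) := by
    have h3 : (r : ℝ) / P ≤ (513 / δ) / (15 / 16 * X) :=
      div_le_div₀ (by positivity) hr2 (by positivity) hP1'
    calc v ≤ (1 + 1 / 16) * (r / P) := hv3
      _ ≤ (1 + 1 / 16) * ((513 / δ) / (15 / 16 * X)) :=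
          mul_le_mul_of_nonneg_left h3 (by norm_num)
      _ = (17 / 15 * 513 * τ) / (δ * τ * X) := by field_simp; norm_num
      _ ≤ _ := by
          apply div_le_div_of_nonneg_right _ (by positivity)
          linarith
  have hstage1 : (q : ℝ) ≤ 600 * ℓ ^ 2 * ((4 * d + 1) / (δ * τ * X)) := by
    rw [hq]
    calc v * (4 * (d : ℝ) + 1) ≤ 600 / (δ * τ * X) * (4 * d + 1) :=
          mul_le_mul_of_nonneg_right hv4 hd0
      _ = 600 * 1 * ((4 * d + 1) / (δ * τ * X)) := by ring
      _ ≤ _ := by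
          apply mul_le_mul_of_nonneg_right _ hbase
          linarith
  -- Replaces the amplitude `√P` in the denominator by `P`, which is weaker but is all that the
  -- stated bound requires.
  have haP : P ≤ a := by
    rw [ha]
    apply Real.le_sqrt_of_sq_le
    nlinarith
  have hc₀ : 0 < c₀ := by linarith
  have hw : τ * X / 25 ≤ (3 / 4) ^ J * (c₀ / 16) := by
    have h1 : 16 / 17 * (15 / 16 * X) / 16 ≤ c₀ / 16 := by linarith
    have h2 := mul_le_mul hJ2 h1 (by positivity) (by positivity)
    nlinarith [mul_pos hτ hX]
  have hstage2 : (J : ℝ) * R * (3 / 5 * (4 * d + 1) / ((3 / 4) ^ J * (c₀ / 16))) ≤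
      19125 * ℓ ^ 2 * ((4 * d + 1) / (δ * τ * X)) := by
    have h1 : 3 / 5 * (4 * d + 1) / ((3 / 4) ^ J * (c₀ / 16)) ≤
        3 / 5 * (4 * (d : ℝ) + 1) / (τ * X / 25) :=
      div_le_div_of_nonneg_left (by positivity) (by positivity) hw
    calc _ ≤ (1275 * ℓ ^ 2 / δ) * (3 / 5 * (4 * (d : ℝ) + 1) / (τ * X / 25)) :=
          mul_le_mul hJRcost h1 (by positivity) (by positivity)
      _ = _ := by field_simp; norm_num
  have e : 20000 * ℓ ^ 2 * (4 * (d : ℝ) + 1) / (δ * τ * X) =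
      20000 * ℓ ^ 2 * ((4 * d + 1) / (δ * τ * X)) := by ring
  rw [e]
  have hnn : 0 ≤ ℓ ^ 2 * ((4 * (d : ℝ) + 1) / (δ * τ * X)) :=
    mul_nonneg (by linarith) hbase
  linarith


/-- Estimation by a rough estimate and its successive refinement. -/
theorem estimableByAmplitudeEstimation_of_approx {α γ ε δ τ κ ℓ : ℝ} (hα : 0 < α) (hα1 : α ≠ 1)
    (hγ : 0 < γ) (hδ : 0 < δ) (hδ1 : δ < 1) (hτ : 0 < τ) (hτ1 : τ ≤ 1 / 16)
    (hτε : 16 * τ ≤ |1 - α| * ε) (hκ : 0 < κ) (hℓ : 1 ≤ ℓ) (hτℓ : Real.log (1 / τ) ≤ ℓ)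
    {Q : Polynomial ℝ} (hQ : IsPowerApprox α γ τ κ Q)
    {d : ℕ} (hd : Q.natDegree ≤ d) {B : ℝ → ℝ}
    (hB : ∀ (n : ℕ) (ρ : Matrix (Reg n) (Reg n) ℂ), IsDensityMatrix ρ →
      (∀ p ∈ spectrum ℝ ρ, p ≠ 0 → γ ≤ p) →
      20000 * ℓ ^ 2 * (4 * d + 1) / (δ * τ * (κ * tracePow α ρ)) ≤ B (renyiEta α ρ)) :
    EstimableByAmplitudeEstimation α γ ε δ B := by
  obtain ⟨p, hpL, hp⟩ := exists_qppParams Q d hd hQ.bound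
  have hlab' : ∀ c w : ℝ, ∃ x : QPPParams × ℕ, 0 < w → 15 * w ≤ c → c + w ≤ 3 / 5 →
      ∀ (n m : ℕ) (ρ : Matrix (Reg n) (Reg n) ℂ)
      (U : unitaryGroup (OracleReg n m) ℂ), ρ.IsHermitian → IsPurifiedOracle U ρ →
        |Real.sqrt (spectralProb Q ρ) - c| ≤ w →
        ((amplified (qppCircuit x.1) x.2 : Circuit n m).queries : ℝ) * w ≤ 3 / 5 * (4 * d + 1) ∧
        (c + w / 2 ≤ Real.sqrt (spectralProb Q ρ) → 1 / 2 + 1 / 10 ≤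
          (amplified (qppCircuit x.1) x.2).outcomeProb U 1) ∧
        (Real.sqrt (spectralProb Q ρ) ≤ c - w / 2 →
          (amplified (qppCircuit x.1) x.2).outcomeProb U 1 ≤ 1 / 2 - 1 / 10) := by
    intro c w
    by_cases h : 0 < w ∧ 15 * w ≤ c ∧ c + w ≤ 3 / 5
    · obtain ⟨x, hx⟩ := exists_test_circuit Q d hd hQ.bound h.1 h.2.1 h.2.2
      exact ⟨x, fun _ _ _ => hx⟩
    -- An arbitrary label off the admissible range, so that the choice of test is a function of `(c,
    -- w)` alone and does not depend on the state or the oracle.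
    · exact ⟨(p, 0), fun h1 h2 h3 => absurd ⟨h1, h2, h3⟩ h⟩
  choose lab hlab using hlab'
  set T₀ := min 1 (γ ^ (α - 1)) with hT₀
  have hT₀pos : 0 < T₀ := lt_min one_pos (Real.rpow_pos_of_pos hγ _)
  -- `512 = 2 · 16²`: relative error `1/16` with failure probability at most `δ/2`. The other `δ/2`
  -- goes to the `J` rounds of refinement.
  obtain ⟨r, hr⟩ : ∃ r : ℕ, r = ⌈512 / δ⌉₊ := ⟨_, rfl⟩
  have hδinv : 1 ≤ 1 / δ := by rw [le_div_iff₀ hδ]; linarith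
  have hr1 : 512 / δ ≤ r := hr ▸ Nat.le_ceil _
  have hr2 : (r : ℝ) ≤ 513 / δ := by
    have h1 : (r : ℝ) < 512 / δ + 1 := hr ▸ Nat.ceil_lt_add_one (by positivity)
    have h2 : 513 / δ = 512 / δ + 1 / δ := by ring
    linarith
  have hrpos : (0 : ℝ) < r := lt_of_lt_of_le (by positivity) hr1
  have hrnat : 0 < r := by exact_mod_cast hrpos
  obtain ⟨J, hJ0, hJ1, hJ2, hJ3⟩ := exists_round_count hτ (by linarith)
  have hJ1' : (1 : ℝ) ≤ J := by exact_mod_cast hJ0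
  have hJℓ : (J : ℝ) ≤ 5 * ℓ := by linarith
  obtain ⟨R, hR⟩ : ∃ R : ℕ, R = ⌈50 * J / δ⌉₊ := ⟨_, rfl⟩
  have hR1 : 50 * J / δ ≤ R := hR ▸ Nat.le_ceil _
  have hR2 : (R : ℝ) ≤ 51 * J / δ := by
    have h1 : (R : ℝ) < 50 * J / δ + 1 := hR ▸ Nat.ceil_lt_add_one (by positivity)
    have h2 : 51 * J / δ = 50 * J / δ + J * (1 / δ) := by ring
    nlinarith
  have hRpos : (0 : ℝ) < R := lt_of_lt_of_le (by positivity) hR1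
  have hRnat : 0 < R := by exact_mod_cast hRpos
  have hJR : (J : ℝ) * (25 / R) ≤ δ / 2 := by
    rw [div_le_iff₀ hδ] at hR1
    rw [← mul_div_assoc, div_le_iff₀ hRpos]
    linarith
  have hJRcost : (J : ℝ) * R ≤ 1275 * ℓ ^ 2 / δ := by
    have h1 : (J : ℝ) * R ≤ J * (51 * J / δ) := mul_le_mul_of_nonneg_left hR2 (by linarith)
    have h2 : (J : ℝ) * J ≤ (5 * ℓ) * (5 * ℓ) := mul_le_mul hJℓ hJℓ (by linarith) (by linarith)
    have h3 : (J : ℝ) * (51 * J / δ) = 51 * (J * J) / δ := by ring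
    rw [h3] at h1
    refine h1.trans ?_
    apply div_le_div_of_nonneg_right _ hδ.le
    linarith
  obtain ⟨fuel, hfuel⟩ := exists_nat_ge (2 * r / ((1 - τ) * (κ * T₀)))
  refine ⟨(inverseSample (p, 0) fuel r 0).bind fun v =>
    (refineEstimate lab R J (Real.sqrt (r / v)) (Real.sqrt (r / v) / 16)).bind fun c =>
    .output (1 / (1 - α) * Real.log (c ^ 2 / κ)), fun n m ρ U hρ hU hspec => ?_⟩
  set circ : QPPParams × ℕ → Circuit n m := fun p => amplified (qppCircuit p.1) p.2 with hcirc
  have hTlo := hρ.min_le_tracePow hspec hα hα1 hγ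
  obtain ⟨T, hTdef⟩ : ∃ T, T = tracePow α ρ := ⟨_, rfl⟩
  rw [← hTdef] at hTlo
  have hT : 0 < T := hT₀pos.trans_le hTlo
  obtain ⟨hP1, hP2, hP4⟩ := hQ.spectralProb_bounds hρ hspec hα.ne' hγ
  have hprob : (circ (p, 0)).outcomeProb U 1 = spectralProb Q ρ := by
    rw [hcirc]
    simp only [amplified_zero]
    exact hp n m ρ U hU
  have hlabρ := fun c w h1 h2 h3 => hlab c w h1 h2 h3 n m ρ U hρ.1.1 hU
  obtain ⟨P, hPdef⟩ : ∃ P, P = spectralProb Q ρ := ⟨_, rfl⟩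
  rw [← hPdef] at hP1 hP2 hP4 hprob
  rw [← hTdef] at hP1 hP2
  rw [← hPdef] at hlabρ
  obtain ⟨a, ha⟩ : ∃ a, a = Real.sqrt P := ⟨_, rfl⟩
  rw [← ha] at hlabρ
  have hκT : 0 < κ * T := by positivity
  have hP : 0 < P := lt_of_lt_of_le (mul_pos (by linarith) hκT) hP1
  have hP1' : 15 / 16 * (κ * T) ≤ P :=
    le_trans (mul_le_mul_of_nonneg_right (by linarith) hκT.le) hP1
  have hfuel' : 2 * r / P ≤ fuel := by
    refine le_trans ?_ hfuel
    apply div_le_div_of_nonneg_left (by positivity)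
      (mul_pos (by linarith) (by positivity))
    refine le_trans ?_ hP1
    have : κ * T₀ ≤ κ * T := mul_le_mul_of_nonneg_left hTlo hκ.le
    exact mul_le_mul_of_nonneg_left this (by linarith)
  have hδr : 1 / (r * (1 / 16 : ℝ) ^ 2) ≤ δ / 2 := by
    rw [div_le_iff₀ hδ] at hr1
    rw [div_le_iff₀ (by positivity)]
    linarith
  have hsample := le_prob_inverseSample circ U (p, 0)
    hprob hP (τ := 1 / 16) (by norm_num) (by norm_num) hrnat hfuel' hδr
  rw [show 1 - δ = 1 - (δ / 2 + δ / 2) by ring]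
  refine Algorithm.le_prob_bind circ U _ 0 hsample (by positivity) (by positivity) ?_
  rintro v q ⟨hv, hq⟩
  obtain ⟨hv0, hv1, hv2, hv3⟩ := inverse_sample_bounds hrpos hP (by norm_num) hv
  obtain ⟨c₀, hc₀⟩ : ∃ c₀, c₀ = Real.sqrt (r / v) := ⟨_, rfl⟩
  have hrv : 0 < r / v := by positivity
  obtain ⟨hc0, hac, hc35⟩ := initial_amplitude_bounds hrv hv1 hv2 ha hc₀ hP4
  rw [← hc₀]
  have hw0 : 0 < c₀ / 16 := by positivity
  have href := le_prob_refineEstimate circ U lab hRnat (a := a) (B := 3 / 5 * (4 * d + 1))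
    hlabρ J hw0 (by linarith) hc35 hac q
  have href' := (sub_le_sub_left hJR 1).trans href
  rw [show 1 - δ / 2 = 1 - (δ / 2 + 0) by ring]
  refine Algorithm.le_prob_bind circ U _ q href' (by positivity) le_rfl ?_
  rintro c q' ⟨hc, hq'⟩
  have ha0 : 0 < a := ha ▸ Real.sqrt_pos.2 hP
  have hca : |a - c| ≤ τ * a := by
    refine hc.trans (mul_le_mul hJ1 ?_ hw0.le hτ.le)
    linarith [(abs_le.1 hac).1]
  obtain ⟨hcpos, hca1, hca2⟩ := relative_error_bounds ha0 hτ hτ1 hca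
  rw [Algorithm.prob, if_pos, sub_zero]
  refine ⟨?_, ?_⟩
  · apply abs_renyi_sub_le hα1
    rw [← hTdef]
    have h1 := abs_log_spectralProb_sub_le hP hκ hT hτ (by linarith) hP1 hP2
    have h2 := abs_log_sub_log_le hcpos ha0 hτ (by linarith) hca1 hca2
    -- Passing from amplitude to probability doubles the logarithmic error: `4τ + 2 · 4τ` still fits
    -- into `16τ`.
    have h3 : Real.log a = Real.log P / 2 := by rw [ha, Real.log_sqrt hP.le]
    rw [Real.log_div hP.ne' hκ.ne'] at h1
    rw [Real.log_div (pow_pos hcpos 2).ne' hκ.ne', Real.log_pow]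
    rw [h3] at h2
    rw [abs_le] at h1 h2 ⊢
    push_cast
    constructor <;> linarith
  · refine le_trans ?_ (hB n ρ hρ hspec)
    rw [← hTdef]
    have hquer : ((circ (p, 0)).queries : ℝ) = 4 * d + 1 := by
      rw [hcirc]
      simp only [amplified_zero, queries_qppCircuit, hpL]
      push_cast; ring
    refine refinement_cost_bound hδ hτ (by linarith) hℓ hκT hJRcost hr2 hP hP1' hP4 ha hJ2
      hac hv3 ?_ hq'
    rw [hq, hquer]

/-! ### Approximating polynomials and the query bounds -/

section PowerApprox

open Polynomial

/-- The approximated values `x^(-s)` are at least 1, so an absolute error is also a relative one;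
squaring at most about doubles it. -/
theorem sq_bounds_of_relative {y z τ : ℝ} (hz : 1 ≤ z) (hτ : 0 < τ) (hτ1 : τ ≤ 1)
    (h : |y - z| ≤ τ / 4) : (1 - τ) * z ^ 2 ≤ y ^ 2 ∧ y ^ 2 ≤ (1 + τ) * z ^ 2 := by
  have hz0 : 0 < z := by linarith
  have h1 : τ / 4 ≤ τ / 4 * z := le_mul_of_one_le_right (by linarith) hz
  rw [abs_le] at h
  have h2 : (1 - τ / 4) * z ≤ y := by linarith
  have h3 : y ≤ (1 + τ / 4) * z := by linarith
  have h4 : 0 ≤ (1 - τ / 4) * z := mul_nonneg (by linarith) hz0.le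
  constructor
  · calc (1 - τ) * z ^ 2 ≤ ((1 - τ / 4) * z) ^ 2 := by
          rw [mul_pow]; apply mul_le_mul_of_nonneg_right _ (by positivity); nlinarith
      _ ≤ y ^ 2 := pow_le_pow_left₀ h4 h2 2
  · calc y ^ 2 ≤ ((1 + τ / 4) * z) ^ 2 := pow_le_pow_left₀ (h4.trans h2) h3 2
      _ ≤ (1 + τ) * z ^ 2 := by
          rw [mul_pow]; apply mul_le_mul_of_nonneg_right _ (by positivity); nlinarith

theorem exists_isPowerApprox_of_lt_one {α γ τ : ℝ} (hα : 0 < α) (hα1 : α < 1) (hγ : 0 < γ)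
    (hγ1 : γ ≤ 1) (hτ : 0 < τ) (hτ1 : τ ≤ 1) :
    ∃ Q : ℝ[X], 4 * (Q.natDegree : ℝ) + 1 ≤ 121 * logFactor γ (τ / 4) ^ 2 * (1 / γ) ∧
      IsPowerApprox α γ τ (γ ^ (1 - α) / (400 * logFactor γ (τ / 4) ^ 2)) Q := by
  obtain ⟨r, hdeg, happ, hbound, -⟩ := exists_negPow_approx (s := (1 - α) / 2) (γ := γ)
    (τ := τ / 4) (by linarith) (by linarith) hγ hγ1 (by linarith) (by linarith)
  have hℓ : 1 ≤ logFactor γ (τ / 4) := one_le_logFactor hγ hγ1 (by linarith) (by linarith)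
  obtain ⟨ℓ, hℓdef⟩ : ∃ ℓ, ℓ = logFactor γ (τ / 4) := ⟨_, rfl⟩
  rw [← hℓdef] at hdeg hbound hℓ ⊢
  have hg : 0 < γ ^ ((1 - α) / 2) := Real.rpow_pos_of_pos hγ _
  have hginv : γ ^ (-((1 - α) / 2)) = (γ ^ ((1 - α) / 2))⁻¹ := Real.rpow_neg hγ.le _
  have hg2 : (γ ^ ((1 - α) / 2)) ^ 2 = γ ^ (1 - α) := by
    rw [← Real.rpow_natCast, ← Real.rpow_mul hγ.le]; congr 1; push_cast; ring
  have hev : ∀ x, (C (γ ^ ((1 - α) / 2) / (20 * ℓ)) * r).eval x =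
      γ ^ ((1 - α) / 2) / (20 * ℓ) * r.eval x := fun x => by rw [eval_mul, eval_C]
  have hκ : γ ^ (1 - α) / (400 * ℓ ^ 2) = (γ ^ ((1 - α) / 2) / (20 * ℓ)) ^ 2 := by
    rw [div_pow, hg2]; ring
  have hsq : ∀ x ∈ Set.Icc γ 1,
      (1 - τ) * x ^ (α - 1) ≤ r.eval x ^ 2 ∧ r.eval x ^ 2 ≤ (1 + τ) * x ^ (α - 1) := by
    intro x hx
    have hx0 := hγ.trans_le hx.1
    have hz : 1 ≤ x ^ (-((1 - α) / 2)) :=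
      Real.one_le_rpow_of_pos_of_le_one_of_nonpos hx0 hx.2 (by linarith)
    have hz2 : (x ^ (-((1 - α) / 2))) ^ 2 = x ^ (α - 1) := by
      rw [← Real.rpow_natCast, ← Real.rpow_mul hx0.le]; congr 1; push_cast; ring
    rw [← hz2]
    exact sq_bounds_of_relative hz hτ hτ1 (happ x hx)
  -- The scaling is half the inverse of the global bound `10 ℓ γ^(-(1-α)/2)`; its square is `κ`.
  refine ⟨C (γ ^ ((1 - α) / 2) / (20 * ℓ)) * r, ?_, ⟨fun x hx => ?_, fun x hx => ?_,
    fun x hx => ?_⟩⟩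
  · have h1 : ((C (γ ^ ((1 - α) / 2) / (20 * ℓ)) * r).natDegree : ℝ) ≤ 30 * ℓ ^ 2 / γ :=
      le_trans (by exact_mod_cast natDegree_C_mul_le _ _) hdeg
    have h2 : 1 ≤ ℓ ^ 2 * (1 / γ) :=
      one_le_mul_of_one_le_of_one_le (one_le_pow₀ hℓ) (by rw [le_div_iff₀ hγ]; linarith)
    have h3 : 30 * ℓ ^ 2 / γ = 30 * (ℓ ^ 2 * (1 / γ)) := by ring
    linarith
  · rw [hev, abs_mul, abs_of_pos (by positivity)]
    calc γ ^ ((1 - α) / 2) / (20 * ℓ) * |r.eval x|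
        ≤ γ ^ ((1 - α) / 2) / (20 * ℓ) * (10 * ℓ * γ ^ (-((1 - α) / 2))) :=
          mul_le_mul_of_nonneg_left (hbound x hx) (by positivity)
      _ = 1 / 2 := by rw [hginv]; field_simp; norm_num
  · rw [hev, mul_pow, hκ, mul_left_comm]
    exact mul_le_mul_of_nonneg_left (hsq x hx).1 (by positivity)
  · rw [hev, mul_pow, hκ, mul_left_comm]
    exact mul_le_mul_of_nonneg_left (hsq x hx).2 (by positivity)

/-- Split `x^((α-1)/2) = x^k · x^(-s)` with `k` the exponent rounded up, so `0 ≤ s ≤ 1`. Since `k ≥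
1`, one factor `x` tames the approximation of `x^(-s)` and no power of `γ` is lost; the degree is
that of the approximation plus `k`, whence `α + 1/γ`. -/
theorem exists_isPowerApprox_of_one_lt {α γ τ : ℝ} (hα1 : 1 < α) (hγ : 0 < γ)
    (hγ1 : γ ≤ 1) (hτ : 0 < τ) (hτ1 : τ ≤ 1) :
    ∃ Q : ℝ[X], 4 * (Q.natDegree : ℝ) + 1 ≤
        121 * logFactor γ (τ / 4) ^ 2 * ((α * γ + 1) / γ) ∧
      IsPowerApprox α γ τ (1 / 16) Q := by
  obtain ⟨k, hk⟩ : ∃ k : ℕ, k = ⌈(α - 1) / 2⌉₊ := ⟨_, rfl⟩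
  have hk1 : (α - 1) / 2 ≤ k := hk ▸ Nat.le_ceil _
  have hk2 : (k : ℝ) < (α - 1) / 2 + 1 := hk ▸ Nat.ceil_lt_add_one (by linarith)
  have hk0 : 0 < k := by
    have : (0 : ℝ) < k := by linarith
    exact_mod_cast this
  obtain ⟨s, hs⟩ : ∃ s, s = k - (α - 1) / 2 := ⟨_, rfl⟩
  obtain ⟨r, hdeg, happ, -, hbound⟩ := exists_negPow_approx (s := s) (γ := γ)
    (τ := τ / 4) (by linarith) (by linarith) hγ hγ1 (by linarith) (by linarith)
  have hℓ : 1 ≤ logFactor γ (τ / 4) := one_le_logFactor hγ hγ1 (by linarith) (by linarith)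
  obtain ⟨ℓ, hℓdef⟩ : ∃ ℓ, ℓ = logFactor γ (τ / 4) := ⟨_, rfl⟩
  rw [← hℓdef] at hdeg hℓ ⊢
  have hev : ∀ x, (C (1 / 4) * (X ^ k * r)).eval x = 1 / 4 * (x ^ k * r.eval x) :=
    fun x => by simp
  have hsq : ∀ x ∈ Set.Icc γ 1,
      (1 - τ) * x ^ (α - 1) ≤ (x ^ k) ^ 2 * r.eval x ^ 2 ∧
        (x ^ k) ^ 2 * r.eval x ^ 2 ≤ (1 + τ) * x ^ (α - 1) := by
    intro x hx
    have hx0 := hγ.trans_le hx.1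
    have hz : 1 ≤ x ^ (-s) :=
      Real.one_le_rpow_of_pos_of_le_one_of_nonpos hx0 hx.2 (by linarith)
    have hz2 : x ^ (α - 1) = (x ^ k) ^ 2 * (x ^ (-s)) ^ 2 := by
      rw [← mul_pow, ← Real.rpow_natCast x k, ← Real.rpow_add hx0, ← Real.rpow_natCast,
        ← Real.rpow_mul hx0.le, hs]
      congr 1; push_cast; ring
    obtain ⟨h1, h2⟩ := sq_bounds_of_relative hz hτ hτ1 (happ x hx)
    rw [hz2]
    have h3 : 0 ≤ (x ^ k) ^ 2 := by positivity
    constructor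
    · rw [mul_left_comm]; exact mul_le_mul_of_nonneg_left h1 h3
    · rw [mul_left_comm]; exact mul_le_mul_of_nonneg_left h2 h3
  refine ⟨C (1 / 4) * (X ^ k * r), ?_, ⟨fun x hx => ?_, fun x hx => ?_, fun x hx => ?_⟩⟩
  · have h0 : (C (1 / 4) * (X ^ k * r) : ℝ[X]).natDegree ≤ k + r.natDegree :=
      (natDegree_C_mul_le _ _).trans (natDegree_mul_le.trans
        (Nat.add_le_add_right (natDegree_X_pow_le k) _))
    have h1 : ((C (1 / 4) * (X ^ k * r) : ℝ[X]).natDegree : ℝ) ≤ k + r.natDegree := by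
      exact_mod_cast h0
    have hℓ2 : 1 ≤ ℓ ^ 2 := one_le_pow₀ hℓ
    have h2 : 1 ≤ ℓ ^ 2 * (1 / γ) :=
      one_le_mul_of_one_le_of_one_le hℓ2 (by rw [le_div_iff₀ hγ]; linarith)
    have h3 : 30 * ℓ ^ 2 / γ = 30 * (ℓ ^ 2 * (1 / γ)) := by ring
    have h4 : 121 * ℓ ^ 2 * ((α * γ + 1) / γ) =
        121 * (ℓ ^ 2 * α) + 121 * (ℓ ^ 2 * (1 / γ)) := by field_simp
    have h5 : α ≤ ℓ ^ 2 * α := le_mul_of_one_le_left (by linarith) hℓ2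
    linarith
  · obtain ⟨k', rfl⟩ := Nat.exists_eq_succ_of_ne_zero hk0.ne'
    have hx1 : |x| ≤ 1 := abs_le.2 hx
    rw [hev, pow_succ, mul_assoc, abs_mul, abs_mul, abs_mul, abs_pow,
      abs_of_pos (by norm_num : (0 : ℝ) < 1 / 4)]
    have h1 : |x| ^ k' ≤ 1 := pow_le_one₀ (abs_nonneg x) hx1
    have h2 := hbound x hx
    have h3 : |x| ^ k' * (|x| * |r.eval x|) ≤ 1 * 2 :=
      mul_le_mul h1 h2 (by positivity) zero_le_one
    linarith
  · rw [hev, mul_pow, mul_pow]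
    have := (hsq x hx).1
    linarith
  · rw [hev, mul_pow, mul_pow]
    have := (hsq x hx).2
    linarith

end PowerApprox

/-! ### Absorbing constants and logarithms, and the final bounds -/

theorem renyiEstimable_of_one_lt_gamma {χ : Type} (circ : ∀ n m : ℕ, χ → Circuit n m)
    {α γ ε δ : ℝ} (hγ : 1 < γ) (B : ℝ → ℝ) : RenyiEstimable circ α γ ε δ B :=
  ⟨.output 0, fun _ _ _ _ hρ _ hspec => absurd (hρ.gamma_le_one hspec) (not_le.2 hγ)⟩

/-- Constant by which the logarithmic factor of the degree exceeds the one of the bound. -/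
def logConstant (M : ℝ) : ℝ := Real.log (64 * M ^ 2) / Real.log 2 + 1

theorem log_two_add_mul_le {a f : ℝ} (ha : 1 ≤ a) (hf : 0 < f) :
    Real.log (2 + a * f) ≤ (Real.log a / Real.log 2 + 1) * Real.log (2 + f) := by
  have h2 : 0 < Real.log 2 := Real.log_pos one_lt_two
  have h1 : Real.log (2 + a * f) ≤ Real.log a + Real.log (2 + f) := by
    rw [← Real.log_mul (by linarith) (by linarith)]
    apply Real.log_le_log (by positivity)
    nlinarith
  have h3 : Real.log 2 ≤ Real.log (2 + f) := Real.log_le_log two_pos (by linarith)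
  have h4 : Real.log a ≤ Real.log a / Real.log 2 * Real.log (2 + f) := by
    rw [div_mul_eq_mul_div, le_div_iff₀ h2]
    exact mul_le_mul_of_nonneg_left h3 (Real.log_nonneg ha)
  linarith

/-- The degree carries logarithms of `1/(γτ)`, which the bound may contain only through `log(2 +
f)`; this works because `1/(γβ) ≤ M f`. In `64 M²`, `64 = 16 · 4` comes from `τ/4`, one `M` from
capping `β` at 1 and the other from that inequality. -/
theorem le_softO {M γ β f Y K : ℝ} (hM : 1 ≤ M) (hγ : 0 < γ) (hγ1 : γ ≤ 1) (hβ : 0 < β)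
    (hβM : β ≤ M) (hK : 0 ≤ K) (hf : 1 / (γ * β) ≤ M * f)
    (hY : Y ≤ K * logFactor γ (min β 1 / 16 / 4) ^ 6 * f) :
    Y ≤ softO (K * logConstant M ^ 6) 6 f := by
  have hf0 : 0 < f := by
    have : 0 < M * f := lt_of_lt_of_le (by positivity) hf
    exact (mul_pos_iff_of_pos_left (by linarith)).1 this
  have hmin : 0 < min β 1 := lt_min hβ one_pos
  have hmin1 : min β 1 ≤ 1 := min_le_right _ _
  have hmin2 : β ≤ M * min β 1 := by
    rcases le_total β 1 with h | h
    · rw [min_eq_left h]; nlinarith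
    · rw [min_eq_right h]; linarith
  have hℓ0 : 1 ≤ logFactor γ (min β 1 / 16 / 4) :=
    one_le_logFactor hγ hγ1 (by positivity) (by linarith)
  have hℓ : logFactor γ (min β 1 / 16 / 4) ≤ logConstant M * Real.log (2 + f) := by
    refine le_trans ?_ (log_two_add_mul_le (a := 64 * M ^ 2) (by nlinarith) hf0)
    rw [logFactor]
    apply Real.log_le_log (by positivity)
    have h1 : 1 / (γ * (min β 1 / 16 / 4)) = 64 * (1 / (γ * min β 1)) := by field_simp; norm_num
    have h2 : 1 / (γ * min β 1) ≤ M * (1 / (γ * β)) := by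
      rw [← mul_div_assoc, mul_one, div_le_div_iff₀ (by positivity) (by positivity)]
      nlinarith
    have h3 : M * (1 / (γ * β)) ≤ M * (M * f) := mul_le_mul_of_nonneg_left hf (by linarith)
    rw [h1]
    nlinarith
  refine hY.trans ?_
  have h6 := pow_le_pow_left₀ (by linarith) hℓ 6
  rw [mul_pow] at h6
  rw [softO]
  calc K * logFactor γ (min β 1 / 16 / 4) ^ 6 * f
      ≤ K * (logConstant M ^ 6 * Real.log (2 + f) ^ 6) * f :=
        mul_le_mul_of_nonneg_right (mul_le_mul_of_nonneg_left h6 hK) hf0.le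
    _ = _ := by ring

section Cost

variable {M γ δ ℓ A D g T κ β τ : ℝ}

/-- The actual cost has only the first power of `g T` in the denominator; `g T ≤ 1` weakens it to
the square that appears in `η²`. Four logarithms occur, two from the degree and two from `κ`, padded
to six to match the other setting. -/
theorem measurement_cost_le (hM : 1 ≤ M) (hδ : 0 < δ) (hℓ : 1 ≤ ℓ) (hA : 0 < A)
    (hD : D ≤ 121 * ℓ ^ 2 * A) (hg : 0 < g) (hκ : g / (400 * ℓ ^ 2) ≤ κ) (hT : 0 < T)
    (hgT : g * T ≤ 1) (hβ : 0 < β) (hτ : β ≤ 16 * M * τ) :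
    8 * D / (δ * τ ^ 2 * (κ * T)) ≤ 10 ^ 11 * M ^ 2 / δ * ℓ ^ 6 * (A / (g * T * β) ^ 2) := by
  have hτ' : β / (16 * M) ≤ τ := by
    rw [div_le_iff₀ (by positivity)]; linarith
  have hτ0 : 0 < β / (16 * M) := by positivity
  have hκ0 : 0 < g / (400 * ℓ ^ 2) := by positivity
  have hτpos := hτ0.trans_le hτ'
  have hκpos := hκ0.trans_le hκ
  calc 8 * D / (δ * τ ^ 2 * (κ * T))
      ≤ 8 * (121 * ℓ ^ 2 * A) / (δ * (β / (16 * M)) ^ 2 * (g / (400 * ℓ ^ 2) * T)) := by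
        gcongr
    _ = 8 * 121 * 400 * 256 * M ^ 2 / δ * ℓ ^ 4 * (A * (g * T) / (g * T * β) ^ 2) := by
        field_simp
        norm_num
    _ ≤ 10 ^ 11 * M ^ 2 / δ * ℓ ^ 6 * (A * 1 / (g * T * β) ^ 2) := by
        gcongr
        · norm_num
        · norm_num
    _ = _ := by rw [mul_one]

/-- The six logarithms: two from rounds and repetitions, two from the degree, two from the
normalization `κ`. -/
theorem amplitudeEstimation_cost_le (hM : 1 ≤ M) (hδ : 0 < δ) (hℓ : 1 ≤ ℓ) (hA : 0 < A)
    (hD : D ≤ 121 * ℓ ^ 2 * A) (hg : 0 < g) (hκ : g / (400 * ℓ ^ 2) ≤ κ) (hT : 0 < T)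
    (hβ : 0 < β) (hτ : β ≤ 16 * M * τ) :
    20000 * ℓ ^ 2 * D / (δ * τ * (κ * T)) ≤
      10 ^ 11 * M ^ 2 / δ * ℓ ^ 6 * (A / (g * T * β)) := by
  have hτ' : β / (16 * M) ≤ τ := by
    rw [div_le_iff₀ (by positivity)]; linarith
  have hτ0 : 0 < β / (16 * M) := by positivity
  have hκ0 : 0 < g / (400 * ℓ ^ 2) := by positivity
  have hτpos := hτ0.trans_le hτ'
  have hκpos := hκ0.trans_le hκ
  calc 20000 * ℓ ^ 2 * D / (δ * τ * (κ * T))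
      ≤ 20000 * ℓ ^ 2 * (121 * ℓ ^ 2 * A) / (δ * (β / (16 * M)) * (g / (400 * ℓ ^ 2) * T)) := by
        gcongr
    _ = 20000 * 121 * 400 * 16 * M ^ 1 / δ * ℓ ^ 6 * (A / (g * T * β)) := by
        field_simp
    _ ≤ 10 ^ 11 * M ^ 2 / δ * ℓ ^ 6 * (A / (g * T * β)) := by
        gcongr
        · norm_num
        · norm_num

theorem inv_le_measurement_bound (hM : 1 ≤ M) (hγ : 0 < γ) (hA : 1 / γ ≤ A) (hg : 0 < g)
    (hT : 0 < T) (hgT : g * T ≤ 1) (hβ : 0 < β) (hβM : β ≤ M) :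
    1 / (γ * β) ≤ M * (A / (g * T * β) ^ 2) := by
  have hA0 : 0 < A := lt_of_lt_of_le (by positivity) hA
  calc 1 / (γ * β) = 1 / γ * 1 / (1 * β) := by field_simp
    _ = β * (1 / γ / (1 * β) ^ 2) := by field_simp
    _ ≤ M * (A / (g * T * β) ^ 2) := by gcongr

theorem inv_le_amplitudeEstimation_bound (hM : 1 ≤ M) (hγ : 0 < γ) (hA : 1 / γ ≤ A)
    (hg : 0 < g) (hT : 0 < T) (hgT : g * T ≤ 1) (hβ : 0 < β) :
    1 / (γ * β) ≤ M * (A / (g * T * β)) := by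
  have hA0 : 0 < A := lt_of_lt_of_le (by positivity) hA
  calc 1 / (γ * β) = 1 * (1 / γ / (1 * β)) := by field_simp
    _ ≤ M * (A / (g * T * β)) := by gcongr

theorem log_inv_le_logFactor (hγ : 0 < γ) (hγ1 : γ ≤ 1) (hτ : 0 < τ) :
    Real.log (1 / τ) ≤ logFactor γ (τ / 4) := by
  rw [logFactor]
  apply Real.log_le_log (by positivity)
  have : 1 / τ ≤ 1 / (γ * (τ / 4)) :=
    one_div_le_one_div_of_le (by positivity) (by nlinarith)
  linarith

end Cost

theorem one_le_logConstant {M : ℝ} (hM : 1 ≤ M) : 1 ≤ logConstant M := by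
  have h : 0 ≤ Real.log (64 * M ^ 2) / Real.log 2 :=
    div_nonneg (Real.log_nonneg (by nlinarith)) (Real.log_nonneg one_le_two)
  rw [logConstant]
  linarith

section Estimability

variable {α γ ε δ M κ g A : ℝ} {Q : Polynomial ℝ}

/-- Both estimation settings, from a polynomial approximation whose degree is of order `A` and
whose normalization is of order `g`. -/
theorem estimable_of_isPowerApprox (hα : 0 < α) (hα1 : α ≠ 1) (hγ : 0 < γ) (hγ1 : γ ≤ 1)
    (hε : 0 < ε) (hδ : 0 < δ) (hδ1 : δ < 1) (hM : 1 ≤ M) (hεM : |1 - α| * ε ≤ M)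
    (hA : 1 / γ ≤ A) (hg : 0 < g)
    (hκ : g / (400 * logFactor γ (min (|1 - α| * ε) 1 / 16 / 4) ^ 2) ≤ κ)
    (hQ : IsPowerApprox α γ (min (|1 - α| * ε) 1 / 16) κ Q)
    (hd : 4 * (Q.natDegree : ℝ) + 1 ≤
      121 * logFactor γ (min (|1 - α| * ε) 1 / 16 / 4) ^ 2 * A)
    (hgT : ∀ (n : ℕ) (ρ : Matrix (Reg n) (Reg n) ℂ), IsDensityMatrix ρ →
      (∀ p ∈ spectrum ℝ ρ, p ≠ 0 → γ ≤ p) → 0 < tracePow α ρ ∧ g * tracePow α ρ ≤ 1) :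
    EstimableByMeasurement α γ ε δ (fun η =>
        softO (10 ^ 11 * M ^ 2 / δ * logConstant M ^ 6) 6 (A / g ^ 2 / ε ^ 2 * η ^ 2)) ∧
      EstimableByAmplitudeEstimation α γ ε δ (fun η =>
        softO (10 ^ 11 * M ^ 2 / δ * logConstant M ^ 6) 6 (A / g / ε * η)) := by
  have hk : 0 < |1 - α| := abs_pos.2 (sub_ne_zero.2 hα1.symm)
  have hβ : 0 < |1 - α| * ε := mul_pos hk hε
  obtain ⟨τ, hτdef⟩ : ∃ τ, τ = min (|1 - α| * ε) 1 / 16 := ⟨_, rfl⟩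
  have hmin : 0 < min (|1 - α| * ε) 1 := lt_min hβ one_pos
  have hτ : 0 < τ := by rw [hτdef]; positivity
  have hτ1 : τ ≤ 1 / 16 := by rw [hτdef]; linarith [min_le_right (|1 - α| * ε) 1]
  have hτε : 16 * τ ≤ |1 - α| * ε := by rw [hτdef]; linarith [min_le_left (|1 - α| * ε) 1]
  have hβτ : |1 - α| * ε ≤ 16 * M * τ := by
    have h16 : 16 * M * τ = M * min (|1 - α| * ε) 1 := by rw [hτdef]; ring
    rw [h16]
    rcases le_total (|1 - α| * ε) 1 with h | h
    · rw [min_eq_left h]; nlinarith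
    · rw [min_eq_right h]; linarith
  have hℓ : 1 ≤ logFactor γ (τ / 4) := one_le_logFactor hγ hγ1 (by linarith) (by linarith)
  have hA0 : 0 < A := lt_of_lt_of_le (by positivity) hA
  have hK : 0 ≤ 10 ^ 11 * M ^ 2 / δ := by positivity
  rw [← hτdef] at hκ hQ hd
  have hκ0 : 0 < κ := lt_of_lt_of_le (by positivity) hκ
  constructor
  · refine estimableByMeasurement_of_approx hα hα1 hγ hδ hδ1 hτ hτ1 hτε hκ0 hQ le_rfl
      fun n ρ hρ hspec => ?_
    obtain ⟨hT, hgT⟩ := hgT n ρ hρ hspec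
    have hf : A / g ^ 2 / ε ^ 2 * renyiEta α ρ ^ 2 =
        A / (g * tracePow α ρ * (|1 - α| * ε)) ^ 2 := by
      rw [renyiEta]; field_simp
    simp only [hf]
    refine le_softO hM hγ hγ1 hβ hεM hK
      (inv_le_measurement_bound hM hγ hA hg hT hgT hβ hεM) ?_
    rw [← hτdef]
    exact measurement_cost_le hM hδ hℓ hA0 hd hg hκ hT hgT hβ hβτ
  · refine estimableByAmplitudeEstimation_of_approx hα hα1 hγ hδ hδ1 hτ hτ1 hτε hκ0 hℓ
      (log_inv_le_logFactor hγ hγ1 hτ) hQ le_rfl fun n ρ hρ hspec => ?_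
    obtain ⟨hT, hgT⟩ := hgT n ρ hρ hspec
    have hf : A / g / ε * renyiEta α ρ = A / (g * tracePow α ρ * (|1 - α| * ε)) := by
      rw [renyiEta]; field_simp
    simp only [hf]
    refine le_softO hM hγ hγ1 hβ hεM hK
      (inv_le_amplitudeEstimation_bound hM hγ hA hg hT hgT hβ) ?_
    rw [← hτdef]
    exact amplitudeEstimation_cost_le hM hδ hℓ hA0 hd hg hκ hT hβ hβτ

end Estimability

theorem theorem7 :
    ∃ k : ℕ, ∀ δ M : ℝ, 0 < δ → δ < 1 → 0 < M → ∃ C : ℝ, 0 < C ∧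
      ∀ α γ ε : ℝ, 0 < α → 0 < γ → 0 < ε → |1 - α| * ε ≤ M →
        (α < 1 →
          EstimableByMeasurement α γ ε δ
              (fun η => softO C k (1 / (γ ^ (3 - 2 * α) * ε ^ 2) * η ^ 2)) ∧
            EstimableByAmplitudeEstimation α γ ε δ
              (fun η => softO C k (1 / (γ ^ (2 - α) * ε) * η))) ∧
        (1 < α →
          EstimableByMeasurement α γ ε δ
              (fun η => softO C k ((α * γ + 1) / (γ * ε ^ 2) * η ^ 2)) ∧
            EstimableByAmplitudeEstimation α γ ε δ
              (fun η => softO C k ((α * γ + 1) / (γ * ε) * η))) := by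
  refine ⟨6, fun δ M hδ hδ1 hM => ?_⟩
  -- Enlarging `M` to at least 1 is harmless and is what the cost estimates assume.
  obtain ⟨N, hN⟩ : ∃ N, N = max 1 M := ⟨_, rfl⟩
  have hN1 : 1 ≤ N := hN ▸ le_max_left _ _
  have hlog := one_le_logConstant hN1
  refine ⟨10 ^ 11 * N ^ 2 / δ * logConstant N ^ 6, by positivity,
    fun α γ ε hα hγ hε hεM => ?_⟩
  rcases lt_or_ge 1 γ with hγ1 | hγ1
  · exact ⟨fun _ => ⟨renyiEstimable_of_one_lt_gamma _ hγ1 _, renyiEstimable_of_one_lt_gamma _ hγ1 _⟩,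
      fun _ => ⟨renyiEstimable_of_one_lt_gamma _ hγ1 _, renyiEstimable_of_one_lt_gamma _ hγ1 _⟩⟩
  have hεN : |1 - α| * ε ≤ N := hεM.trans (hN ▸ le_max_right _ _)
  have hmin1 := min_le_right (|1 - α| * ε) 1
  constructor
  · intro hα1
    have hmin : 0 < min (|1 - α| * ε) 1 :=
      lt_min (mul_pos (abs_pos.2 (by linarith)) hε) one_pos
    obtain ⟨Q, hd, hQ⟩ := exists_isPowerApprox_of_lt_one hα hα1 hγ hγ1
      (τ := min (|1 - α| * ε) 1 / 16) (by positivity) (by linarith)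
    have hg : 0 < γ ^ (1 - α) := Real.rpow_pos_of_pos hγ _
    have key := estimable_of_isPowerApprox hα hα1.ne hγ hγ1 hε hδ hδ1 hN1 hεN le_rfl hg le_rfl
      hQ hd fun n ρ hρ hspec => by
        obtain ⟨h1, h2⟩ := hρ.tracePow_bounds_of_lt_one hspec hα hα1 hγ
        refine ⟨by linarith, (mul_le_mul_of_nonneg_left h2 hg.le).trans_eq ?_⟩
        rw [← Real.rpow_add hγ]
        simp
    -- The stated exponents are `γ g²` and `γ g` with `g = γ^(1-α)`: degree `1/γ` times the loss
    -- from normalization.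
    have e1 : γ ^ (3 - 2 * α) = γ * (γ ^ (1 - α)) ^ 2 := by
      rw [← Real.rpow_mul_natCast hγ.le, ← Real.rpow_one_add' hγ.le (by push_cast; linarith)]
      congr 1; push_cast; ring
    have e2 : γ ^ (2 - α) = γ * γ ^ (1 - α) := by
      rw [← Real.rpow_one_add' hγ.le (by linarith)]
      congr 1; ring
    rw [e1, e2]
    simpa only [div_div, mul_assoc] using key
  · intro hα1
    have hmin : 0 < min (|1 - α| * ε) 1 :=
      lt_min (mul_pos (abs_pos.2 (by linarith)) hε) one_pos
    obtain ⟨Q, hd, hQ⟩ := exists_isPowerApprox_of_one_lt hα1 hγ hγ1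
      (τ := min (|1 - α| * ε) 1 / 16) (by positivity) (by linarith)
    have hℓ : 1 ≤ logFactor γ (min (|1 - α| * ε) 1 / 16 / 4) :=
      one_le_logFactor hγ hγ1 (by positivity) (by linarith)
    have key := estimable_of_isPowerApprox (g := 1) hα hα1.ne' hγ hγ1 hε hδ hδ1 hN1 hεN
      (by gcongr; nlinarith)
      one_pos (one_div_le_one_div_of_le (by norm_num) (by nlinarith)) hQ hd
      fun n ρ hρ hspec => by
        obtain ⟨h1, h2⟩ := hρ.tracePow_bounds_of_one_lt hspec hα1 hγ
        exact ⟨(Real.rpow_pos_of_pos hγ _).trans_le h1, by rwa [one_mul]⟩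
    simpa only [one_pow, div_one, div_div] using key

end
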